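/- Let $d\ge 0$, $0\le n\le d$ be integers and $m\in\mathbb R$. Notation. For $g\in\mathscr S(\mathbb R^d)$ put $T_xg(y)=g(y-x)$, $M_\xi g(y)=e^{i\langle y,\xi\rangle}g(y)$, and for $u\in\mathscr S'(\mathbb R^d)$ let $$\mathcal T_gu(x,\xi)=(2\pi)^{-d/2}\,\langle u,\overline{T_xM_\xi g}\rangle,\qquad (x,\xi)\in T^*\mathbb R^d=\mathbb R^d\times\mathbb R^d.$$ For a linear subspace $Y\subseteq\mathbb R^d$ let $\pi_{Y^\perp}$ be the orthogonal projection onto $Y^\perp$, let $N(Y)=Y\times Y^\perp\subseteq T^*\mathbb R^d$ and $\mathcal T_g^Yu(x,\xi)=e^{-i\langle\pi_{Y^\perp}x,\xi\rangle}\mathcal T_gu(x,\xi)$. Let $V\subseteq T^*\mathbb R^d$ be a linear subspace with $N(Y)\oplus V=T^*\mathbb R^d$. A tempered distribution $u\in\mathscr S'(\mathbb R^d)$ is *$\Gamma$-conormal to $Y$ of degree $m$*, written $u\in I^m_\Gamma(\mathbb R^d,Y)$, if there is $g\in\mathscr S(\mathbb R^d)\setminus\{0\}$ such that for all integers $k,N\ge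 0$ and all $b_1,\dots,b_k\in N(Y)$ there is a constant $C$ such that, with $L_j=\langle b_j,\nabla_{x,\xi}\rangle$ and for all $(x,\xi)\in T^*\mathbb R^d$, $$|L_1\cdots L_k\mathcal T_g^Yu(x,\xi)|\le C\,\bigl(1+\mathrm{dist}((x,\xi),V)\bigr)^{m-k}\bigl(1+\mathrm{dist}((x,\xi),N(Y))\bigr)^{-N}.$$ The statements below hold for every choice of the complement $V$. The Shubin class $\Gamma^m(\mathbb R^d)$ consists of all $a\in C^\infty(\mathbb R^d)$ such that for each multi-index $\alpha$ there is $C_\alpha$ with $|\partial^\alpha a(z)|\le C_\alpha(1+|z|^2)^{(m-|\alpha|)/2}$ for all $z\in\mathbb R^d$. An identity $u(x)=\int_{\mathbb R^{d-n}}e^{i\Phi(x,\theta)}A(x,\theta)\,d\theta$ is understood as an oscillatory integral: for every $\varphi\in\mathscr S(\mathbb R^d)$, $\langle u,\varphi\rangle=\int_{\mathbb R^{d-n}}\bigl(\int_{\mathbb R^d}e^{i\Phi(x,\theta)}A(x,\theta)\varphi(x)\,dx\bigr)d\theta$, each of the two successive integrals being absolutely convergent. **Theorem.** Let $u\in\mathscr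 S'(\mathbb R^d)$. 1. Let $Y\subseteq\mathbb R^d$ be an $n$-dimensional linear subspace. Call real matrices $M_1$ of size $d\times n$ and $M_2$ of size $d\times(d-n)$ *adapted to $Y$* if $Y=\mathrm{Ker}\,M_2^t$ and $[M_1\ M_2]$ is invertible. Then $u\in I^m_\Gamma(\mathbb R^d,Y)$ if and only if $$u(x)=\int_{\mathbb R^{d-n}}e^{i\langle M_2^tx,\theta\rangle}\,a(M_1^tx,\theta)\,d\theta\qquad(*)$$ for some $M_1,M_2$ adapted to $Y$ and some $a\in\Gamma^m(\mathbb R^d)$. Moreover, for every given pair $M_1,M_2$ adapted to $Y$, $u\in I^m_\Gamma(\mathbb R^d,Y)$ if and only if $(*)$ holds for some $a\in\Gamma^m(\mathbb R^d)$. 2. Write $x=(x_1,x_2)\in\mathbb R^n\times\mathbb R^{d-n}$. Then $u\in I^m_\Gamma(\mathbb R^d,\mathbb R^n\times\{0\})$ if and only if $$u(x)=(2\pi)^{-(d-n)/2}\int_{\mathbb R^{d-n}}e^{i\langle x_2,\theta\rangle}a(x_1,\theta)\,d\theta\qquad(**)$$ for some $a\in\Gamma^m(\mathbb R^d)$. For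 $a\in\Gamma^m(\mathbb R^d)$, the identity $(**)$ is equivalent to $u=\mathscr F_2^{-1}a$, the partial inverse Fourier transform of $a$ in the last $d-n$ variables; that is, to: for all $\varphi\in\mathscr S(\mathbb R^d)$, $a\,\mathscr F_2^{-1}\varphi$ is integrable and $\langle u,\varphi\rangle=\int_{\mathbb R^d}a(z)\,\mathscr F_2^{-1}\varphi(z)\,dz$, where $\mathscr F_2^{-1}\varphi(x_1,\theta)=(2\pi)^{-(d-n)/2}\int_{\mathbb R^{d-n}}e^{i\langle y,\theta\rangle}\varphi(x_1,y)\,dy$. -/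

import Mathlib

open MeasureTheory
open scoped SchwartzMap ContDiff

noncomputable section

/-- The space `ℝᵈ` with its Euclidean inner product. -/
abbrev Rd (d : ℕ) : Type := EuclideanSpace ℝ (Fin d)

/-- The phase space `T*ℝᵈ = ℝᵈ × ℝᵈ` of pairs `(x, ξ)`, with the Euclidean norm of `ℝ²ᵈ`. -/
abbrev PhaseSpace (d : ℕ) : Type := WithLp 2 (Rd d × Rd d)

theorem iteratedDeriv_exp_I_mul (j : ℕ) :
    iteratedDeriv j (fun t : ℝ => Complex.exp (Complex.I * (t : ℂ)))
      = fun t : ℝ => Complex.I ^ j * Complex.exp (Complex.I * (t : ℂ)) := by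
  induction j with
  | zero => funext t; simp
  | succ j ih =>
    funext t
    rw [iteratedDeriv_succ, ih]
    have h : HasDerivAt (fun t : ℝ => Complex.I * (t : ℂ)) (Complex.I * 1) t :=
      (Complex.ofRealCLM.hasDerivAt (x := t)).const_mul Complex.I
    rw [(h.cexp.const_mul (Complex.I ^ j)).deriv]
    ring

theorem hasTemperateGrowth_exp_I_mul :
    Function.HasTemperateGrowth (fun t : ℝ => Complex.exp (Complex.I * (t : ℂ))) := by
  refine ⟨?_, fun j => ⟨0, 1, fun t => ?_⟩⟩
  · exact (contDiff_const.mul Complex.ofRealCLM.contDiff).cexp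
  · rw [norm_iteratedFDeriv_eq_norm_iteratedDeriv, iteratedDeriv_exp_I_mul]
    simp [Complex.norm_exp]

theorem hasTemperateGrowth_modulation {d : ℕ} (ξ : Rd d) :
    Function.HasTemperateGrowth
      (fun y : Rd d => Complex.exp (Complex.I * ((inner ℝ y ξ : ℝ) : ℂ))) :=
  hasTemperateGrowth_exp_I_mul.comp (Function.hasTemperateGrowth_inner_left ξ)

/-- Modulation `M_ξ g (y) = e^{i⟨y, ξ⟩} g(y)` on the Schwartz space. -/
def modulation {d : ℕ} (ξ : Rd d) (g : 𝓢(Rd d, ℂ)) : 𝓢(Rd d, ℂ) :=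
  SchwartzMap.smulLeftCLM ℂ
    (fun y : Rd d => Complex.exp (Complex.I * ((inner ℝ y ξ : ℝ) : ℂ))) g

/-- Translation `T_x g (y) = g(y - x)` on the Schwartz space. -/
def translation {d : ℕ} (x : Rd d) (g : 𝓢(Rd d, ℂ)) : 𝓢(Rd d, ℂ) :=
  SchwartzMap.compSubConstCLM ℂ x g

/-- Complex conjugation on the Schwartz space. -/
def schwartzConj {d : ℕ} (g : 𝓢(Rd d, ℂ)) : 𝓢(Rd d, ℂ) :=
  SchwartzMap.postcompCLM (𝕜 := ℝ) Complex.conjCLE.toContinuousLinearMap g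

theorem modulation_apply {d : ℕ} (ξ : Rd d) (g : 𝓢(Rd d, ℂ)) (y : Rd d) :
    modulation ξ g y = Complex.exp (Complex.I * ((inner ℝ y ξ : ℝ) : ℂ)) * g y := by
  simp [modulation, SchwartzMap.smulLeftCLM_apply_apply (hasTemperateGrowth_modulation ξ)]

theorem translation_apply {d : ℕ} (x : Rd d) (g : 𝓢(Rd d, ℂ)) (y : Rd d) :
    translation x g y = g (y - x) := rfl

theorem schwartzConj_apply {d : ℕ} (g : 𝓢(Rd d, ℂ)) (y : Rd d) :
    schwartzConj g y = (starRingEnd ℂ) (g y) := rfl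

/-- The FBI type transform `𝒯_g u(x, ξ) = (2π)^{-d/2} (u, T_x M_ξ g)` of a tempered distribution,
where `(u, v) = ⟨u, conj v⟩` is the sesquilinear pairing. -/
def fbiTransform {d : ℕ} (g : 𝓢(Rd d, ℂ)) (u : 𝓢'(Rd d, ℂ)) (z : PhaseSpace d) : ℂ :=
  (((2 * Real.pi) ^ (-(d : ℝ) / 2) : ℝ) : ℂ) *
    u (schwartzConj (translation z.fst (modulation z.snd g)))

/-- The twisted transform `𝒯_g^Y u(x, ξ) = e^{-i⟨π_{Y^⊥} x, ξ⟩} 𝒯_g u(x, ξ)`. -/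
def fbiTransformAlong {d : ℕ} (Y : Submodule ℝ (Rd d)) (g : 𝓢(Rd d, ℂ)) (u : 𝓢'(Rd d, ℂ))
    (z : PhaseSpace d) : ℂ :=
  Complex.exp (-Complex.I * ((inner ℝ (Yᗮ.starProjection z.fst) z.snd : ℝ) : ℂ)) *
    fbiTransform g u z

/-- The conormal space `N(Y) = Y × Y^⊥ ⊆ T*ℝᵈ`. -/
def conormalSpace {d : ℕ} (Y : Submodule ℝ (Rd d)) : Submodule ℝ (PhaseSpace d) where
  carrier := {z | z.fst ∈ Y ∧ z.snd ∈ Yᗮ}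
  add_mem' := fun ha hb => ⟨Y.add_mem ha.1 hb.1, Yᗮ.add_mem ha.2 hb.2⟩
  zero_mem' := ⟨Y.zero_mem, Yᗮ.zero_mem⟩
  smul_mem' := fun c _ ha => ⟨Y.smul_mem c ha.1, Yᗮ.smul_mem c ha.2⟩

/-- `u` is `Γ`-conormal to `Y` of degree `m`, with respect to a complement `V` of `N(Y)` in
`T*ℝᵈ`: for some window `g ∈ 𝓢 \ 0`, for all `k, N ∈ ℕ` and all constant vector fields
`L_j = ⟨b_j, ∇_{x,ξ}⟩` with `b_j ∈ N(Y)`,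
`|L_1 ⋯ L_k 𝒯_g^Y u(z)| ≲ (1 + dist(z, V))^{m-k} (1 + dist(z, N(Y)))^{-N}` for `z ∈ T*ℝᵈ`.
The value `L_1 ⋯ L_k F(z)` is the `k`-th derivative of `F` at `z` on `(b_1, …, b_k)`. -/
def IsGammaConormal {d : ℕ} (m : ℝ) (Y : Submodule ℝ (Rd d)) (V : Submodule ℝ (PhaseSpace d))
    (u : 𝓢'(Rd d, ℂ)) : Prop :=
  ∃ g : 𝓢(Rd d, ℂ), g ≠ 0 ∧
    ∀ (k N : ℕ) (b : Fin k → PhaseSpace d), (∀ j, b j ∈ conormalSpace Y) →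
      ∃ C : ℝ, ∀ z : PhaseSpace d,
        ‖iteratedFDeriv ℝ k (fbiTransformAlong Y g u) z b‖ ≤
          C * (1 + Metric.infDist z (V : Set (PhaseSpace d))) ^ (m - (k : ℝ)) *
            (1 + Metric.infDist z (conormalSpace Y : Set (PhaseSpace d))) ^ (-(N : ℝ))

/-- The Shubin class `Γ^m(ℝᵈ)`: smooth `a` with `|∂^α a(z)| ≲ ⟨z⟩^{m-|α|}` for every `α`,
where `⟨z⟩ = (1 + |z|²)^{1/2}`. -/
def IsShubinSymbol {d : ℕ} (m : ℝ) (a : Rd d → ℂ) : Prop :=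
  ContDiff ℝ ∞ a ∧
    ∀ k : ℕ, ∃ C : ℝ, ∀ z : Rd d,
      ‖iteratedFDeriv ℝ k a z‖ ≤ C * Real.sqrt (1 + ‖z‖ ^ 2) ^ (m - (k : ℝ))

/-- The point `(y, θ) ∈ ℝⁿ⁺ᵏ` for `y ∈ ℝⁿ` and `θ ∈ ℝᵏ`. -/
def joinVec {n k : ℕ} (y : Rd n) (θ : Rd k) : Rd (n + k) :=
  WithLp.toLp 2 (Fin.append y.ofLp θ.ofLp)

/-- The first component `x₁ ∈ ℝⁿ` of `x = (x₁, x₂) ∈ ℝⁿ⁺ᵏ`. -/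
def fstVec {n k : ℕ} (x : Rd (n + k)) : Rd n :=
  WithLp.toLp 2 (fun i => x (Fin.castAdd k i))

/-- The second component `x₂ ∈ ℝᵏ` of `x = (x₁, x₂) ∈ ℝⁿ⁺ᵏ`. -/
def sndVec {n k : ℕ} (x : Rd (n + k)) : Rd k :=
  WithLp.toLp 2 (fun i => x (Fin.natAdd n i))

/-- The coordinate subspace `ℝⁿ × {0} ⊆ ℝⁿ⁺ᵏ`. -/
def coordSubspace (n k : ℕ) : Submodule ℝ (Rd (n + k)) where
  carrier := {x | sndVec x = 0}
  add_mem' := fun {a b} ha hb => by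
    have h : sndVec (a + b) = sndVec a + sndVec b := rfl
    simp only [Set.mem_ofPred_eq] at ha hb ⊢
    rw [h, ha, hb, add_zero]
  zero_mem' := rfl
  smul_mem' := fun c a ha => by
    have h : sndVec (c • a) = c • sndVec a := rfl
    simp only [Set.mem_ofPred_eq] at ha ⊢
    rw [h, ha, smul_zero]

/-- The block matrix `[M₁ M₂]`. -/
def blockMatrix {n k : ℕ} (M₁ : Matrix (Fin (n + k)) (Fin n) ℝ)
    (M₂ : Matrix (Fin (n + k)) (Fin k) ℝ) : Matrix (Fin (n + k)) (Fin (n + k)) ℝ :=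
  Matrix.of fun i => Fin.append (M₁ i) (M₂ i)

/-- The tempered distribution `u` is the oscillatory integral
`u(x) = ∫_{ℝᵏ} e^{i Φ(x, θ)} A(x, θ) dθ`: for every test function `φ`,
`⟨u, φ⟩ = ∫ (∫ e^{i Φ(x, θ)} A(x, θ) φ(x) dx) dθ`, where both integrations converge absolutely. -/
def IsOscillatoryIntegral {d k : ℕ} (Φ : Rd d → Rd k → ℝ) (A : Rd d → Rd k → ℂ)
    (u : 𝓢'(Rd d, ℂ)) : Prop :=
  ∀ φ : 𝓢(Rd d, ℂ),
    (∀ θ : Rd k, Integrable (fun x => Complex.exp (Complex.I * (Φ x θ : ℂ)) * A x θ * φ x)) ∧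
    Integrable (fun θ => ∫ x, Complex.exp (Complex.I * (Φ x θ : ℂ)) * A x θ * φ x) ∧
    u φ = ∫ θ, ∫ x, Complex.exp (Complex.I * (Φ x θ : ℂ)) * A x θ * φ x

/-- The partial inverse Fourier transform in the last `k` variables of a test function,
`𝓕₂⁻¹ φ (x₁, θ) = (2π)^{-k/2} ∫_{ℝᵏ} e^{i⟨y, θ⟩} φ(x₁, y) dy`. -/
def partialFourierInv {n k : ℕ} (φ : 𝓢(Rd (n + k), ℂ)) (z : Rd (n + k)) : ℂ :=
  (((2 * Real.pi) ^ (-(k : ℝ) / 2) : ℝ) : ℂ) *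
    ∫ y : Rd k, Complex.exp (Complex.I * ((inner ℝ y (sndVec z) : ℝ) : ℂ)) *
      φ (joinVec (fstVec z) y)

/-- `u = 𝓕₂⁻¹ a` in the sense of tempered distributions: `⟨u, φ⟩ = ⟨a, 𝓕₂⁻¹ φ⟩` for every test
function `φ`, the function `a` acting by integration. -/
def IsPartialFourierInv {n k : ℕ} (a : Rd (n + k) → ℂ) (u : 𝓢'(Rd (n + k), ℂ)) : Prop :=
  ∀ φ : 𝓢(Rd (n + k), ℂ),
    Integrable (fun z => a z * partialFourierInv φ z) ∧
    u φ = ∫ z, a z * partialFourierInv φ z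

/-- `M₁`, `M₂` are adapted to `Y`: `Y = Ker M₂ᵗ` and `[M₁ M₂]` is invertible. -/
def IsAdapted {n k : ℕ} (Y : Submodule ℝ (Rd (n + k))) (M₁ : Matrix (Fin (n + k)) (Fin n) ℝ)
    (M₂ : Matrix (Fin (n + k)) (Fin k) ℝ) : Prop :=
  Y = LinearMap.ker M₂.transpose.toEuclideanLin ∧ IsUnit (blockMatrix M₁ M₂)

/-- `u(x) = ∫_{ℝᵏ} e^{i⟨M₂ᵗ x, θ⟩} a(M₁ᵗ x, θ) dθ` as an oscillatory integral. -/
def IsLinearOscillatoryIntegral {n k : ℕ} (M₁ : Matrix (Fin (n + k)) (Fin n) ℝ)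
    (M₂ : Matrix (Fin (n + k)) (Fin k) ℝ) (a : Rd (n + k) → ℂ) (u : 𝓢'(Rd (n + k), ℂ)) : Prop :=
  IsOscillatoryIntegral
    (fun (x : Rd (n + k)) (θ : Rd k) => inner ℝ (M₂.transpose.toEuclideanLin x) θ)
    (fun (x : Rd (n + k)) (θ : Rd k) => a (joinVec (M₁.transpose.toEuclideanLin x) θ)) u

end

/-! ### Differentiation of all orders under the integral sign -/

section ParametricIntegral

variable {X E α : Type*} [NormedAddCommGroup X] [NormedSpace ℝ X] [NormedAddCommGroup E]
  [NormedSpace ℝ E] [MeasurableSpace α] {μ : Measure α}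

/-! Put d = n + k and take a linear automorphism A of ℝᵈ with Y = {x : (Ax)₂ = 0}; for adapted
matrices, (Ax)₁ = M₁ᵗx and (Ax)₂ = M₂ᵗx. After the change of variables y = Ax and a partial Fourier
transform in the last k variables, u becomes a functional v on the Schwartz space
(`symbolFunctional`), and (*) says exactly that v is integration against a
(`IsShubinSymbol.isOscillatoryIntegral_iff_symbolFunctional`). The inverse partial Fourier transform
P preserves Schwartz functions and a grows polynomially, so every integral involved converges
absolutely.

Phase space undergoes the matching change. With (x, ξ) = (A⁻¹(p₁, q₂), Aᵗ(-q₁, p₂)) (`phaseEquiv`),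
the transform 𝒯_g u becomes, up to a constant and the phase e^{i⟨q₂, p₂⟩}, the short time transform
(p, q) ↦ ⟨v, T_p M_q h⟩ with window h = P(ḡ ∘ A⁻¹). The twist by π_{Y^⊥} replaces this phase by one
in q alone (`fbiTransformAlong_phaseEquiv`). The space N(Y) is {q = 0}, so the fields L_j
differentiate in p only. The distance to N(Y) is comparable to |q|, and 1 + dist(·, V) to 1 + |p| up
to factors 1 + |q|, which the arbitrary decay in q absorbs. Hence conormality means |∂_p^j ⟨v, T_p
M_q h⟩| ≲ (1+|p|)^{m-j} (1+|q|)^{-N} for one nonzero g (`isGammaConormal_iff_shortTime`), and V has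
dropped out.

These bounds characterise Shubin symbols. If v is integration against a, the transform is ∫ a(p+y)
e^{i⟨y,q⟩} h(y) dy: derivatives in p fall on a and lower its order, while the decay in q is that of
a Fourier transform (`exists_shortTime_le_of_symbol`, for every window). Conversely, if h(p⋆) ≠ 0,
Fourier inversion recovers a(x) as a multiple of ∫ e^{-i⟨p⋆,q⟩} ⟨v, T_{x-p⋆} M_q h⟩ dq, and
differentiation under this integral gives the symbol estimates (`exists_symbol_of_shortTime`). For a
general tempered v the inversion rests on `apply_eq_integral_slice`, which lets v pass through the
integral of a Schwartz kernel over a parameter. -/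

theorem hasFDerivAt_integral_of_linearIsometryEquiv {F G : Type*} [NormedAddCommGroup F]
    [NormedSpace ℝ F] [NormedAddCommGroup G] [NormedSpace ℝ G] (L : G ≃ₗᵢ[ℝ] (X →L[ℝ] F))
    {f : X → α → F} {g : X → α → G} {x : X} {s : Set X} {bound : α → ℝ} (hs : s ∈ nhds x)
    (hf : ∀ y, AEStronglyMeasurable (f y) μ) (hi : Integrable (f x) μ)
    (hg : AEStronglyMeasurable (g x) μ) (hb : ∀ q, ∀ y ∈ s, ‖g y q‖ ≤ bound q)
    (hbi : Integrable bound μ)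
    (hd : ∀ q, ∀ y, HasFDerivAt (fun y => f y q) (L (g y q)) y) :
    HasFDerivAt (fun y => ∫ q, f y q ∂μ) (L (∫ q, g x q ∂μ)) x := by
  -- The map L stands for currying of multilinear maps: being linear and continuous it passes
  -- through the integral, being isometric it keeps the bound on g.
  have h1 : L (∫ q, g x q ∂μ) = ∫ q, L (g x q) ∂μ :=
    (L.toContinuousLinearEquiv.integral_comp_comm (fun q => g x q)).symm
  rw [h1]
  refine hasFDerivAt_integral_of_dominated_of_fderiv_le (bound := bound)
    (F' := fun x q => L (g x q)) hs (Filter.Eventually.of_forall hf) hi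
    (L.continuous.comp_aestronglyMeasurable hg)
    (Filter.Eventually.of_forall fun q y hy => ?_) hbi
    (Filter.Eventually.of_forall fun q y _ => hd q y)
  rw [LinearIsometryEquiv.norm_map]
  exact hb q y hy

/-- Differentiation of all orders under the integral sign. -/
theorem hasFTaylorSeriesUpTo_integral {H : X → α → E}
    (hH : ∀ q, ContDiff ℝ ∞ (fun x => H x q))
    (hm : ∀ j x, AEStronglyMeasurable (fun q => iteratedFDeriv ℝ j (fun x => H x q) x) μ)
    (hb : ∀ j x₀, ∃ s ∈ nhds x₀, ∃ bound : α → ℝ, Integrable bound μ ∧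
      ∀ q, ∀ x ∈ s, ‖iteratedFDeriv ℝ j (fun x => H x q) x‖ ≤ bound q) :
    HasFTaylorSeriesUpTo ∞ (fun x => ∫ q, H x q ∂μ)
      (fun x j => ∫ q, iteratedFDeriv ℝ j (fun x => H x q) x ∂μ) := by
  have hint : ∀ j x, Integrable (fun q => iteratedFDeriv ℝ j (fun x => H x q) x) μ := by
    intro j x
    obtain ⟨s, hs, bound, hbi, hbs⟩ := hb j x
    exact hbi.mono' (hm j x) (Filter.Eventually.of_forall fun q => hbs q x (mem_of_mem_nhds hs))
  have hd : ∀ (j : ℕ) (x : X), HasFDerivAt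
      (fun y => ∫ q, iteratedFDeriv ℝ j (fun x => H x q) y ∂μ)
      (∫ q, iteratedFDeriv ℝ (j + 1) (fun x => H x q) x ∂μ).curryLeft x := by
    intro j x
    obtain ⟨s, hs, bound, hbi, hbs⟩ := hb (j + 1) x
    exact hasFDerivAt_integral_of_linearIsometryEquiv
      (continuousMultilinearCurryLeftEquiv ℝ (fun _ : Fin (j + 1) => X) E) hs
      (fun y => hm j y) (hint j x) (hm (j + 1) x) hbs hbi fun q y =>
        (contDiff_iff_ftaylorSeries.1 (hH q)).fderiv j (by exact_mod_cast ENat.natCast_lt_top j) y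
  refine ⟨fun x => ?_, fun j _ x => hd j x, fun j _ => ?_⟩
  · have := ((continuousMultilinearCurryFin0 ℝ X E).toContinuousLinearEquiv.integral_comp_comm
      (μ := μ) (fun q => iteratedFDeriv ℝ 0 (fun x => H x q) x))
    refine this.symm.trans ?_
    simp
  · exact continuous_iff_continuousAt.2 fun x => (hd j x).continuousAt

theorem contDiff_integral {H : X → α → E}
    (hH : ∀ q, ContDiff ℝ ∞ (fun x => H x q))
    (hm : ∀ j x, AEStronglyMeasurable (fun q => iteratedFDeriv ℝ j (fun x => H x q) x) μ)
    (hb : ∀ j x₀, ∃ s ∈ nhds x₀, ∃ bound : α → ℝ, Integrable bound μ ∧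
      ∀ q, ∀ x ∈ s, ‖iteratedFDeriv ℝ j (fun x => H x q) x‖ ≤ bound q) :
    ContDiff ℝ ∞ (fun x => ∫ q, H x q ∂μ) :=
  (hasFTaylorSeriesUpTo_integral hH hm hb).contDiff

theorem iteratedFDeriv_integral {H : X → α → E}
    (hH : ∀ q, ContDiff ℝ ∞ (fun x => H x q))
    (hm : ∀ j x, AEStronglyMeasurable (fun q => iteratedFDeriv ℝ j (fun x => H x q) x) μ)
    (hb : ∀ j x₀, ∃ s ∈ nhds x₀, ∃ bound : α → ℝ, Integrable bound μ ∧
      ∀ q, ∀ x ∈ s, ‖iteratedFDeriv ℝ j (fun x => H x q) x‖ ≤ bound q) (j : ℕ) (x : X) :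
    iteratedFDeriv ℝ j (fun x => ∫ q, H x q ∂μ) x
      = ∫ q, iteratedFDeriv ℝ j (fun x => H x q) x ∂μ :=
  ((hasFTaylorSeriesUpTo_integral hH hm hb).eq_iteratedFDeriv
    (by exact_mod_cast le_top) x).symm

end ParametricIntegral

/-! ### Derivatives of partial functions on a product -/

section Slices

variable {X Q E : Type*} [NormedAddCommGroup X] [NormedSpace ℝ X] [NormedAddCommGroup Q]
  [NormedSpace ℝ Q] [NormedAddCommGroup E] [NormedSpace ℝ E]

theorem iteratedFDeriv_slice_left {H : X × Q → E} (hH : ContDiff ℝ ∞ H) (j : ℕ) (x : X) (q : Q) :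
    iteratedFDeriv ℝ j (fun x => H (x, q)) x =
      (iteratedFDeriv ℝ j H (x, q)).compContinuousLinearMap
        (fun _ => ContinuousLinearMap.inl ℝ X Q) := by
  have h1 : ContDiff ℝ ∞ (fun z => H (z + (0, q))) := hH.comp (contDiff_id.add contDiff_const)
  have h2 := (ContinuousLinearMap.inl ℝ X Q).iteratedFDeriv_comp_right h1 x (i := j)
    (by exact_mod_cast le_top)
  rw [iteratedFDeriv_comp_add_right] at h2
  have h3 : (fun x => H (x, q)) = (fun z => H (z + (0, q))) ∘ (ContinuousLinearMap.inl ℝ X Q) := by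
    funext x; simp
  rw [h3, h2]
  simp

theorem iteratedFDeriv_slice_right {H : X × Q → E} (hH : ContDiff ℝ ∞ H) (j : ℕ) (x : X) (q : Q) :
    iteratedFDeriv ℝ j (fun q => H (x, q)) q =
      (iteratedFDeriv ℝ j H (x, q)).compContinuousLinearMap
        (fun _ => ContinuousLinearMap.inr ℝ X Q) := by
  have h1 : ContDiff ℝ ∞ (fun z => H (z + (x, 0))) := hH.comp (contDiff_id.add contDiff_const)
  have h2 := (ContinuousLinearMap.inr ℝ X Q).iteratedFDeriv_comp_right h1 q (i := j)
    (by exact_mod_cast le_top)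
  rw [iteratedFDeriv_comp_add_right] at h2
  have h3 : (fun q => H (x, q)) = (fun z => H (z + (x, 0))) ∘ (ContinuousLinearMap.inr ℝ X Q) := by
    funext x; simp
  rw [h3, h2]
  simp

theorem norm_iteratedFDeriv_slice_right_le {H : X × Q → E} (hH : ContDiff ℝ ∞ H) (j : ℕ)
    (x : X) (q : Q) :
    ‖iteratedFDeriv ℝ j (fun q => H (x, q)) q‖ ≤ ‖iteratedFDeriv ℝ j H (x, q)‖ := by
  rw [iteratedFDeriv_slice_right hH]
  refine (ContinuousMultilinearMap.norm_compContinuousLinearMap_le _ _).trans ?_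
  exact mul_le_of_le_one_right (norm_nonneg _)
    (Finset.prod_le_one (fun _ _ => norm_nonneg _)
      fun _ _ => ContinuousLinearMap.norm_inr_le_one ℝ X Q)

theorem continuous_iteratedFDeriv_slice_left {H : X × Q → E} (hH : ContDiff ℝ ∞ H) (j : ℕ) :
    Continuous (fun z : X × Q => iteratedFDeriv ℝ j (fun x => H (x, z.2)) z.1) := by
  have h : (fun z : X × Q => iteratedFDeriv ℝ j (fun x => H (x, z.2)) z.1) = fun z =>
      ContinuousMultilinearMap.compContinuousLinearMapL (fun _ => ContinuousLinearMap.inl ℝ X Q)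
        (iteratedFDeriv ℝ j H z) := by
    funext z
    exact iteratedFDeriv_slice_left hH j z.1 z.2
  rw [h]
  exact (ContinuousLinearMap.continuous _).comp
    (hH.continuous_iteratedFDeriv (by exact_mod_cast le_top))

end Slices

/-! ### Multilinear maps controlled by their values on a basis -/

section Multilinear

/-- Expand every argument in a basis; the coordinate functionals are bounded by a common c, whence
the constant c ^ j. This reduces bounds on iterated derivatives to finitely many tuples of constant
directions. -/
theorem exists_norm_multilinear_le_sum {X F : Type*} [NormedAddCommGroup X] [NormedSpace ℝ X]
    [FiniteDimensional ℝ X] [NormedAddCommGroup F] [NormedSpace ℝ F] (j : ℕ) :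
    ∃ C : ℝ, 0 ≤ C ∧ ∀ f : X [×j]→L[ℝ] F,
      ‖f‖ ≤ C * ∑ r : Fin j → Fin (Module.finrank ℝ X), ‖f fun i => Module.finBasis ℝ X (r i)‖ := by
  set b := Module.finBasis ℝ X
  have hc : ∃ c : ℝ, 0 ≤ c ∧ ∀ (l : Fin (Module.finrank ℝ X)) (v : X), |b.repr v l| ≤ c * ‖v‖ := by
    let L : X →L[ℝ] (Fin (Module.finrank ℝ X) → ℝ) :=
      (b.equivFun.toContinuousLinearEquiv : X ≃L[ℝ] (Fin (Module.finrank ℝ X) → ℝ))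
    exact ⟨‖L‖, norm_nonneg _, fun l v =>
      (norm_le_pi_norm (b.equivFun v) l).trans (L.le_opNorm v)⟩
  obtain ⟨c, hc0, hc⟩ := hc
  refine ⟨c ^ j, by positivity, fun f => ?_⟩
  refine ContinuousMultilinearMap.opNorm_le_bound (by positivity) fun v => ?_
  have h1 : f v = ∑ r : Fin j → Fin (Module.finrank ℝ X),
      (∏ i, b.repr (v i) (r i)) • f fun i => b (r i) := by
    conv_lhs => rw [show v = fun i => ∑ l, b.repr (v i) l • b l from
      funext fun i => (b.sum_repr (v i)).symm]
    rw [f.map_sum]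
    exact Finset.sum_congr rfl fun r _ =>
      f.map_smul_univ (fun i => b.repr (v i) (r i)) (fun i => b (r i))
  rw [h1, mul_assoc, Finset.sum_mul, Finset.mul_sum]
  refine (norm_sum_le _ _).trans (Finset.sum_le_sum fun r _ => ?_)
  rw [norm_smul, norm_prod]
  calc (∏ i, ‖b.repr (v i) (r i)‖) * ‖f fun i => b (r i)‖
      ≤ (∏ i, c * ‖v i‖) * ‖f fun i => b (r i)‖ := by
        gcongr with i _
        exact hc _ _
    _ = c ^ j * (‖f fun i => b (r i)‖ * ∏ i, ‖v i‖) := by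
        rw [Finset.prod_mul_distrib]; simp; ring

end Multilinear

/-! ### Families of functions closed under directional derivatives -/

section ClosedFamily

variable {X F S : Type*}

/-- Iteration of a family of operators along a tuple of directions. -/
def iterFamily (D : X → S → S) : (j : ℕ) → (Fin j → X) → S → S
  | 0, _ => id
  | j + 1, v => fun s => iterFamily D j (Fin.init v) (D (v (Fin.last j)) s)

variable [NormedAddCommGroup X] [NormedSpace ℝ X] [FiniteDimensional ℝ X]
  [NormedAddCommGroup F] [NormedSpace ℝ F]

/-- A family of functions whose directional derivatives stay in the family is smooth. -/
theorem contDiff_of_hasFDerivAt_family (T : S → X → F) (D : X → S → S)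
    (h : ∀ s x, ∃ L : X →L[ℝ] F, HasFDerivAt (T s) L x ∧ ∀ v, L v = T (D v s) x) (s : S) :
    ContDiff ℝ ∞ (T s) := by
  rw [contDiff_infty]
  intro n
  induction n generalizing s with
  | zero =>
    refine contDiff_zero.2 (continuous_iff_continuousAt.2 fun x => ?_)
    obtain ⟨L, hL, -⟩ := h s x
    exact hL.continuousAt
  | succ n ih =>
    refine (contDiff_succ_iff_fderiv_apply (n := n)).2 ⟨fun x => ?_, by simp, fun v => ?_⟩
    · obtain ⟨L, hL, -⟩ := h s x
      exact hL.differentiableAt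
    · have : (fun x => fderiv ℝ (T s) x v) = T (D v s) := by
        funext x
        obtain ⟨L, hL, hv⟩ := h s x
        rw [hL.fderiv, hv]
      rw [this]
      exact ih _

/-- A derivative of a member is again a member, so a bound valid for all members bounds derivatives
of all orders. `iterFamily` consumes the last direction first, to agree with
`iteratedFDeriv_succ_apply_right`. -/
theorem iteratedFDeriv_family_apply (T : S → X → F) (D : X → S → S)
    (h : ∀ s x, ∃ L : X →L[ℝ] F, HasFDerivAt (T s) L x ∧ ∀ v, L v = T (D v s) x)
    (j : ℕ) (v : Fin j → X) (s : S) (x : X) :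
    iteratedFDeriv ℝ j (T s) x v = T (iterFamily D j v s) x := by
  induction j generalizing s with
  | zero => simp [iterFamily]
  | succ j ih =>
    have hs := contDiff_of_hasFDerivAt_family T D h s
    have h2 : ContDiff ℝ j (fderiv ℝ (T s)) :=
      (contDiff_infty_iff_fderiv.1 hs).2.of_le (by exact_mod_cast le_top)
    rw [iteratedFDeriv_succ_apply_right]
    have h3 := iteratedFDeriv_clm_apply_const_apply (i := j)
      h2 le_rfl (x := x) (u := v (Fin.last j)) (m := Fin.init v)
    refine h3.symm.trans ?_
    have : (fun x => fderiv ℝ (T s) x (v (Fin.last j))) = T (D (v (Fin.last j)) s) := by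
      funext x
      obtain ⟨L, hL, hv⟩ := h s x
      rw [hL.fderiv, hv]
    rw [this, ih]
    rfl

end ClosedFamily

/-! ### First order Taylor expansion in the Schwartz seminorms -/

namespace SchwartzMap

open LineDeriv

section Taylor

variable {W : Type*} [NormedAddCommGroup W] [NormedSpace ℝ W]

theorem exists_one_add_pow_mul_le (f : 𝓢(W, ℂ)) (k n : ℕ) : ∃ C : ℝ, 0 ≤ C ∧ ∀ x,
    (1 + ‖x‖) ^ k * ‖iteratedFDeriv ℝ n f x‖ ≤ C :=
  ⟨_, by positivity, fun x => one_add_le_sup_seminorm_apply (𝕜 := ℂ) (m := (k, n)) le_rfl le_rfl f x⟩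

theorem lineDerivOp_comm (v w : W) (f : 𝓢(W, ℂ)) : ∂_{v} (∂_{w} f) = ∂_{w} (∂_{v} f) := by
  have key : ∀ (a b : W) (x : W), ∂_{a} (∂_{b} f) x = fderiv ℝ (fderiv ℝ f) x a b := by
    intro a b x
    have h1 : ((∂_{b} f : 𝓢(W, ℂ)) : W → ℂ) = fun y => fderiv ℝ f y b := rfl
    have h2 : DifferentiableAt ℝ (fderiv ℝ f) x :=
      (contDiff_infty_iff_fderiv.1 (f.smooth ⊤)).2.differentiable (by simp) x
    rw [lineDerivOp_apply_eq_fderiv, h1, fderiv_clm_apply h2 (differentiableAt_const b)]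
    simp
  ext x
  rw [key, key]
  exact ((f.contDiffAt ⊤).isSymmSndFDerivAt (by simp; exact WithTop.coe_le_coe.2 le_top)).eq v w

/-- The mean value inequality is used twice on the ball of radius ‖v‖ about w, once for the
derivative and once for the function. On that ball the second derivative is at most a multiple of (1
+ ‖w‖) ^ (-k). -/
theorem exists_taylor_bound_zero (f : 𝓢(W, ℂ)) (k : ℕ) : ∃ C : ℝ, 0 ≤ C ∧ ∀ v : W, ‖v‖ ≤ 1 →
    ∀ w, ‖w‖ ^ k * ‖f (w + v) - f w - ∂_{v} f w‖ ≤ C * ‖v‖ ^ 2 := by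
  obtain ⟨M, hM0, hM⟩ := f.exists_one_add_pow_mul_le k 2
  refine ⟨2 ^ k * M, by positivity, fun v hv w => ?_⟩
  have hB : 0 < (1 + ‖w‖) ^ k := by positivity
  have h2 : ∀ y ∈ Metric.closedBall w ‖v‖,
      ‖fderiv ℝ (fderiv ℝ f) y‖ ≤ 2 ^ k * M / (1 + ‖w‖) ^ k := by
    intro y hy
    -- As ‖v‖ ≤ 1, the weights at w and at y differ by at most a factor 2, which gives the constant
    -- 2 ^ k.
    have hwy : 1 + ‖w‖ ≤ 2 * (1 + ‖y‖) := by
      have : ‖w‖ ≤ ‖y‖ + ‖y - w‖ := by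
        have := norm_sub_le y (y - w); simpa using this
      rw [Metric.mem_closedBall, dist_eq_norm] at hy
      linarith [norm_nonneg y]
    rw [le_div_iff₀ hB]
    have h3 : ‖fderiv ℝ (fderiv ℝ f) y‖ = ‖iteratedFDeriv ℝ 2 f y‖ := by
      rw [← norm_iteratedFDeriv_fderiv, ← norm_iteratedFDeriv_one]
    rw [h3]
    calc ‖iteratedFDeriv ℝ 2 f y‖ * (1 + ‖w‖) ^ k
        ≤ ‖iteratedFDeriv ℝ 2 f y‖ * (2 * (1 + ‖y‖)) ^ k := by gcongr
      _ = 2 ^ k * ((1 + ‖y‖) ^ k * ‖iteratedFDeriv ℝ 2 f y‖) := by rw [mul_pow]; ring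
      _ ≤ 2 ^ k * M := by gcongr; exact hM y
  have hdiff : Differentiable ℝ (fderiv ℝ f) :=
    (contDiff_infty_iff_fderiv.1 (f.smooth ⊤)).2.differentiable (by simp)
  have hw : w ∈ Metric.closedBall w ‖v‖ := Metric.mem_closedBall_self (norm_nonneg _)
  have hwv : w + v ∈ Metric.closedBall w ‖v‖ := by simp
  have h3 : ∀ y ∈ Metric.closedBall w ‖v‖,
      ‖fderiv ℝ f y - fderiv ℝ f w‖ ≤ 2 ^ k * M / (1 + ‖w‖) ^ k * ‖v‖ := by
    intro y hy
    refine ((convex_closedBall w ‖v‖).norm_image_sub_le_of_norm_fderiv_le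
      (fun z _ => hdiff z) h2 hw hy).trans ?_
    rw [Metric.mem_closedBall, dist_eq_norm] at hy
    gcongr
  have h4 := (convex_closedBall w ‖v‖).norm_image_sub_le_of_norm_hasFDerivWithin_le'
    (f := f) (fun z _ => (f.hasFDerivAt z).hasFDerivWithinAt) h3 hw hwv
  rw [add_sub_cancel_left] at h4
  calc ‖w‖ ^ k * ‖f (w + v) - f w - ∂_{v} f w‖
      ≤ (1 + ‖w‖) ^ k * (2 ^ k * M / (1 + ‖w‖) ^ k * ‖v‖ * ‖v‖) := by
        gcongr
        · linarith
        · exact h4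
    _ = 2 ^ k * M * ‖v‖ ^ 2 := by field_simp

/-- The first order Taylor remainder `f(· + v) - f - ∂_v f`. -/
noncomputable def taylorRemainder (v : W) (f : 𝓢(W, ℂ)) : 𝓢(W, ℂ) :=
  compSubConstCLM ℂ (-v) f - f - ∂_{v} f

theorem taylorRemainder_apply (v : W) (f : 𝓢(W, ℂ)) (w : W) :
    taylorRemainder v f w = f (w + v) - f w - ∂_{v} f w := by
  simp [taylorRemainder]

theorem lineDerivOp_taylorRemainder (m v : W) (f : 𝓢(W, ℂ)) :
    ∂_{m} (taylorRemainder v f) = taylorRemainder v (∂_{m} f) := by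
  have h1 : ∂_{m} (compSubConstCLM ℂ (-v) f) = compSubConstCLM ℂ (-v) (∂_{m} f) := by
    ext x
    have : (⇑(compSubConstCLM ℂ (-v) f) : W → ℂ) = fun x => f (x - -v) := rfl
    rw [lineDerivOp_apply_eq_fderiv, this, fderiv_comp_sub]
    rfl
  have hsub : ∀ f g : 𝓢(W, ℂ), ∂_{m} (f - g) = ∂_{m} f - ∂_{m} g := fun f g => by
    rw [sub_eq_add_neg, lineDerivOp_add, lineDerivOp_neg, ← sub_eq_add_neg]
  rw [taylorRemainder, taylorRemainder, hsub, hsub, h1, lineDerivOp_comm]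

theorem iteratedLineDerivOp_taylorRemainder {j : ℕ} (m : Fin j → W) (v : W) (f : 𝓢(W, ℂ)) :
    ∂^{m} (taylorRemainder v f) = taylorRemainder v (∂^{m} f) := by
  induction j with
  | zero => simp
  | succ j ih =>
    rw [iteratedLineDerivOp_succ_left, iteratedLineDerivOp_succ_left, ih,
      lineDerivOp_taylorRemainder]

/-- Taking the remainder commutes with line derivatives, so the undifferentiated bound applied to
each ∂^m f along basis directions is enough. -/
theorem exists_seminorm_taylorRemainder_le [FiniteDimensional ℝ W] (f : 𝓢(W, ℂ)) (k j : ℕ) :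
    ∃ C : ℝ, 0 ≤ C ∧ ∀ v : W, ‖v‖ ≤ 1 →
      SchwartzMap.seminorm ℂ k j (taylorRemainder v f) ≤ C * ‖v‖ ^ 2 := by
  obtain ⟨c, hc0, hc⟩ := exists_norm_multilinear_le_sum (X := W) (F := ℂ) j
  choose M hM0 hM using fun r : Fin j → Fin (Module.finrank ℝ W) =>
    exists_taylor_bound_zero (∂^{fun i => Module.finBasis ℝ W (r i)} f) k
  refine ⟨c * ∑ r, M r, by have := Finset.sum_nonneg fun r (_ : r ∈ Finset.univ) => hM0 r; positivity,
    fun v hv => seminorm_le_bound ℂ k j _ ?_ fun w => ?_⟩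
  · have := Finset.sum_nonneg fun r (_ : r ∈ Finset.univ) => hM0 r
    positivity
  · calc ‖w‖ ^ k * ‖iteratedFDeriv ℝ j (taylorRemainder v f) w‖
        ≤ ‖w‖ ^ k * (c * ∑ r : Fin j → Fin (Module.finrank ℝ W),
            ‖iteratedFDeriv ℝ j (taylorRemainder v f) w fun i => Module.finBasis ℝ W (r i)‖) := by
          gcongr
          exact hc _
      _ = c * ∑ r : Fin j → Fin (Module.finrank ℝ W), ‖w‖ ^ k *
            ‖iteratedFDeriv ℝ j (taylorRemainder v f) w fun i => Module.finBasis ℝ W (r i)‖ := by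
          rw [← Finset.mul_sum]; ring
      _ ≤ c * ∑ r : Fin j → Fin (Module.finrank ℝ W), M r * ‖v‖ ^ 2 := by
          refine mul_le_mul_of_nonneg_left (Finset.sum_le_sum fun r _ => ?_) hc0
          rw [← iteratedLineDerivOp_eq_iteratedFDeriv, iteratedLineDerivOp_taylorRemainder,
            taylorRemainder_apply]
          exact hM r v hv w
      _ = c * (∑ r, M r) * ‖v‖ ^ 2 := by rw [← Finset.sum_mul]; ring

end Taylor

/-! ### Schwartz kernels depending on a parameter -/

section Slice

variable {Z E : Type*} [NormedAddCommGroup Z] [NormedSpace ℝ Z] [NormedAddCommGroup E]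
  [NormedSpace ℝ E]

theorem hasTemperateGrowth_prodMk_left (z : Z) :
    Function.HasTemperateGrowth (fun y : E => (z, y)) := by
  have h : (fun y : E => (z, y)) = (fun _ : E => ((z, 0) : Z × E))
      + fun y => ContinuousLinearMap.inr ℝ Z E y := by
    funext y; simp
  rw [h]
  exact (Function.HasTemperateGrowth.const _).add
    (ContinuousLinearMap.inr ℝ Z E).hasTemperateGrowth

/-- The restriction `y ↦ K(z, y)` of a Schwartz function on a product. -/
noncomputable def slice (z : Z) : 𝓢(Z × E, ℂ) →L[ℂ] 𝓢(E, ℂ) :=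
  compCLM ℂ (hasTemperateGrowth_prodMk_left z)
    ⟨1, 1, fun y => by
      have : ‖y‖ ≤ ‖(z, y)‖ := le_max_right _ _
      simp only [pow_one, one_mul]; linarith⟩

@[simp] theorem slice_apply (z : Z) (K : 𝓢(Z × E, ℂ)) (y : E) : slice z K y = K (z, y) := rfl

theorem norm_pow_mul_seminorm_slice_le (z : Z) (K : 𝓢(Z × E, ℂ)) (l k j : ℕ) :
    ‖z‖ ^ l * SchwartzMap.seminorm ℂ k j (slice z K) ≤ SchwartzMap.seminorm ℂ (l + k) j K := by
  rcases eq_or_ne (‖z‖ ^ l) 0 with h0 | h0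
  · rw [h0, zero_mul]; exact apply_nonneg _ _
  have hpos : 0 < ‖z‖ ^ l := lt_of_le_of_ne (by positivity) h0.symm
  rw [← le_div_iff₀' hpos]
  refine seminorm_le_bound ℂ k j _ (div_nonneg (apply_nonneg _ _) hpos.le) fun y => ?_
  rw [le_div_iff₀' hpos]
  calc ‖z‖ ^ l * (‖y‖ ^ k * ‖iteratedFDeriv ℝ j (slice z K) y‖)
      ≤ ‖(z, y)‖ ^ l * (‖(z, y)‖ ^ k * ‖iteratedFDeriv ℝ j K (z, y)‖) := by
        gcongr
        · exact le_max_left _ _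
        · exact le_max_right _ _
        · exact norm_iteratedFDeriv_slice_right_le (K.smooth ⊤) j z y
    _ = ‖(z, y)‖ ^ (l + k) * ‖iteratedFDeriv ℝ j K (z, y)‖ := by rw [pow_add]; ring
    _ ≤ _ := le_seminorm ℂ _ _ K (z, y)

theorem seminorm_slice_le (z : Z) (K : 𝓢(Z × E, ℂ)) (k j : ℕ) :
    SchwartzMap.seminorm ℂ k j (slice z K) ≤ SchwartzMap.seminorm ℂ k j K := by
  simpa using norm_pow_mul_seminorm_slice_le z K 0 k j

theorem exists_bound_of_clm {B : Type*} [NormedAddCommGroup B] [NormedSpace ℂ B]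
    (u : 𝓢(E, ℂ) →L[ℂ] B) : ∃ (s : Finset (ℕ × ℕ)) (C : ℝ), 0 ≤ C ∧
    ∀ φ, ‖u φ‖ ≤ C * ∑ i ∈ s, SchwartzMap.seminorm ℂ i.1 i.2 φ := by
  obtain ⟨s, C, -, h⟩ := Seminorm.bound_of_continuous (schwartz_withSeminorms ℂ E ℂ)
    ((normSeminorm ℂ B).comp u.toLinearMap) (u.continuous.norm)
  refine ⟨s, C, C.2, fun φ => (h φ).trans ?_⟩
  have h2 : (s.sup (schwartzSeminormFamily ℂ E ℂ)) φ
      ≤ ∑ i ∈ s, SchwartzMap.seminorm ℂ i.1 i.2 φ := by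
    refine (Seminorm.finset_sup_le_sum (schwartzSeminormFamily ℂ E ℂ) s φ).trans (le_of_eq ?_)
    rw [← FunLike.coeAddMonoidHom_apply, map_sum, Finset.sum_apply]
    rfl
  exact mul_le_mul_of_nonneg_left h2 C.2

variable [FiniteDimensional ℝ Z] [FiniteDimensional ℝ E]

/-- Finitely many seminorms control u, and each of them is O(‖v‖²) on the Taylor remainder of the
kernel. The derivative is u applied to slices of ∂_{(v, 0)} K, again a Schwartz kernel, so the
family indexed by K is closed. -/
theorem hasFDerivAt_apply_slice (u : 𝓢(E, ℂ) →L[ℂ] ℂ) (K : 𝓢(Z × E, ℂ)) (z : Z) :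
    ∃ L : Z →L[ℝ] ℂ, HasFDerivAt (fun z => u (slice z K)) L z ∧
      ∀ v, L v = u (slice z (∂_{((v, 0) : Z × E)} K)) := by
  let L₀ : Z →ₗ[ℝ] ℂ :=
    { toFun := fun v => u (slice z (∂_{((v, 0) : Z × E)} K))
      map_add' := fun v w => by
        have : ((v + w, 0) : Z × E) = (v, 0) + (w, 0) := by simp
        rw [this, lineDerivOp_left_add, map_add, map_add]
      map_smul' := fun c v => by
        have : ((c • v, 0) : Z × E) = c • (v, 0) := by simp
        have h2 : ∂_{((c • v, 0) : Z × E)} K = (c : ℂ) • ∂_{((v, 0) : Z × E)} K := by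
          rw [this, lineDerivOp_left_smul]
          ext x; simp
        rw [h2, map_smul, map_smul]
        simp }
  refine ⟨LinearMap.toContinuousLinearMap L₀, ?_, fun v => rfl⟩
  obtain ⟨s, C, hC0, hu⟩ := exists_bound_of_clm u
  choose M hM0 hM using fun i : ℕ × ℕ => exists_seminorm_taylorRemainder_le K i.1 i.2
  have hb : ∀ v : Z, ‖v‖ ≤ 1 → ‖u (slice (z + v) K) - u (slice z K) - L₀ v‖
      ≤ (C * ∑ i ∈ s, M i) * ‖v‖ ^ 2 := by
    intro v hv
    have h1 : u (slice (z + v) K) - u (slice z K) - L₀ v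
        = u (slice z (taylorRemainder ((v, 0) : Z × E) K)) := by
      have : slice z (taylorRemainder ((v, 0) : Z × E) K)
          = slice (z + v) K - slice z K - slice z (∂_{((v, 0) : Z × E)} K) := by
        ext y
        simp [taylorRemainder_apply]
      rw [this, map_sub, map_sub]
      rfl
    rw [h1, mul_assoc, Finset.sum_mul]
    refine (hu _).trans ?_
    gcongr with i hi
    refine (seminorm_slice_le _ _ _ _).trans ?_
    have hv' : ‖((v, 0) : Z × E)‖ = ‖v‖ := by simp
    have := hM i (v, 0) (hv'.trans_le hv)
    rwa [hv'] at this
  rw [hasFDerivAt_iff_isLittleO_nhds_zero]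
  have hO : (fun v : Z => u (slice (z + v) K) - u (slice z K) - L₀ v)
      =O[nhds 0] fun v => ‖v‖ ^ 2 := by
    refine Asymptotics.IsBigO.of_bound (C * ∑ i ∈ s, M i) ?_
    filter_upwards [Metric.closedBall_mem_nhds (0 : Z) one_pos] with v hv
    have := hb v (by simpa using hv)
    simpa using this
  exact hO.trans_isLittleO (by
    have := Asymptotics.isLittleO_pow_id (𝕜 := ℝ) (n := 2) one_lt_two
    have h3 := this.comp_tendsto (tendsto_norm_zero (E := Z))
    exact h3.trans_isBigO (Asymptotics.isBigO_refl _ _).norm_left)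

theorem contDiff_apply_slice (u : 𝓢(E, ℂ) →L[ℂ] ℂ) (K : 𝓢(Z × E, ℂ)) :
    ContDiff ℝ ∞ (fun z => u (slice z K)) :=
  contDiff_of_hasFDerivAt_family (fun (K : 𝓢(Z × E, ℂ)) z => u (slice z K))
    (fun v K => ∂_{((v, 0) : Z × E)} K) (fun K z => hasFDerivAt_apply_slice u K z) K

end Slice

end SchwartzMap

/-! ### Exchanging a tempered distribution with a parameter integral -/

/-- The bound forces u to vanish on the kernel of ι, so u descends to a bounded functional on the
range, which Hahn–Banach extends to B. -/
theorem exists_clm_factor {V B : Type*} [AddCommGroup V] [Module ℂ V] [NormedAddCommGroup B]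
    [NormedSpace ℂ B] (ι : V →ₗ[ℂ] B) (u : V →ₗ[ℂ] ℂ) (C : ℝ) (h : ∀ φ, ‖u φ‖ ≤ C * ‖ι φ‖) :
    ∃ w : B →L[ℂ] ℂ, ∀ φ, w (ι φ) = u φ := by
  have hker : LinearMap.ker ι ≤ LinearMap.ker u := fun φ hφ => by
    have h1 := h φ
    rw [LinearMap.mem_ker.1 hφ, norm_zero, mul_zero] at h1
    exact LinearMap.mem_ker.2 (norm_le_zero_iff.1 h1)
  let f : LinearMap.range ι →ₗ[ℂ] ℂ :=
    ((LinearMap.ker ι).liftQ u hker).comp ι.quotKerEquivRange.symm.toLinearMap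
  have hf : ∀ φ, f ⟨ι φ, LinearMap.mem_range_self ι φ⟩ = u φ := fun φ => by
    have : ι.quotKerEquivRange.symm ⟨ι φ, LinearMap.mem_range_self ι φ⟩
        = (LinearMap.ker ι).mkQ φ := ι.quotKerEquivRange_symm_apply_image φ _
    simp only [f, LinearMap.comp_apply, LinearEquiv.coe_coe, this]
    rfl
  have hfb : ∀ x, ‖f x‖ ≤ C * ‖x‖ := by
    rintro ⟨_, φ, rfl⟩
    rw [hf]
    exact h φ
  obtain ⟨w, hw, -⟩ := exists_extension_norm_eq _ (f.mkContinuous C hfb)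
  exact ⟨w, fun φ => (hw ⟨ι φ, LinearMap.mem_range_self ι φ⟩).trans (hf φ)⟩

namespace SchwartzMap

open LineDeriv

variable {Z E : Type*} [NormedAddCommGroup Z] [NormedSpace ℝ Z] [NormedAddCommGroup E]
  [InnerProductSpace ℝ E]

theorem lineDerivOp_slice (z : Z) (e : E) (K : 𝓢(Z × E, ℂ)) :
    ∂_{e} (slice z K) = slice z (∂_{((0, e) : Z × E)} K) := by
  ext y
  have h1 : HasFDerivAt (slice z K) ((fderiv ℝ K (z, y)).comp (ContinuousLinearMap.inr ℝ Z E)) y :=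
    (K.hasFDerivAt (z, y)).comp y (hasFDerivAt_prodMk_right z y)
  rw [lineDerivOp_apply_eq_fderiv, h1.fderiv]
  rfl

theorem iteratedLineDerivOp_slice (z : Z) {j : ℕ} (m : Fin j → E) (K : 𝓢(Z × E, ℂ)) :
    ∂^{m} (slice z K) = slice z (∂^{fun i => ((0, m i) : Z × E)} K) := by
  induction j with
  | zero => simp
  | succ j ih =>
    rw [iteratedLineDerivOp_succ_left, iteratedLineDerivOp_succ_left, ih, lineDerivOp_slice]
    rfl

variable [FiniteDimensional ℝ E]

/-- A continuous functional on the Schwartz space is controlled by finitely many weighted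
derivatives in the supremum norm. -/
theorem exists_clm_bound_family (u : 𝓢(E, ℂ) →L[ℂ] ℂ) :
    ∃ (I : Type) (_ : Fintype I) (j : I → ℕ) (m : ∀ i, Fin (j i) → E) (K : ℕ) (C : ℝ),
      ∀ φ, ‖u φ‖ ≤ C * ∑ i, ‖toBoundedContinuousFunctionCLM ℂ E ℂ
        (smulLeftCLM ℂ (fun x : E => (((1 + ‖x‖ ^ 2) ^ K : ℝ) : ℂ)) (∂^{m i} φ))‖ := by
  obtain ⟨s, C, hC0, hu⟩ := exists_bound_of_clm u
  choose c hc0 hc using fun j => exists_norm_multilinear_le_sum (X := E) (F := ℂ) j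
  let d := Module.finrank ℝ E
  -- One exponent dominating all the polynomial weights that occur in s.
  let K := ∑ i ∈ s, i.1
  have hK : Function.HasTemperateGrowth (fun x : E => (((1 + ‖x‖ ^ 2) ^ K : ℝ) : ℂ)) := by
    have h1 : Function.HasTemperateGrowth (fun x : E => 1 + ‖x‖ ^ 2) :=
      (Function.HasTemperateGrowth.const 1).add (Function.hasTemperateGrowth_norm_sq E)
    exact Function.Complex.hasTemperateGrowth_ofReal.comp (h1.pow K)
  refine ⟨Σ i : s, (Fin i.1.2 → Fin d), inferInstance, fun i => i.1.1.2,
    fun i l => Module.finBasis ℝ E (i.2 l), K, C * ∑ i ∈ s, c i.2, fun φ => ?_⟩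
  set N : (Σ i : s, (Fin i.1.2 → Fin d)) → ℝ := fun i => ‖toBoundedContinuousFunctionCLM ℂ E ℂ
        (smulLeftCLM ℂ (fun x : E => (((1 + ‖x‖ ^ 2) ^ K : ℝ) : ℂ))
          (∂^{fun l => Module.finBasis ℝ E (i.2 l)} φ))‖ with hN
  have hN0 : ∀ i, 0 ≤ N i := fun i => norm_nonneg _
  refine (hu φ).trans ?_
  rw [mul_assoc, Finset.sum_mul]
  refine mul_le_mul_of_nonneg_left (Finset.sum_le_sum fun i hi => ?_) hC0
  have hS0 : 0 ≤ ∑ i, N i := Finset.sum_nonneg fun i _ => hN0 i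
  refine seminorm_le_bound ℂ _ _ _ (mul_nonneg (hc0 _) hS0) fun x => ?_
  have hle : ‖x‖ ^ i.1 ≤ (1 + ‖x‖ ^ 2) ^ K := by
    have h1 : ‖x‖ ≤ 1 + ‖x‖ ^ 2 := by nlinarith [sq_nonneg (‖x‖ - 1), norm_nonneg x]
    have h2 : (1 : ℝ) ≤ 1 + ‖x‖ ^ 2 := by nlinarith [norm_nonneg x]
    exact (pow_le_pow_left₀ (norm_nonneg _) h1 _).trans
      (pow_le_pow_right₀ h2 (Finset.single_le_sum (f := fun i : ℕ × ℕ => i.1) (by simp) hi))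
  calc ‖x‖ ^ i.1 * ‖iteratedFDeriv ℝ i.2 φ x‖
      ≤ (1 + ‖x‖ ^ 2) ^ K * (c i.2 * ∑ r : Fin i.2 → Fin d,
          ‖iteratedFDeriv ℝ i.2 φ x fun l => Module.finBasis ℝ E (r l)‖) := by
        gcongr
        exact hc _ _
    _ = c i.2 * ∑ r : Fin i.2 → Fin d, (1 + ‖x‖ ^ 2) ^ K *
          ‖iteratedFDeriv ℝ i.2 φ x fun l => Module.finBasis ℝ E (r l)‖ := by
        rw [← Finset.mul_sum]; ring
    _ ≤ c i.2 * ∑ r : Fin i.2 → Fin d, N ⟨⟨i, hi⟩, r⟩ := by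
        refine mul_le_mul_of_nonneg_left (Finset.sum_le_sum fun r _ => ?_) (hc0 _)
        rw [← iteratedLineDerivOp_eq_iteratedFDeriv]
        refine le_trans (le_of_eq ?_) (BoundedContinuousFunction.norm_coe_le_norm _ x)
        rw [toBoundedContinuousFunctionCLM_apply, smulLeftCLM_apply_apply hK, norm_smul,
          Complex.norm_real, Real.norm_of_nonneg (by positivity)]
    _ ≤ c i.2 * ∑ i, N i := by
        refine mul_le_mul_of_nonneg_left ?_ (hc0 _)
        rw [Fintype.sum_sigma]
        exact Finset.single_le_sum (f := fun i : s => ∑ r, N ⟨i, r⟩)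
          (fun i _ => Finset.sum_nonneg fun r _ => hN0 _) (Finset.mem_univ (⟨i, hi⟩ : s))

variable [FiniteDimensional ℝ Z]

/-- The increment of the slice is a Taylor remainder, quadratic in z' - z in every seminorm, plus
the slice of ∂_{(z' - z, 0)} K, which depends linearly on z' - z and so tends to zero. -/
theorem continuous_slice (K : 𝓢(Z × E, ℂ)) : Continuous fun z => slice z K := by
  rw [continuous_iff_continuousAt]
  intro z
  rw [ContinuousAt, (schwartz_withSeminorms ℂ E ℂ).tendsto_nhds]
  rintro ⟨k, j⟩ ε hε
  obtain ⟨M, hM0, hM⟩ := exists_seminorm_taylorRemainder_le K k j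
  have hcont : ContinuousAt (fun v : Z => M * ‖v‖ ^ 2
      + SchwartzMap.seminorm ℂ k j (∂_{((v, 0) : Z × E)} K)) 0 := by
    have h2 : Continuous fun v : Z => ∂_{((v, 0) : Z × E)} K := by
      let L : Z →ₗ[ℝ] 𝓢(Z × E, ℂ) :=
        { toFun := fun v => ∂_{((v, 0) : Z × E)} K
          map_add' := fun v w => by
            rw [← lineDerivOp_left_add]; simp
          map_smul' := fun c v => by
            rw [RingHom.id_apply, ← lineDerivOp_left_smul]; simp }
      exact L.continuous_of_finiteDimensional
    have h3 := ((schwartz_withSeminorms ℂ (Z × E) ℂ).continuous_seminorm (k, j)).comp h2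
    exact ((continuous_const.mul (continuous_norm.pow 2)).add h3).continuousAt
  have h0 : M * ‖(0 : Z)‖ ^ 2 + SchwartzMap.seminorm ℂ k j (∂_{((0, 0) : Z × E)} K) < ε := by
    have : ∂_{((0, 0) : Z × E)} K = 0 := lineDerivOp_left_zero K
    rw [this]; simpa using hε
  have h1 := (hcont.eventually_lt_const h0).and (Metric.closedBall_mem_nhds (0 : Z) one_pos)
  have h2 : Filter.Tendsto (fun z' => z' - z) (nhds z) (nhds 0) := by
    have : ContinuousAt (fun z' => z' - z) z := by fun_prop
    simpa [ContinuousAt] using this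
  filter_upwards [h2.eventually h1] with z' hz'
  refine lt_of_le_of_lt ?_ hz'.1
  have hdec : slice z' K - slice z K = slice z (taylorRemainder ((z' - z, 0) : Z × E) K)
      + slice z (∂_{((z' - z, 0) : Z × E)} K) := by
    ext y
    simp [taylorRemainder_apply]
  have hv : ‖((z' - z, 0) : Z × E)‖ = ‖z' - z‖ := by simp
  have h4 := hM (z' - z, 0) (by rw [hv]; simpa using hz'.2)
  rw [hv] at h4
  change SchwartzMap.seminorm ℂ k j (slice z' K - slice z K) ≤ _
  rw [hdec]
  refine (map_add_le_add _ _ _).trans (add_le_add ?_ ?_)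
  · exact (seminorm_slice_le _ _ _ _).trans h4
  · exact seminorm_slice_le _ _ _ _

variable [MeasurableSpace Z] [BorelSpace Z] (μ : Measure Z) [μ.HasTemperateGrowth]

/-- Weights in z can be moved onto the kernel, so the seminorm of the slice decays faster than any
power of ‖z‖. -/
theorem integrable_seminorm_slice (K : 𝓢(Z × E, ℂ)) (k j : ℕ) :
    Integrable (fun z => SchwartzMap.seminorm ℂ k j (slice z K)) μ := by
  have hm : AEStronglyMeasurable (fun z => SchwartzMap.seminorm ℂ k j (slice z K)) μ :=
    (((schwartz_withSeminorms ℂ E ℂ).continuous_seminorm (k, j)).comp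
      (continuous_slice K)).aestronglyMeasurable
  have hb : ∀ l : ℕ, ∀ z, ‖z‖ ^ l * ‖SchwartzMap.seminorm ℂ k j (slice z K)‖
      ≤ SchwartzMap.seminorm ℂ (l + k) j K := fun l z => by
    rw [Real.norm_of_nonneg (apply_nonneg _ _)]
    exact norm_pow_mul_seminorm_slice_le z K l k j
  have := integrable_of_le_of_pow_mul_le (μ := μ) (k := 0)
    (fun z => by simpa using hb 0 z) (fun z => hb (0 + μ.integrablePower) z) hm
  exact this.mono' hm (by simp)

theorem integrable_clm_slice {B : Type*} [NormedAddCommGroup B] [NormedSpace ℂ B]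
    (u : 𝓢(E, ℂ) →L[ℂ] B) (K : 𝓢(Z × E, ℂ)) : Integrable (fun z => u (slice z K)) μ := by
  obtain ⟨s, C, hC0, hu⟩ := exists_bound_of_clm u
  refine Integrable.mono' ((integrable_finsetSum s fun i _ =>
    integrable_seminorm_slice μ K i.1 i.2).const_mul C)
    (u.continuous.comp (continuous_slice K)).aestronglyMeasurable
    (Filter.Eventually.of_forall fun z => hu _)

/-- The (0, 1) seminorm of the slice dominates the derivative uniformly in y and is integrable in z,
which permits differentiation under the integral. -/
theorem integral_lineDerivOp_slice (K : 𝓢(Z × E, ℂ)) (ψ : 𝓢(E, ℂ))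
    (h : ∀ y, ψ y = ∫ z, K (z, y) ∂μ) (e : E) (y : E) :
    ∂_{e} ψ y = ∫ z, (∂_{((0, e) : Z × E)} K) (z, y) ∂μ := by
  have hb : ∀ z y, ‖fderiv ℝ (slice z K) y‖ ≤ SchwartzMap.seminorm ℂ 0 1 (slice z K) :=
    fun z y => by
      have := norm_iteratedFDeriv_le_seminorm ℂ (slice z K) 1 y
      rwa [norm_iteratedFDeriv_one] at this
  have hf : ∀ z y, HasFDerivAt (slice z K)
      ((fderiv ℝ K (z, y)).comp (ContinuousLinearMap.inr ℝ Z E)) y := fun z y =>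
    (K.hasFDerivAt (z, y)).comp y (hasFDerivAt_prodMk_right z y)
  have hev : Integrable (fun z => fderiv ℝ (slice z K) y) μ := by
    refine (integrable_seminorm_slice μ K 0 1).mono' (Continuous.aestronglyMeasurable ?_)
      (Filter.Eventually.of_forall fun z => hb z y)
    simp only [fun z => (hf z y).fderiv]
    exact (((K.smooth ⊤).continuous_fderiv (by simp)).comp
      (Continuous.prodMk_left y)).clm_comp continuous_const
  have hs : ∀ y, Integrable (fun z => K (z, y)) μ := fun y =>
    (BoundedContinuousFunction.evalCLM ℂ y).integrable_comp
      (integrable_clm_slice μ (toBoundedContinuousFunctionCLM ℂ E ℂ) K)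
  have hd := hasFDerivAt_integral_of_dominated_of_fderiv_le (μ := μ) (𝕜 := ℝ)
    (F := fun y z => K (z, y)) (F' := fun y z => fderiv ℝ (slice z K) y) (x₀ := y)
    (bound := fun z => SchwartzMap.seminorm ℂ 0 1 (slice z K)) Filter.univ_mem
    (Filter.Eventually.of_forall fun y => (hs y).aestronglyMeasurable) (hs y)
    hev.aestronglyMeasurable
    (Filter.Eventually.of_forall fun z y _ => hb z y)
    (integrable_seminorm_slice μ K 0 1)
    (Filter.Eventually.of_forall fun z y _ => (slice z K).hasFDerivAt y)
  have hψ : (ψ : E → ℂ) = fun y => ∫ z, K (z, y) ∂μ := funext h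
  rw [lineDerivOp_apply_eq_fderiv, hψ, hd.fderiv, ContinuousLinearMap.integral_apply hev]
  refine integral_congr_ae (Filter.Eventually.of_forall fun z => ?_)
  have h2 := congrArg (fun f : 𝓢(E, ℂ) => f y) (lineDerivOp_slice z e K)
  exact h2

theorem integral_iteratedLineDerivOp_slice {j : ℕ} (K : 𝓢(Z × E, ℂ)) (ψ : 𝓢(E, ℂ))
    (h : ∀ y, ψ y = ∫ z, K (z, y) ∂μ) (m : Fin j → E) (y : E) :
    ∂^{m} ψ y = ∫ z, (∂^{fun i => ((0, m i) : Z × E)} K) (z, y) ∂μ := by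
  induction j generalizing y with
  | zero => simpa using h y
  | succ j ih =>
    rw [iteratedLineDerivOp_succ_left, iteratedLineDerivOp_succ_left]
    exact integral_lineDerivOp_slice μ _ _ (fun y => ih (Fin.tail m) y) (m 0) y

/-- A tempered distribution commutes with integration of a Schwartz kernel in a parameter. -/
theorem apply_eq_integral_slice (u : 𝓢(E, ℂ) →L[ℂ] ℂ) (K : 𝓢(Z × E, ℂ)) (ψ : 𝓢(E, ℂ))
    (h : ∀ y, ψ y = ∫ z, K (z, y) ∂μ) : u ψ = ∫ z, u (slice z K) ∂μ := by
  obtain ⟨I, _, j, m, N, C, hC⟩ := exists_clm_bound_family u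
  -- The weighted derivatives that control u map the Schwartz space into a Banach space, where
  -- Bochner integrals are taken; u factors through this map.
  let A : I → 𝓢(E, ℂ) →L[ℂ] BoundedContinuousFunction E ℂ := fun i =>
    toBoundedContinuousFunctionCLM ℂ E ℂ ∘L
      smulLeftCLM ℂ (fun x : E => (((1 + ‖x‖ ^ 2) ^ N : ℝ) : ℂ)) ∘L
      iteratedLineDerivOpCLM ℂ 𝓢(E, ℂ) (m i)
  let ι : 𝓢(E, ℂ) →L[ℂ] (I → BoundedContinuousFunction E ℂ) := ContinuousLinearMap.pi A
  have hbound : ∀ φ, ‖u φ‖ ≤ (|C| * Fintype.card I) * ‖ι φ‖ := fun φ => by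
    refine (hC φ).trans ?_
    rw [mul_assoc]
    have h1 : ∑ i, ‖A i φ‖ ≤ Fintype.card I * ‖ι φ‖ := by
      calc ∑ i, ‖A i φ‖ ≤ ∑ _i : I, ‖ι φ‖ :=
            Finset.sum_le_sum fun i _ => norm_le_pi_norm (ι φ) i
        _ = _ := by simp
    exact mul_le_mul (le_abs_self C) h1 (Finset.sum_nonneg fun i _ => norm_nonneg _) (abs_nonneg _)
  obtain ⟨w, hw⟩ := exists_clm_factor ι.toLinearMap u.toLinearMap _ hbound
  have hi := integrable_clm_slice μ ι K
  -- Equality in the Banach space is tested by evaluating each component at each point; there it is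
  -- differentiation under the integral.
  have key : ι ψ = ∫ z, ι (slice z K) ∂μ := by
    funext i
    ext y
    let ev : (I → BoundedContinuousFunction E ℂ) →L[ℂ] ℂ :=
      BoundedContinuousFunction.evalCLM ℂ y ∘L ContinuousLinearMap.proj i
    have h1 : ev (∫ z, ι (slice z K) ∂μ) = ∫ z, ev (ι (slice z K)) ∂μ :=
      (ev.integral_comp_comm hi).symm
    change ev (ι ψ) = ev (∫ z, ι (slice z K) ∂μ)
    rw [h1]
    have hK : Function.HasTemperateGrowth (fun x : E => (((1 + ‖x‖ ^ 2) ^ N : ℝ) : ℂ)) :=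
      Function.Complex.hasTemperateGrowth_ofReal.comp
        (((Function.HasTemperateGrowth.const 1).add
          (Function.hasTemperateGrowth_norm_sq E)).pow N)
    have h2 : ∀ φ : 𝓢(E, ℂ), ev (ι φ) = (((1 + ‖y‖ ^ 2) ^ N : ℝ) : ℂ) * ∂^{m i} φ y := fun φ => by
      change smulLeftCLM ℂ (fun x : E => (((1 + ‖x‖ ^ 2) ^ N : ℝ) : ℂ)) (∂^{m i} φ) y = _
      rw [smulLeftCLM_apply_apply hK, smul_eq_mul]
    simp only [h2]
    rw [integral_const_mul, integral_iteratedLineDerivOp_slice μ K ψ h]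
    congr 1
    refine integral_congr_ae (Filter.Eventually.of_forall fun z => ?_)
    have h2 := congrArg (fun f : 𝓢(E, ℂ) => f y) (iteratedLineDerivOp_slice z (m i) K)
    exact h2.symm
  calc u ψ = w (ι ψ) := (hw ψ).symm
    _ = ∫ z, w (ι (slice z K)) ∂μ := by rw [key]; exact (w.integral_comp_comm hi).symm
    _ = ∫ z, u (slice z K) ∂μ := integral_congr_ae (Filter.Eventually.of_forall fun z => hw _)

end SchwartzMap

/-! ### Domination by Schwartz seminorms -/

namespace SchwartzMap

open LineDeriv

section Bound

variable {E F V : Type*} [NormedAddCommGroup E] [NormedSpace ℝ E]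

/-- `g` is dominated by a continuous seminorm of the Schwartz space. -/
def HasSeminormBound (g : 𝓢(E, ℂ) → ℝ) : Prop :=
  ∃ (s : Finset (ℕ × ℕ)) (C : ℝ), 0 ≤ C ∧ ∀ φ, g φ ≤ C * (s.sup (schwartzSeminormFamily ℂ E ℂ)) φ

theorem HasSeminormBound.mono {g h : 𝓢(E, ℂ) → ℝ} (hg : HasSeminormBound g) (hh : ∀ φ, h φ ≤ g φ) :
    HasSeminormBound h := by
  obtain ⟨s, C, hC, H⟩ := hg
  exact ⟨s, C, hC, fun φ => (hh φ).trans (H φ)⟩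

theorem HasSeminormBound.add {g h : 𝓢(E, ℂ) → ℝ} (hg : HasSeminormBound g)
    (hh : HasSeminormBound h) : HasSeminormBound fun φ => g φ + h φ := by
  obtain ⟨s, C, hC, H⟩ := hg
  obtain ⟨s', C', hC', H'⟩ := hh
  refine ⟨s ∪ s', C + C', by positivity, fun φ => ?_⟩
  rw [add_mul]
  have h1 : s.sup (schwartzSeminormFamily ℂ E ℂ) φ ≤ (s ∪ s').sup (schwartzSeminormFamily ℂ E ℂ) φ :=
    Finset.sup_mono (f := schwartzSeminormFamily ℂ E ℂ) Finset.subset_union_left φ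
  have h2 : s'.sup (schwartzSeminormFamily ℂ E ℂ) φ ≤ (s ∪ s').sup (schwartzSeminormFamily ℂ E ℂ) φ :=
    Finset.sup_mono (f := schwartzSeminormFamily ℂ E ℂ) Finset.subset_union_right φ
  exact add_le_add ((H φ).trans (by gcongr)) ((H' φ).trans (by gcongr))

theorem HasSeminormBound.const_mul {g : 𝓢(E, ℂ) → ℝ} (hg : HasSeminormBound g) {c : ℝ}
    (hc : 0 ≤ c) : HasSeminormBound fun φ => c * g φ := by
  obtain ⟨s, C, hC, H⟩ := hg
  refine ⟨s, c * C, by positivity, fun φ => ?_⟩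
  rw [mul_assoc]
  exact mul_le_mul_of_nonneg_left (H φ) hc

theorem HasSeminormBound.sum {I : Type*} (t : Finset I) {g : I → 𝓢(E, ℂ) → ℝ}
    (hg : ∀ i ∈ t, HasSeminormBound (g i)) : HasSeminormBound fun φ => ∑ i ∈ t, g i φ := by
  classical
  induction t using Finset.induction_on with
  | empty => exact ⟨∅, 0, le_rfl, fun φ => by simp⟩
  | insert a t ha ih =>
    simp only [Finset.sum_insert ha]
    exact (hg a (Finset.mem_insert_self a t)).add
      (ih fun i hi => hg i (Finset.mem_insert_of_mem hi))

theorem hasSeminormBound_of_continuous (q : Seminorm ℂ 𝓢(E, ℂ)) (hq : Continuous q) :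
    HasSeminormBound fun φ => q φ := by
  obtain ⟨s, C, -, h⟩ := Seminorm.bound_of_continuous (schwartz_withSeminorms ℂ E ℂ) q hq
  exact ⟨s, C, C.2, h⟩

theorem hasSeminormBound_seminorm_comp [NormedAddCommGroup F] [NormedSpace ℝ F]
    (A : 𝓢(E, ℂ) →L[ℂ] 𝓢(F, ℂ)) (k j : ℕ) :
    HasSeminormBound fun φ => SchwartzMap.seminorm ℂ k j (A φ) :=
  hasSeminormBound_of_continuous
    ((SchwartzMap.seminorm ℂ k j : Seminorm ℂ 𝓢(F, ℂ)).comp A.toLinearMap)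
    (((schwartz_withSeminorms ℂ F ℂ).continuous_seminorm (k, j)).comp A.continuous)

theorem finset_sup_schwartzSeminormFamily_le (s : Finset (ℕ × ℕ)) (φ : 𝓢(E, ℂ)) :
    (s.sup (schwartzSeminormFamily ℂ E ℂ)) φ ≤ ∑ i ∈ s, SchwartzMap.seminorm ℂ i.1 i.2 φ := by
  refine (Seminorm.finset_sup_le_sum (schwartzSeminormFamily ℂ E ℂ) s φ).trans (le_of_eq ?_)
  rw [← FunLike.coeAddMonoidHom_apply, map_sum, Finset.sum_apply]
  rfl

theorem HasSeminormBound.comp [NormedAddCommGroup F] [NormedSpace ℝ F] {g : 𝓢(F, ℂ) → ℝ}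
    (hg : HasSeminormBound g) (A : 𝓢(E, ℂ) →L[ℂ] 𝓢(F, ℂ)) :
    HasSeminormBound fun φ => g (A φ) := by
  obtain ⟨s, C, hC, H⟩ := hg
  refine HasSeminormBound.mono ?_ fun φ => H (A φ)
  refine HasSeminormBound.const_mul ?_ hC
  refine HasSeminormBound.mono (HasSeminormBound.sum s
    fun i _ => hasSeminormBound_seminorm_comp A i.1 i.2) fun φ => finset_sup_schwartzSeminormFamily_le s (A φ)

end Bound

/-! ### The partial Fourier transform on the Schwartz space -/

section PartialFourier

open Complex FourierTransform

variable {E F : Type*} [NormedAddCommGroup E] [NormedSpace ℝ E]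
  [NormedAddCommGroup F] [InnerProductSpace ℝ F]

theorem hasTemperateGrowth_I_mul_inner_snd (w : F) :
    Function.HasTemperateGrowth (fun p : E × F => I * ((inner ℝ p.2 w : ℝ) : ℂ)) := by
  have h1 : Function.HasTemperateGrowth (fun p : E × F => (inner ℝ p.2 w : ℝ)) :=
    (Function.hasTemperateGrowth_inner_left w).comp
      (ContinuousLinearMap.snd ℝ E F).hasTemperateGrowth
  exact (Function.HasTemperateGrowth.const I).mul
    (Function.Complex.hasTemperateGrowth_ofReal.comp h1)

/-- The operator intertwined with `∂_v` by the partial Fourier integral. -/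
noncomputable def partialFourierDeriv (v : E × F) : 𝓢(E × F, ℂ) →L[ℂ] 𝓢(E × F, ℂ) :=
  lineDerivOpCLM ℂ 𝓢(E × F, ℂ) ((v.1, 0) : E × F)
    + smulLeftCLM ℂ (fun p : E × F => I * ((inner ℝ p.2 v.2 : ℝ) : ℂ))

theorem partialFourierDeriv_apply (v : E × F) (φ : 𝓢(E × F, ℂ)) (p : E × F) :
    partialFourierDeriv v φ p
      = fderiv ℝ φ p (v.1, 0) + I * ((inner ℝ p.2 v.2 : ℝ) : ℂ) * φ p := by
  change (∂_{((v.1, 0) : E × F)} φ) p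
    + smulLeftCLM ℂ (fun p : E × F => I * ((inner ℝ p.2 v.2 : ℝ) : ℂ)) φ p = _
  rw [smulLeftCLM_apply_apply (hasTemperateGrowth_I_mul_inner_snd v.2), smul_eq_mul]
  rfl

/-- Reflection in the second variable. -/
noncomputable def reflectSnd : 𝓢(E × F, ℂ) →L[ℂ] 𝓢(E × F, ℂ) :=
  compCLMOfContinuousLinearEquiv ℂ
    ((ContinuousLinearEquiv.refl ℝ E).prodCongr (ContinuousLinearEquiv.neg ℝ))

theorem reflectSnd_apply (φ : 𝓢(E × F, ℂ)) (x : E) (y : F) : reflectSnd φ (x, y) = φ (x, -y) := rfl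

variable [FiniteDimensional ℝ F] [MeasurableSpace F] [BorelSpace F]

/-- The partial Fourier integral `∫ e^{i⟨y, θ⟩} φ(x, y) dy`. -/
noncomputable def partialFourierIntegral (φ : 𝓢(E × F, ℂ)) (p : E × F) : ℂ :=
  ∫ y : F, exp (I * ((inner ℝ y p.2 : ℝ) : ℂ)) * φ (p.1, y)

theorem norm_exp_I_mul_ofReal' (t : ℝ) : ‖exp (I * (t : ℂ))‖ = 1 := by
  rw [mul_comm]; exact norm_exp_ofReal_mul_I t

/-- The transform `𝓕` has kernel e^{-2πi⟨y, w⟩}, so the kernel e^{i⟨y, θ⟩} corresponds to w =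
-θ/(2π). -/
theorem partialFourierIntegral_eq_fourier (φ : 𝓢(E × F, ℂ)) (p : E × F) :
    partialFourierIntegral φ p = 𝓕 (slice p.1 φ) (-(2 * Real.pi)⁻¹ • p.2) := by
  rw [fourier_coe, Real.fourier_eq']
  refine integral_congr_ae (Filter.Eventually.of_forall fun y => ?_)
  simp only [slice_apply, smul_eq_mul]
  congr 2
  rw [inner_smul_right]
  have : (Real.pi : ℂ) ≠ 0 := by exact_mod_cast Real.pi_ne_zero
  push_cast
  field_simp

/-- The weight in x is moved onto the slice of φ, and the weight in θ is supplied by the decay of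
the Fourier transform of the slice. The dominating functional g does not depend on p. -/
theorem hasSeminormBound_partialFourierIntegral (k : ℕ) : ∃ g : 𝓢(E × F, ℂ) → ℝ,
    HasSeminormBound g ∧ ∀ φ p, ‖p‖ ^ k * ‖partialFourierIntegral φ p‖ ≤ g φ := by
  have hA : ∀ l : ℕ, HasSeminormBound fun ψ : 𝓢(F, ℂ) => SchwartzMap.seminorm ℂ l 0 (𝓕 ψ) := by
    intro l
    refine (hasSeminormBound_seminorm_comp (fourierTransformCLM ℂ (V := F) (E := ℂ)) l 0).mono
      fun ψ => le_of_eq ?_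
    rfl
  have hsum : ∀ l : ℕ, ∃ (s : Finset (ℕ × ℕ)) (C : ℝ), 0 ≤ C ∧ ∀ ψ : 𝓢(F, ℂ),
      SchwartzMap.seminorm ℂ l 0 (𝓕 ψ) ≤ C * ∑ i ∈ s, SchwartzMap.seminorm ℂ i.1 i.2 ψ := by
    intro l
    obtain ⟨s, C, hC, H⟩ := hA l
    refine ⟨s, C, hC, fun ψ => (H ψ).trans
      (mul_le_mul_of_nonneg_left (finset_sup_schwartzSeminormFamily_le s ψ) hC)⟩
  obtain ⟨s₀, C₀, hC₀, H₀⟩ := hsum 0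
  obtain ⟨s, C, hC, H⟩ := hsum k
  have hid : ∀ i j, HasSeminormBound fun φ : 𝓢(E × F, ℂ) => SchwartzMap.seminorm ℂ i j φ :=
    fun i j => hasSeminormBound_seminorm_comp (ContinuousLinearMap.id ℂ _) i j
  refine ⟨fun φ => C₀ * ∑ i ∈ s₀, SchwartzMap.seminorm ℂ (k + i.1) i.2 φ
    + (2 * Real.pi) ^ k * (C * ∑ i ∈ s, SchwartzMap.seminorm ℂ i.1 i.2 φ), ?_, fun φ p => ?_⟩
  · exact ((HasSeminormBound.sum _ fun i _ => hid _ _).const_mul hC₀).add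
      (((HasSeminormBound.sum _ fun i _ => hid _ _).const_mul hC).const_mul (by positivity))
  · obtain ⟨x, θ⟩ := p
    rw [partialFourierIntegral_eq_fourier]
    set ψ := slice x φ with hψ
    set w := -(2 * Real.pi)⁻¹ • θ with hw
    have hθ : ‖θ‖ = 2 * Real.pi * ‖w‖ := by
      rw [hw, norm_smul, norm_neg, norm_inv, Real.norm_of_nonneg (by positivity)]
      field_simp
    have h1 : ‖x‖ ^ k * ‖𝓕 ψ w‖ ≤ C₀ * ∑ i ∈ s₀, SchwartzMap.seminorm ℂ (k + i.1) i.2 φ := by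
      calc ‖x‖ ^ k * ‖𝓕 ψ w‖ ≤ ‖x‖ ^ k * (C₀ * ∑ i ∈ s₀, SchwartzMap.seminorm ℂ i.1 i.2 ψ) := by
            gcongr
            exact (norm_le_seminorm ℂ (𝓕 ψ) w).trans (H₀ ψ)
        _ = C₀ * ∑ i ∈ s₀, ‖x‖ ^ k * SchwartzMap.seminorm ℂ i.1 i.2 ψ := by
            rw [← Finset.mul_sum]; ring
        _ ≤ _ := by
            gcongr
            exact norm_pow_mul_seminorm_slice_le _ _ _ _ _
    have h2 : ‖θ‖ ^ k * ‖𝓕 ψ w‖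
        ≤ (2 * Real.pi) ^ k * (C * ∑ i ∈ s, SchwartzMap.seminorm ℂ i.1 i.2 φ) := by
      rw [hθ, mul_pow, mul_assoc]
      refine mul_le_mul_of_nonneg_left ?_ (by positivity)
      refine (norm_pow_mul_le_seminorm ℂ (𝓕 ψ) k w).trans ((H ψ).trans ?_)
      gcongr
      exact seminorm_slice_le _ _ _ _
    have h3 : ‖((x, θ) : E × F)‖ ^ k ≤ ‖x‖ ^ k + ‖θ‖ ^ k := by
      rcases max_cases ‖x‖ ‖θ‖ with h | h
      · rw [Prod.norm_mk, h.1]; linarith [pow_nonneg (norm_nonneg θ) k]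
      · rw [Prod.norm_mk, h.1]; linarith [pow_nonneg (norm_nonneg x) k]
    calc ‖((x, θ) : E × F)‖ ^ k * ‖𝓕 ψ w‖ ≤ (‖x‖ ^ k + ‖θ‖ ^ k) * ‖𝓕 ψ w‖ := by gcongr
      _ ≤ _ := by rw [add_mul]; exact add_le_add h1 h2

theorem hasFDerivAt_integral_exp_mul {X : Type*} [NormedAddCommGroup X] [NormedSpace ℝ X]
    (a : X →L[ℝ] E) (b : X →L[ℝ] F) (φ : 𝓢(E × F, ℂ)) (p : X) :
    ∃ L : X →L[ℝ] ℂ,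
      HasFDerivAt (fun p => ∫ y : F, exp (I * ((inner ℝ y (b p) : ℝ) : ℂ)) * φ (a p, y)) L p ∧
      ∀ v, L v = ∫ y : F, exp (I * ((inner ℝ y (b p) : ℝ) : ℂ)) *
        (fderiv ℝ φ (a p, y) (a v, 0) + I * ((inner ℝ y (b v) : ℝ) : ℂ) * φ (a p, y)) := by
  let N := (volume : Measure F).integrablePower
  -- The extra power beyond N absorbs the factor ‖y‖ that appears when the exponential is
  -- differentiated.
  obtain ⟨C₀, hC₀, H₀⟩ := φ.exists_one_add_pow_mul_le (N + 1) 0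
  obtain ⟨C₁, hC₁, H₁⟩ := φ.exists_one_add_pow_mul_le N 1
  let f : X → F → ℂ := fun p y => exp (I * ((inner ℝ y (b p) : ℝ) : ℂ)) * φ (a p, y)
  let g : X → F → (X →L[ℝ] ℂ) := fun p y =>
    (fderiv ℝ φ (a p, y)).comp ((ContinuousLinearMap.inl ℝ E F).comp a)
  let h : F → (X →L[ℝ] ℂ) := fun y => ofRealCLM.comp ((innerSL ℝ y).comp b)
  let f' : X → F → (X →L[ℝ] ℂ) := fun p y =>
    exp (I * ((inner ℝ y (b p) : ℝ) : ℂ)) • g p y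
      + φ (a p, y) • (exp (I * ((inner ℝ y (b p) : ℝ) : ℂ)) • (I • h y))
  have hf : ∀ y q, HasFDerivAt (fun p => f p y) (f' q y) q := by
    intro y q
    have h1 : HasFDerivAt (fun p : X => exp (I * ((inner ℝ y (b p) : ℝ) : ℂ)))
        (exp (I * ((inner ℝ y (b q) : ℝ) : ℂ)) • (I • h y)) q := by
      have : HasFDerivAt (fun p : X => ((inner ℝ y (b p) : ℝ) : ℂ)) (h y) q := (h y).hasFDerivAt
      exact (this.const_mul I).cexp
    have h2 : HasFDerivAt (fun p : X => φ (a p, y)) (g q y) q :=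
      (φ.hasFDerivAt (a q, y)).comp q
        ((hasFDerivAt_prodMk_left (a q) y).comp q a.hasFDerivAt)
    exact h1.mul h2
  have hexp : ∀ θ : F, Continuous fun y : F => exp (I * ((inner ℝ y θ : ℝ) : ℂ)) := fun θ => by
    fun_prop
  have hφc : ∀ x : E, Continuous fun y : F => φ (x, y) := fun x =>
    φ.continuous.comp (Continuous.prodMk_right x)
  have hfc : ∀ q, Continuous (f q) := fun q => (hexp (b q)).mul (hφc (a q))
  have hgc : ∀ q, Continuous (g q) := fun q =>
    (((φ.smooth ⊤).continuous_fderiv (by simp)).comp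
        (Continuous.prodMk_right (a q))).clm_comp continuous_const
  have hhc : Continuous h :=
    continuous_const.clm_comp ((innerSL ℝ).continuous.clm_comp continuous_const)
  have hfc' : ∀ q, Continuous (f' q) := fun q =>
    ((hexp (b q)).smul (hgc q)).add ((hφc (a q)).smul ((hexp (b q)).smul (hhc.const_smul I)))
  have hdec : ∀ (n : ℕ) (x : E) (y : F) (a C : ℝ), (1 + ‖((x, y) : E × F)‖) ^ n * a ≤ C → 0 ≤ a →
      a ≤ C * (1 + ‖y‖) ^ (-(n : ℝ)) := by
    intro n x y a C h ha
    rw [Real.rpow_neg (by positivity), Real.rpow_natCast, ← div_eq_mul_inv,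
      le_div_iff₀ (by positivity), mul_comm]
    refine le_trans ?_ h
    gcongr
    exact le_max_right _ _
  have hint : Integrable (fun y : F => (1 + ‖y‖) ^ (-(N : ℝ))) :=
    Measure.integrable_pow_neg_integrablePower _
  have hb₀ : ∀ q y, ‖f q y‖ ≤ C₀ * (1 + ‖y‖) ^ (-(N : ℝ)) := by
    intro q y
    rw [norm_mul, norm_exp_I_mul_ofReal', one_mul]
    refine hdec N (a q) y _ _ (le_trans ?_ (H₀ (a q, y))) (norm_nonneg _)
    rw [norm_iteratedFDeriv_zero]
    gcongr
    · linarith [norm_nonneg (a q, y)]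
    · simp
  have hg : ∀ q y, ‖g q y‖ ≤ C₁ * (1 + ‖y‖) ^ (-(N : ℝ)) * ‖a‖ := by
    intro q y
    refine (ContinuousLinearMap.opNorm_comp_le _ _).trans ?_
    have h1 : ‖(ContinuousLinearMap.inl ℝ E F).comp a‖ ≤ ‖a‖ :=
      (ContinuousLinearMap.opNorm_comp_le _ _).trans
        (mul_le_of_le_one_left (norm_nonneg _) (ContinuousLinearMap.norm_inl_le_one ℝ E F))
    have h2 := H₁ (a q, y)
    rw [norm_iteratedFDeriv_one] at h2
    have h3 := hdec N (a q) y _ _ h2 (norm_nonneg _)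
    exact mul_le_mul h3 h1 (norm_nonneg _) ((norm_nonneg _).trans h3)
  have hh : ∀ y, ‖h y‖ ≤ ‖y‖ * ‖b‖ := by
    intro y
    refine (ContinuousLinearMap.opNorm_comp_le _ _).trans ?_
    rw [ofRealCLM_norm, one_mul]
    refine (ContinuousLinearMap.opNorm_comp_le _ _).trans ?_
    rw [innerSL_apply_norm]
  have hb₁ : ∀ q y, ‖f' q y‖ ≤ (C₁ * ‖a‖ + C₀ * ‖b‖) * (1 + ‖y‖) ^ (-(N : ℝ)) := by
    intro q y
    have h1 : ‖f' q y‖ ≤ ‖g q y‖ + ‖φ (a q, y)‖ * ‖h y‖ := by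
      refine (norm_add_le _ _).trans (le_of_eq ?_)
      simp only [norm_smul, norm_exp_I_mul_ofReal', norm_I, one_mul]
    have h2 : ‖φ (a q, y)‖ * ‖y‖ ≤ C₀ * (1 + ‖y‖) ^ (-(N : ℝ)) := by
      refine hdec N (a q) y _ _ (le_trans ?_ (H₀ (a q, y))) (by positivity)
      rw [norm_iteratedFDeriv_zero, pow_succ]
      have : ‖y‖ ≤ 1 + ‖((a q, y) : E × F)‖ := by
        have : ‖y‖ ≤ ‖((a q, y) : E × F)‖ := le_max_right _ _
        linarith
      calc (1 + ‖((a q, y) : E × F)‖) ^ N * (‖φ (a q, y)‖ * ‖y‖)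
          ≤ (1 + ‖((a q, y) : E × F)‖) ^ N * (‖φ (a q, y)‖ * (1 + ‖((a q, y) : E × F)‖)) := by
            gcongr
        _ = _ := by ring
    calc ‖f' q y‖ ≤ ‖g q y‖ + ‖φ (a q, y)‖ * ‖h y‖ := h1
      _ ≤ C₁ * (1 + ‖y‖) ^ (-(N : ℝ)) * ‖a‖ + ‖φ (a q, y)‖ * (‖y‖ * ‖b‖) := by
          gcongr
          · exact hg q y
          · exact hh y
      _ = C₁ * (1 + ‖y‖) ^ (-(N : ℝ)) * ‖a‖ + (‖φ (a q, y)‖ * ‖y‖) * ‖b‖ := by ring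
      _ ≤ C₁ * (1 + ‖y‖) ^ (-(N : ℝ)) * ‖a‖ + (C₀ * (1 + ‖y‖) ^ (-(N : ℝ))) * ‖b‖ := by gcongr
      _ = _ := by ring
  have hi' : Integrable (f' p) := (hint.const_mul _).mono'
    (hfc' p).aestronglyMeasurable (Filter.Eventually.of_forall (hb₁ p))
  refine ⟨∫ y, f' p y, ?_, fun v => ?_⟩
  · exact hasFDerivAt_integral_of_dominated_of_fderiv_le (𝕜 := ℝ)
      (bound := fun y => (C₁ * ‖a‖ + C₀ * ‖b‖) * (1 + ‖y‖) ^ (-(N : ℝ))) Filter.univ_mem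
      (Filter.Eventually.of_forall fun q => (hfc q).aestronglyMeasurable)
      ((hint.const_mul C₀).mono' (hfc p).aestronglyMeasurable
        (Filter.Eventually.of_forall (hb₀ p)))
      (hfc' p).aestronglyMeasurable
      (Filter.Eventually.of_forall fun y q _ => hb₁ q y) (hint.const_mul _)
      (Filter.Eventually.of_forall fun y q _ => hf y q)
  · rw [ContinuousLinearMap.integral_apply hi']
    refine integral_congr_ae (Filter.Eventually.of_forall fun y => ?_)
    simp [f', g, h]
    ring

theorem hasFDerivAt_partialFourierIntegral (φ : 𝓢(E × F, ℂ)) (p : E × F) :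
    ∃ L : (E × F) →L[ℝ] ℂ, HasFDerivAt (partialFourierIntegral φ) L p ∧
      ∀ v, L v = partialFourierIntegral (partialFourierDeriv v φ) p := by
  obtain ⟨L, hL, hv⟩ := hasFDerivAt_integral_exp_mul
    (ContinuousLinearMap.fst ℝ E F) (ContinuousLinearMap.snd ℝ E F) φ p
  refine ⟨L, hL, fun v => ?_⟩
  rw [hv, partialFourierIntegral]
  simp only [partialFourierDeriv_apply]
  rfl

theorem partialFourierIntegral_add (φ ψ : 𝓢(E × F, ℂ)) (p : E × F) :
    partialFourierIntegral (φ + ψ) p = partialFourierIntegral φ p + partialFourierIntegral ψ p := by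
  simp only [partialFourierIntegral_eq_fourier, map_add, FourierTransform.fourier_add, add_apply]

theorem partialFourierIntegral_smul (c : ℂ) (φ : 𝓢(E × F, ℂ)) (p : E × F) :
    partialFourierIntegral (c • φ) p = c • partialFourierIntegral φ p := by
  simp only [partialFourierIntegral_eq_fourier, map_smul, FourierTransform.fourier_smul, smul_apply]

variable [FiniteDimensional ℝ E]

/-- The partial Fourier transform as an operator on the Schwartz space. -/
noncomputable def partialFourier : 𝓢(E × F, ℂ) →L[ℂ] 𝓢(E × F, ℂ) :=
  mkCLM partialFourierIntegral partialFourierIntegral_add partialFourierIntegral_smul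
    (fun φ => contDiff_of_hasFDerivAt_family partialFourierIntegral (fun v φ => partialFourierDeriv v φ)
      hasFDerivAt_partialFourierIntegral φ) <| by
  rintro ⟨k, j⟩
  obtain ⟨c, hc0, hc⟩ := exists_norm_multilinear_le_sum (X := E × F) (F := ℂ) j
  obtain ⟨g, hg, hgb⟩ := hasSeminormBound_partialFourierIntegral (E := E) (F := F) k
  -- Iterating `partialFourierDeriv` gives continuous operators on the Schwartz space, so the
  -- undifferentiated bound composed with them remains a seminorm bound.
  have hB : ∀ (j : ℕ) (v : Fin j → E × F), ∃ B : 𝓢(E × F, ℂ) →L[ℂ] 𝓢(E × F, ℂ),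
      iterFamily (fun v φ => partialFourierDeriv v φ) j v = B := by
    intro j
    induction j with
    | zero => exact fun _ => ⟨ContinuousLinearMap.id ℂ _, rfl⟩
    | succ j ih =>
      intro v
      obtain ⟨B, hB⟩ := ih (Fin.init v)
      exact ⟨B ∘L partialFourierDeriv (v (Fin.last j)), by rw [iterFamily, hB]; rfl⟩
  choose B hB using hB j
  have hb : HasSeminormBound fun φ : 𝓢(E × F, ℂ) =>
      c * ∑ r : Fin j → Fin (Module.finrank ℝ (E × F)),
        g (B (fun i => Module.finBasis ℝ (E × F) (r i)) φ) :=
    (HasSeminormBound.sum _ fun r _ => hg.comp _).const_mul hc0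
  obtain ⟨s, C, hC, H⟩ := hb
  refine ⟨s, C, hC, fun φ p => le_trans ?_ (H φ)⟩
  calc ‖p‖ ^ k * ‖iteratedFDeriv ℝ j (partialFourierIntegral φ) p‖
      ≤ ‖p‖ ^ k * (c * ∑ r : Fin j → Fin (Module.finrank ℝ (E × F)),
        ‖iteratedFDeriv ℝ j (partialFourierIntegral φ) p
          fun i => Module.finBasis ℝ (E × F) (r i)‖) := by
        gcongr
        exact hc _
    _ = c * ∑ r : Fin j → Fin (Module.finrank ℝ (E × F)), ‖p‖ ^ k *
        ‖iteratedFDeriv ℝ j (partialFourierIntegral φ) p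
          fun i => Module.finBasis ℝ (E × F) (r i)‖ := by
        rw [← Finset.mul_sum]; ring
    _ ≤ _ := by
        refine mul_le_mul_of_nonneg_left (Finset.sum_le_sum fun r _ => ?_) hc0
        rw [iteratedFDeriv_family_apply partialFourierIntegral (fun v φ => partialFourierDeriv v φ)
          hasFDerivAt_partialFourierIntegral, hB]
        exact hgb _ _

theorem partialFourier_apply (φ : 𝓢(E × F, ℂ)) (p : E × F) :
    partialFourier φ p = ∫ y : F, exp (I * ((inner ℝ y p.2 : ℝ) : ℂ)) * φ (p.1, y) := rfl

theorem slice_partialFourier_apply (φ : 𝓢(E × F, ℂ)) (x : E) (θ : F) :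
    partialFourier φ (x, θ) = 𝓕 (slice x φ) (-(2 * Real.pi)⁻¹ • θ) :=
  partialFourierIntegral_eq_fourier φ (x, θ)

/-- Both transforms carry the same sign in the exponent, so Fourier inversion produces a reflection;
rescaling θ by 2π produces the power of 2π. -/
theorem partialFourier_partialFourier (φ : 𝓢(E × F, ℂ)) (x : E) (y : F) :
    partialFourier (partialFourier φ) (x, y)
      = ((2 * Real.pi) ^ Module.finrank ℝ F : ℝ) * φ (x, -y) := by
  have hpi : (0 : ℝ) < 2 * Real.pi := by positivity
  rw [partialFourier_apply]
  simp only [slice_partialFourier_apply]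
  set ψ := slice x φ with hψ
  have h1 : ∀ θ : F, exp (I * ((inner ℝ θ y : ℝ) : ℂ)) * 𝓕 ψ (-(2 * Real.pi)⁻¹ • θ)
      = (fun w : F => exp (((2 * Real.pi * inner ℝ w (-y) : ℝ) : ℂ) * I) * 𝓕 ψ w)
        ((-(2 * Real.pi)⁻¹) • θ) := fun θ => by
    simp only [inner_smul_left, inner_neg_right]
    congr 2
    have : (Real.pi : ℂ) ≠ 0 := by exact_mod_cast Real.pi_ne_zero
    simp
    field_simp
  rw [integral_congr_ae (Filter.Eventually.of_forall h1), Measure.integral_comp_smul volume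
    (fun w : F => exp (((2 * Real.pi * inner ℝ w (-y) : ℝ) : ℂ) * I) * 𝓕 ψ w)]
  have h2 : ∫ w : F, exp (((2 * Real.pi * inner ℝ w (-y) : ℝ) : ℂ) * I) * 𝓕 ψ w = ψ (-y) := by
    have h3 : 𝓕⁻ (𝓕 ψ) (-y) = ψ (-y) := by rw [FourierTransform.fourierInv_fourier_eq]
    rw [← h3, fourierInv_coe, Real.fourierInv_eq']
    simp only [smul_eq_mul]
  rw [h2, hψ, slice_apply, abs_inv, abs_pow, abs_neg, abs_inv, abs_of_pos hpi, inv_pow, inv_inv]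
  simp

/-- The inverse of the partial Fourier transform. -/
noncomputable def partialFourierSymm : 𝓢(E × F, ℂ) →L[ℂ] 𝓢(E × F, ℂ) :=
  ((((2 * Real.pi) ^ Module.finrank ℝ F)⁻¹ : ℝ) : ℂ) • (reflectSnd ∘L partialFourier)

theorem partialFourierSymm_partialFourier (φ : 𝓢(E × F, ℂ)) :
    partialFourierSymm (partialFourier φ) = φ := by
  ext ⟨x, y⟩
  change ((((2 * Real.pi) ^ Module.finrank ℝ F)⁻¹ : ℝ) : ℂ) *
    partialFourier (partialFourier φ) (x, -y) = _
  rw [partialFourier_partialFourier, ← mul_assoc, ← ofReal_mul, inv_mul_cancel₀ (by positivity)]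
  simp

theorem partialFourier_reflectSnd (φ : 𝓢(E × F, ℂ)) (x : E) (y : F) :
    partialFourier (reflectSnd φ) (x, y) = partialFourier φ (x, -y) := by
  rw [partialFourier_apply, partialFourier_apply, ← integral_neg_eq_self]
  simp [reflectSnd_apply]

theorem partialFourier_partialFourierSymm (φ : 𝓢(E × F, ℂ)) :
    partialFourier (partialFourierSymm φ) = φ := by
  ext ⟨x, y⟩
  have : partialFourierSymm φ = ((((2 * Real.pi) ^ Module.finrank ℝ F)⁻¹ : ℝ) : ℂ) •
    reflectSnd (partialFourier φ) := rfl
  rw [this, map_smul]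
  change ((((2 * Real.pi) ^ Module.finrank ℝ F)⁻¹ : ℝ) : ℂ) *
    partialFourier (reflectSnd (partialFourier φ)) (x, y) = _
  rw [partialFourier_reflectSnd, partialFourier_partialFourier, ← mul_assoc, ← ofReal_mul,
    inv_mul_cancel₀ (by positivity)]
  simp

end PartialFourier

end SchwartzMap

/-! ### Polynomial weights -/

theorem rpow_le_rpow_abs_mul {A B t : ℝ} (hA : 0 < A) (hB : 0 < B) (ht : 1 ≤ t) (h₁ : A ≤ t * B)
    (h₂ : B ≤ t * A) (s : ℝ) : A ^ s ≤ t ^ |s| * B ^ s := by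
  have ht0 : 0 < t := by linarith
  rcases le_total 0 s with hs | hs
  · rw [abs_of_nonneg hs, ← Real.mul_rpow ht0.le hB.le]
    exact Real.rpow_le_rpow hA.le h₁ hs
  · rw [abs_of_nonpos hs, Real.rpow_neg ht0.le, ← div_eq_inv_mul, le_div_iff₀ (by positivity),
      mul_comm, ← Real.mul_rpow ht0.le hA.le]
    exact Real.rpow_le_rpow_of_nonpos hB h₂ hs

/-- Peetre's inequality, for exponents of either sign. -/
theorem one_add_norm_sub_rpow_le {E : Type*} [NormedAddCommGroup E] (x y : E) (s : ℝ) :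
    (1 + ‖x - y‖) ^ s ≤ (1 + ‖y‖) ^ |s| * (1 + ‖x‖) ^ s := by
  refine rpow_le_rpow_abs_mul (by positivity) (by positivity) (by linarith [norm_nonneg y]) ?_ ?_ s
  · nlinarith [norm_sub_le x y, norm_nonneg x, norm_nonneg y]
  · have : ‖x‖ ≤ ‖x - y‖ + ‖y‖ := by simpa using norm_add_le (x - y) y
    nlinarith [norm_nonneg (x - y), norm_nonneg y]

theorem one_add_norm_rpow_le_of_mem_ball {E : Type*} [NormedAddCommGroup E] {x x₀ : E}
    (hx : x ∈ Metric.ball x₀ 1) (s : ℝ) : (1 + ‖x‖) ^ s ≤ (2 + ‖x₀‖) ^ |s| := by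
  have hx' : ‖x‖ ≤ ‖x₀‖ + 1 := by
    have h1 : ‖x - x₀‖ < 1 := by simpa [dist_eq_norm] using hx
    have h2 : ‖x‖ ≤ ‖x₀‖ + ‖x - x₀‖ := by simpa using norm_add_le x₀ (x - x₀)
    linarith
  have := rpow_le_rpow_abs_mul (A := 1 + ‖x‖) (t := 2 + ‖x₀‖) (by positivity) one_pos
    (by linarith [norm_nonneg x₀]) (by linarith) (by nlinarith [norm_nonneg x, norm_nonneg x₀]) s
  rwa [Real.one_rpow, mul_one] at this

/-- The weights (1 + ‖z‖²)^{1/2} and 1 + ‖z‖ agree within a factor 2, and `rpow_le_rpow_abs_mul`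
carries this to powers of either sign. -/
theorem isShubinSymbol_iff {d : ℕ} {m : ℝ} {a : Rd d → ℂ} : IsShubinSymbol m a ↔
    ContDiff ℝ ∞ a ∧ ∀ k : ℕ, ∃ C : ℝ, ∀ z : Rd d,
      ‖iteratedFDeriv ℝ k a z‖ ≤ C * (1 + ‖z‖) ^ (m - (k : ℝ)) := by
  have hpos : ∀ z : Rd d, 0 < Real.sqrt (1 + ‖z‖ ^ 2) := fun z => Real.sqrt_pos.2 (by positivity)
  have h1 : ∀ z : Rd d, Real.sqrt (1 + ‖z‖ ^ 2) ≤ 2 * (1 + ‖z‖) := fun z => by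
    rw [Real.sqrt_le_left (by positivity)]
    nlinarith [norm_nonneg z]
  have h2 : ∀ z : Rd d, 1 + ‖z‖ ≤ 2 * Real.sqrt (1 + ‖z‖ ^ 2) := fun z => by
    have := (Real.le_sqrt' (x := (1 + ‖z‖) / 2) (y := 1 + ‖z‖ ^ 2) (by positivity)).2
      (by nlinarith [sq_nonneg (‖z‖ - 1), norm_nonneg z])
    linarith
  unfold IsShubinSymbol
  refine and_congr_right fun _ => forall_congr' fun k => ⟨?_, ?_⟩
  · rintro ⟨C, hC⟩
    refine ⟨|C| * 2 ^ |m - k|, fun z => (hC z).trans ?_⟩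
    rw [mul_assoc]
    exact mul_le_mul (le_abs_self C) (rpow_le_rpow_abs_mul (hpos z) (by positivity) one_le_two
      (h1 z) (h2 z) _) (by have := hpos z; positivity) (abs_nonneg _)
  · rintro ⟨C, hC⟩
    refine ⟨|C| * 2 ^ |m - k|, fun z => (hC z).trans ?_⟩
    rw [mul_assoc]
    exact mul_le_mul (le_abs_self C) (rpow_le_rpow_abs_mul (by positivity) (hpos z) one_le_two
      (h2 z) (h1 z) _) (by positivity) (abs_nonneg _)

theorem integrable_one_add_norm_rpow_neg_integrablePower (d : ℕ) :
    Integrable fun z : Rd d => (1 + ‖z‖) ^ (-((volume : Measure (Rd d)).integrablePower : ℝ)) :=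
  Measure.integrable_pow_neg_integrablePower _

namespace SchwartzMap

theorem integrable_rpow_mul_iteratedFDeriv {d : ℕ} (χ : 𝓢(Rd d, ℂ)) (s : ℝ) (n : ℕ) :
    Integrable fun x => (1 + ‖x‖) ^ s * ‖iteratedFDeriv ℝ n χ x‖ := by
  let N := (volume : Measure (Rd d)).integrablePower
  obtain ⟨k, hk⟩ := exists_nat_ge s
  obtain ⟨C, hC, H⟩ := χ.exists_one_add_pow_mul_le (k + N) n
  refine ((integrable_one_add_norm_rpow_neg_integrablePower d).const_mul C).mono'
    (Continuous.aestronglyMeasurable ?_) (Filter.Eventually.of_forall fun x => ?_)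
  · refine Continuous.mul (Continuous.rpow_const (by fun_prop) fun x => Or.inl ?_)
      ((χ.smooth ⊤).continuous_iteratedFDeriv (by exact_mod_cast le_top)).norm
    positivity
  · have h1 := H x
    rw [pow_add] at h1
    rw [Real.norm_of_nonneg (by positivity), Real.rpow_neg (by positivity), Real.rpow_natCast,
      ← div_eq_mul_inv, le_div_iff₀ (by positivity)]
    have h2 : (1 + ‖x‖) ^ s ≤ (1 + ‖x‖) ^ k := by
      rw [← Real.rpow_natCast]
      exact Real.rpow_le_rpow_of_exponent_le (by linarith [norm_nonneg x]) hk
    calc (1 + ‖x‖) ^ s * ‖iteratedFDeriv ℝ n χ x‖ * (1 + ‖x‖) ^ N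
        ≤ (1 + ‖x‖) ^ k * ‖iteratedFDeriv ℝ n χ x‖ * (1 + ‖x‖) ^ N := by gcongr
      _ = (1 + ‖x‖) ^ k * (1 + ‖x‖) ^ N * ‖iteratedFDeriv ℝ n χ x‖ := by ring
      _ ≤ C := h1

theorem integrable_rpow_mul {d : ℕ} (χ : 𝓢(Rd d, ℂ)) (s : ℝ) :
    Integrable fun x => (1 + ‖x‖) ^ s * ‖χ x‖ := by
  simpa using χ.integrable_rpow_mul_iteratedFDeriv s 0

/-! ### Tensor products of Schwartz functions -/

section Tensor

variable {E F : Type*} [NormedAddCommGroup E] [NormedSpace ℝ E] [NormedAddCommGroup F]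
  [NormedSpace ℝ F]

/-- The tensor product `(x, y) ↦ f(x) g(y)` of Schwartz functions. -/
noncomputable def tensor (f : 𝓢(E, ℂ)) (g : 𝓢(F, ℂ)) : 𝓢(E × F, ℂ) where
  toFun p := f p.1 * g p.2
  smooth' := ((f.smooth ⊤).comp contDiff_fst).mul ((g.smooth ⊤).comp contDiff_snd)
  decay' k n := by
    refine ⟨∑ i ∈ Finset.range (n + 1), (n.choose i : ℝ) *
      (SchwartzMap.seminorm ℂ k i f * SchwartzMap.seminorm ℂ 0 (n - i) g
        + SchwartzMap.seminorm ℂ 0 i f * SchwartzMap.seminorm ℂ k (n - i) g), fun p => ?_⟩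
    obtain ⟨x, y⟩ := p
    have hf : ∀ i, ‖iteratedFDeriv ℝ i (fun p : E × F => f p.1) (x, y)‖
        ≤ ‖iteratedFDeriv ℝ i f x‖ := fun i => by
      have h := (ContinuousLinearMap.fst ℝ E F).iteratedFDeriv_comp_right (f.smooth ⊤) (x, y)
        (i := i) (by exact_mod_cast le_top)
      refine le_trans (le_of_eq (congrArg norm h)) ?_
      refine (ContinuousMultilinearMap.norm_compContinuousLinearMap_le _ _).trans ?_
      exact mul_le_of_le_one_right (norm_nonneg _) (Finset.prod_le_one (fun _ _ => norm_nonneg _)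
        fun _ _ => ContinuousLinearMap.norm_fst_le ℝ E F)
    have hg : ∀ i, ‖iteratedFDeriv ℝ i (fun p : E × F => g p.2) (x, y)‖
        ≤ ‖iteratedFDeriv ℝ i g y‖ := fun i => by
      have h := (ContinuousLinearMap.snd ℝ E F).iteratedFDeriv_comp_right (g.smooth ⊤) (x, y)
        (i := i) (by exact_mod_cast le_top)
      refine le_trans (le_of_eq (congrArg norm h)) ?_
      refine (ContinuousMultilinearMap.norm_compContinuousLinearMap_le _ _).trans ?_
      exact mul_le_of_le_one_right (norm_nonneg _) (Finset.prod_le_one (fun _ _ => norm_nonneg _)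
        fun _ _ => ContinuousLinearMap.norm_snd_le ℝ E F)
    have hmul := norm_iteratedFDeriv_mul_le (𝕜 := ℝ) (f := fun p : E × F => f p.1)
      (g := fun p : E × F => g p.2) ((f.smooth ⊤).comp contDiff_fst)
      ((g.smooth ⊤).comp contDiff_snd) (x, y) (n := n) (by exact_mod_cast le_top)
    have hp : ‖((x, y) : E × F)‖ ^ k ≤ ‖x‖ ^ k + ‖y‖ ^ k := by
      rcases max_cases ‖x‖ ‖y‖ with h | h
      · rw [Prod.norm_mk, h.1]; linarith [pow_nonneg (norm_nonneg y) k]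
      · rw [Prod.norm_mk, h.1]; linarith [pow_nonneg (norm_nonneg x) k]
    refine (mul_le_mul_of_nonneg_left hmul (by positivity)).trans ?_
    rw [Finset.mul_sum]
    refine Finset.sum_le_sum fun i _ => ?_
    calc ‖((x, y) : E × F)‖ ^ k * ((n.choose i : ℝ) *
          ‖iteratedFDeriv ℝ i (fun p : E × F => f p.1) (x, y)‖ *
          ‖iteratedFDeriv ℝ (n - i) (fun p : E × F => g p.2) (x, y)‖)
        ≤ (‖x‖ ^ k + ‖y‖ ^ k) * ((n.choose i : ℝ) * ‖iteratedFDeriv ℝ i f x‖ *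
          ‖iteratedFDeriv ℝ (n - i) g y‖) := by
          gcongr
          · exact hf i
          · exact hg (n - i)
      _ = (n.choose i : ℝ) * ((‖x‖ ^ k * ‖iteratedFDeriv ℝ i f x‖) * ‖iteratedFDeriv ℝ (n - i) g y‖
          + ‖iteratedFDeriv ℝ i f x‖ * (‖y‖ ^ k * ‖iteratedFDeriv ℝ (n - i) g y‖)) := by ring
      _ ≤ _ := by
          gcongr
          · exact le_seminorm ℂ k i f x
          · exact norm_iteratedFDeriv_le_seminorm ℂ g _ y
          · exact norm_iteratedFDeriv_le_seminorm ℂ f _ x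
          · exact le_seminorm ℂ k _ g y

theorem tensor_apply (f : 𝓢(E, ℂ)) (g : 𝓢(F, ℂ)) (p : E × F) : tensor f g p = f p.1 * g p.2 := rfl

end Tensor

end SchwartzMap

/-! ### From short time estimates to a symbol -/

section ShortTime

open SchwartzMap Complex

variable {d : ℕ}

/-- The short time transform `(p, q) ↦ ⟨v, T_p M_q h⟩` (bilinear pairing). -/
noncomputable def shortTime (v : 𝓢(Rd d, ℂ) →L[ℂ] ℂ) (h : 𝓢(Rd d, ℂ)) (z : Rd d × Rd d) : ℂ :=
  v (translation z.1 (modulation z.2 h))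

/-- The linear automorphism `(z, y) ↦ (z, y - L z)`. -/
noncomputable def shearEquiv {Z E : Type*} [NormedAddCommGroup Z] [NormedSpace ℝ Z]
    [NormedAddCommGroup E] [NormedSpace ℝ E] (L : Z →L[ℝ] E) : (Z × E) ≃L[ℝ] (Z × E) :=
  ContinuousLinearEquiv.equivOfInverse
    ((ContinuousLinearMap.fst ℝ Z E).prod
      (ContinuousLinearMap.snd ℝ Z E - L.comp (ContinuousLinearMap.fst ℝ Z E)))
    ((ContinuousLinearMap.fst ℝ Z E).prod
      (ContinuousLinearMap.snd ℝ Z E + L.comp (ContinuousLinearMap.fst ℝ Z E)))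
    (fun x => by ext <;> simp) (fun x => by ext <;> simp)

@[simp] theorem shearEquiv_apply {Z E : Type*} [NormedAddCommGroup Z] [NormedSpace ℝ Z]
    [NormedAddCommGroup E] [NormedSpace ℝ E] (L : Z →L[ℝ] E) (p : Z × E) :
    shearEquiv L p = (p.1, p.2 - L p.1) := rfl

theorem exists_schwartz_bump {X : Type*} [NormedAddCommGroup X] [NormedSpace ℝ X]
    [FiniteDimensional ℝ X] (x : X) : ∃ χ : 𝓢(X, ℂ), ∀ᶠ y in nhds x, χ y = 1 := by
  let b : ContDiffBump x := ⟨1, 2, one_pos, one_lt_two⟩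
  have h1 : ContDiff ℝ ∞ (fun y => ((b y : ℝ) : ℂ)) := ofRealCLM.contDiff.comp b.contDiff
  have h2 : HasCompactSupport (fun y => ((b y : ℝ) : ℂ)) :=
    b.hasCompactSupport.comp_left (g := fun t : ℝ => (t : ℂ)) (by simp)
  refine ⟨h2.toSchwartzMap h1, ?_⟩
  filter_upwards [b.eventuallyEq_one] with y hy
  change ((b y : ℝ) : ℂ) = 1
  rw [hy]; simp

/-- The kernel e^{i⟨y-p, q⟩} h(y-p) is not Schwartz jointly in (p, q, y). Smoothness is local, so a
cutoff equal to one near the given (p, q) makes it Schwartz and `contDiff_apply_slice` applies. -/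
theorem contDiff_shortTime (v : 𝓢(Rd d, ℂ) →L[ℂ] ℂ) (h : 𝓢(Rd d, ℂ)) :
    ContDiff ℝ ∞ (shortTime v h) := by
  rw [contDiff_iff_contDiffAt]
  intro z₀
  obtain ⟨χ, hχ⟩ := exists_schwartz_bump z₀
  let P : (Rd d × Rd d) × Rd d → ℂ := fun w =>
    exp (I * ((inner ℝ (w.2 - w.1.1) w.1.2 : ℝ) : ℂ))
  have hP : Function.HasTemperateGrowth P := by
    have h1 : Function.HasTemperateGrowth
        (fun w : (Rd d × Rd d) × Rd d => (inner ℝ (w.2 - w.1.1) w.1.2 : ℝ)) := by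
      refine (innerSL ℝ).bilinear_hasTemperateGrowth
        (f := fun w : (Rd d × Rd d) × Rd d => w.2 - w.1.1) (g := fun w => w.1.2) ?_ ?_
      · exact (ContinuousLinearMap.snd ℝ (Rd d × Rd d) (Rd d)
          - (ContinuousLinearMap.fst ℝ (Rd d) (Rd d)).comp
            (ContinuousLinearMap.fst ℝ (Rd d × Rd d) (Rd d))).hasTemperateGrowth
      · exact ((ContinuousLinearMap.snd ℝ (Rd d) (Rd d)).comp
            (ContinuousLinearMap.fst ℝ (Rd d × Rd d) (Rd d))).hasTemperateGrowth
    exact hasTemperateGrowth_exp_I_mul.comp h1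
  let K : 𝓢((Rd d × Rd d) × Rd d, ℂ) := smulLeftCLM ℂ P
    (compCLMOfContinuousLinearEquiv ℂ (shearEquiv (ContinuousLinearMap.fst ℝ (Rd d) (Rd d)))
      (tensor χ h))
  have hK : ∀ z, slice z K = χ z • translation z.1 (modulation z.2 h) := by
    intro z
    ext y
    simp only [slice_apply, K, smul_apply, smul_eq_mul, translation_apply, modulation_apply]
    rw [smulLeftCLM_apply_apply hP, compCLMOfContinuousLinearEquiv_apply, Function.comp_apply,
      tensor_apply, shearEquiv_apply, smul_eq_mul]
    simp only [P, ContinuousLinearMap.coe_fst']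
    ring
  refine (contDiff_apply_slice v K).contDiffAt.congr_of_eventuallyEq ?_
  filter_upwards [hχ] with z hz
  rw [hK, hz, one_smul, shortTime]

/-- A functional whose short time transform has symbol type estimates is given by a symbol. -/
theorem exists_symbol_of_shortTime {m : ℝ} (v : 𝓢(Rd d, ℂ) →L[ℂ] ℂ) (h : 𝓢(Rd d, ℂ)) (h0 : h ≠ 0)
    (H : ∀ j N : ℕ, ∃ C : ℝ, ∀ p q : Rd d,
      ‖iteratedFDeriv ℝ j (fun p => shortTime v h (p, q)) p‖
        ≤ C * (1 + ‖p‖) ^ (m - (j : ℝ)) * (1 + ‖q‖) ^ (-(N : ℝ))) :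
    ∃ a : Rd d → ℂ, IsShubinSymbol m a ∧ ∀ χ : 𝓢(Rd d, ℂ), v χ = ∫ x, a x * χ x := by
  obtain ⟨ps, hps⟩ : ∃ p, h p ≠ 0 := by
    by_contra hc
    push Not at hc
    exact h0 (SchwartzMap.ext hc)
  let N := (volume : Measure (Rd d)).integrablePower
  have hint := integrable_one_add_norm_rpow_neg_integrablePower d
  let e : Rd d → ℂ := fun q => exp (-(I * ((inner ℝ ps q : ℝ) : ℂ)))
  have he : ∀ q, ‖e q‖ = 1 := fun q => by
    simp only [e]
    rw [← mul_neg, ← ofReal_neg, norm_exp_I_mul_ofReal']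
  let c : ℂ := ((((2 * Real.pi) ^ d : ℝ) : ℂ) * h ps)⁻¹
  have hπ : (((2 * Real.pi) ^ d : ℝ) : ℂ) ≠ 0 := by
    exact_mod_cast (by positivity : ((2 * Real.pi) ^ d : ℝ) ≠ 0)
  -- If v were a function, e(q) ⟨v, T_{x-ps} M_q h⟩ would be ∫ v(y) e^{i⟨y-x, q⟩} h(y-x+ps) dy,
  -- whose integral over q is (2π)^d h(ps) v(x) by Fourier inversion; this fixes c and e.
  let G : Rd d × Rd d → ℂ := fun z => (c * e z.2) • shortTime v h (z.1 - ps, z.2)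
  have hec : ContDiff ℝ ∞ e := by
    have h1 : ContDiff ℝ ∞ fun q : Rd d => ((inner ℝ ps q : ℝ) : ℂ) :=
      ofRealCLM.contDiff.comp (innerSL ℝ ps).contDiff
    exact (contDiff_const.mul h1).neg.cexp
  have hGs : ContDiff ℝ ∞ G :=
    (contDiff_const.mul (hec.comp contDiff_snd)).smul ((contDiff_shortTime v h).comp
      ((contDiff_fst.sub contDiff_const).prodMk contDiff_snd))
  choose C hC using H
  have hC0 : ∀ j N, 0 ≤ C j N := fun j N => by
    have := (norm_nonneg _).trans (hC j N 0 0)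
    simpa using this
  have hGb : ∀ (j n : ℕ) (x q : Rd d), ‖iteratedFDeriv ℝ j (fun x => G (x, q)) x‖
      ≤ ‖c‖ * C j n * (1 + ‖ps‖) ^ |m - j| * (1 + ‖x‖) ^ (m - (j : ℝ)) *
        (1 + ‖q‖) ^ (-(n : ℝ)) := by
    intro j n x q
    have h1 : iteratedFDeriv ℝ j (fun x => G (x, q)) x
        = (c * e q) • iteratedFDeriv ℝ j (fun p => shortTime v h (p, q)) (x - ps) := by
      rw [← iteratedFDeriv_comp_sub, ← iteratedFDeriv_const_smul_apply']
      exact (((contDiff_shortTime v h).comp ((contDiff_id.sub contDiff_const).prodMk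
        contDiff_const)).of_le (by exact_mod_cast le_top)).contDiffAt
    rw [h1, norm_smul, norm_mul, he, mul_one]
    calc ‖c‖ * ‖iteratedFDeriv ℝ j (fun p => shortTime v h (p, q)) (x - ps)‖
        ≤ ‖c‖ * (C j n * (1 + ‖x - ps‖) ^ (m - (j : ℝ)) * (1 + ‖q‖) ^ (-(n : ℝ))) := by
          gcongr
          exact hC j n _ _
      _ ≤ ‖c‖ * (C j n * ((1 + ‖ps‖) ^ |m - j| * (1 + ‖x‖) ^ (m - (j : ℝ))) *
          (1 + ‖q‖) ^ (-(n : ℝ))) := by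
          gcongr
          · exact hC0 j n
          · exact one_add_norm_sub_rpow_le x ps _
      _ = _ := by ring
  have hm : ∀ j x, AEStronglyMeasurable (fun q => iteratedFDeriv ℝ j (fun x => G (x, q)) x) :=
    fun j x => ((continuous_iteratedFDeriv_slice_left hGs j).comp
      (Continuous.prodMk_right x)).aestronglyMeasurable
  have hloc : ∀ j (x₀ : Rd d), ∃ s ∈ nhds x₀, ∃ bound : Rd d → ℝ, Integrable bound ∧
      ∀ q, ∀ x ∈ s, ‖iteratedFDeriv ℝ j (fun x => G (x, q)) x‖ ≤ bound q := by
    intro j x₀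
    refine ⟨Metric.ball x₀ 1, Metric.ball_mem_nhds x₀ one_pos, fun q => ‖c‖ * C j N *
      (1 + ‖ps‖) ^ |m - j| * (2 + ‖x₀‖) ^ |m - j| *
        (1 + ‖q‖) ^ (-(N : ℝ)), hint.const_mul _, fun q x hx => (hGb j N x q).trans ?_⟩
    have hcc := hC0 j N
    exact mul_le_mul_of_nonneg_right (mul_le_mul_of_nonneg_left
      (one_add_norm_rpow_le_of_mem_ball hx _) (by positivity)) (by positivity)
  have hG1 : ∀ q, ContDiff ℝ ∞ fun x => G (x, q) := fun q =>
    hGs.comp (contDiff_id.prodMk contDiff_const)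
  let a : Rd d → ℂ := fun x => ∫ q, G (x, q)
  refine ⟨a, isShubinSymbol_iff.2 ⟨contDiff_integral (H := fun x q => G (x, q)) hG1 hm hloc,
    fun j => ?_⟩, fun χ => ?_⟩
  · refine ⟨‖c‖ * C j N * (1 + ‖ps‖) ^ |m - j| * ∫ q : Rd d, (1 + ‖q‖) ^ (-(N : ℝ)), fun x => ?_⟩
    rw [show iteratedFDeriv ℝ j a x = ∫ q, iteratedFDeriv ℝ j (fun x => G (x, q)) x from
      iteratedFDeriv_integral (H := fun x q => G (x, q)) hG1 hm hloc j x]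
    refine (norm_integral_le_of_norm_le (hint.const_mul _)
      (Filter.Eventually.of_forall fun q => hGb j N x q)).trans (le_of_eq ?_)
    rw [integral_const_mul]
    ring
  · have hF : Integrable (fun z : Rd d × Rd d => G z * χ z.1) (volume.prod volume) := by
      have h1 := Integrable.mul_prod ((χ.integrable_rpow_mul m).const_mul
        (‖c‖ * C 0 N * (1 + ‖ps‖) ^ |m|)) hint
      refine h1.mono' (hGs.continuous.mul
        (χ.continuous.comp continuous_fst)).aestronglyMeasurable
        (Filter.Eventually.of_forall fun z => ?_)
      have h2 := hGb 0 N z.1 z.2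
      rw [norm_iteratedFDeriv_zero] at h2
      simp only [Nat.cast_zero, sub_zero] at h2
      rw [norm_mul]
      calc ‖G z‖ * ‖χ z.1‖ ≤ ‖c‖ * C 0 N * (1 + ‖ps‖) ^ |m| * (1 + ‖z.1‖) ^ m *
            (1 + ‖z.2‖) ^ (-(N : ℝ)) * ‖χ z.1‖ := by gcongr
        _ = _ := by ring
    -- The case j = 0 of the bound, together with the decay of χ, makes G(x, q) χ(x) integrable in
    -- both variables, so Fubini applies.
    have hswap : ∫ x, a x * χ x = ∫ q, ∫ x, G (x, q) * χ x := by
      rw [integral_integral_swap (f := fun q x => G (x, q) * χ x) hF.swap]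
      refine integral_congr_ae (Filter.Eventually.of_forall fun x => ?_)
      exact (integral_mul_const (χ x) fun q => G (x, q)).symm
    -- The inversion is carried out on test functions. For fixed q, the average of T_{x-ps} M_q h
    -- against χ(x) dx is, up to e^{i⟨ps, q⟩}, the partial Fourier transform of χ(y-w) h(w+ps) in w.
    let K₁ : 𝓢(Rd d × Rd d, ℂ) := compCLMOfContinuousLinearEquiv ℂ
      ((ContinuousLinearEquiv.prodComm ℝ (Rd d) (Rd d)).trans
        ((shearEquiv (ContinuousLinearMap.id ℝ (Rd d))).trans
          (ContinuousLinearEquiv.prodComm ℝ (Rd d) (Rd d)))) (tensor χ (translation (-ps) h))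
    have hK₁ : ∀ y w, K₁ (y, w) = χ (y - w) * h (w + ps) := fun y w => by
      simp [K₁, tensor_apply, translation_apply]
    let K₂ : 𝓢(Rd d × Rd d, ℂ) := compCLMOfContinuousLinearEquiv ℂ
      (ContinuousLinearEquiv.prodComm ℝ (Rd d) (Rd d)) (partialFourier K₁)
    have hK₂ : ∀ q y, K₂ (q, y) = partialFourier K₁ (y, q) := fun q y => rfl
    have hinner : ∀ q, ∫ x, G (x, q) * χ x = c * v (slice q K₂) := by
      intro q
      let Kq : 𝓢(Rd d × Rd d, ℂ) := compCLMOfContinuousLinearEquiv ℂ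
        (shearEquiv (ContinuousLinearMap.id ℝ (Rd d)))
        (tensor χ (translation (-ps) (modulation q h)))
      have hKq : ∀ x, slice x Kq = χ x • translation (x - ps) (modulation q h) := fun x => by
        ext y
        simp only [slice_apply, Kq, smul_apply, smul_eq_mul, translation_apply]
        rw [compCLMOfContinuousLinearEquiv_apply, Function.comp_apply, tensor_apply,
          shearEquiv_apply, translation_apply]
        simp only [ContinuousLinearMap.id_apply]
        congr 2
        abel
      have h1 := apply_eq_integral_slice (volume : Measure (Rd d)) v Kq
        (exp (I * ((inner ℝ ps q : ℝ) : ℂ)) • slice q K₂) fun y => by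
          rw [smul_apply, slice_apply, hK₂, partialFourier_apply, smul_eq_mul,
            ← integral_const_mul, ← integral_sub_left_eq_self _ volume y]
          refine integral_congr_ae (Filter.Eventually.of_forall fun x => ?_)
          simp only [hK₁, Kq]
          rw [compCLMOfContinuousLinearEquiv_apply, Function.comp_apply, tensor_apply,
            shearEquiv_apply, translation_apply, modulation_apply]
          simp only [ContinuousLinearMap.id_apply, sub_neg_eq_add, sub_sub_cancel, inner_add_left]
          rw [ofReal_add, mul_add, exp_add]
          ring
      rw [map_smul, smul_eq_mul] at h1
      have h2 : v (slice q K₂) = e q * ∫ x, v (slice x Kq) := by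
        rw [← h1, ← mul_assoc, ← exp_add]
        simp
      rw [h2, ← mul_assoc, ← integral_const_mul]
      refine integral_congr_ae (Filter.Eventually.of_forall fun x => ?_)
      simp only [G, hKq, map_smul, smul_eq_mul, shortTime]
      ring
    -- Integrating over q amounts to a second partial Fourier transform evaluated at 0, giving
    -- (2π)^d K₁(y, 0) = (2π)^d h(ps) χ(y).
    have hfin := apply_eq_integral_slice (volume : Measure (Rd d)) v K₂
      (((((2 * Real.pi) ^ d : ℝ) : ℂ) * h ps) • χ) fun y => by
        have h1 := partialFourier_partialFourier K₁ y 0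
        rw [partialFourier_apply, neg_zero, hK₁, finrank_euclideanSpace_fin] at h1
        simp only [inner_zero_right, ofReal_zero, mul_zero, exp_zero, one_mul, sub_zero,
          zero_add] at h1
        simp only [hK₂]
        rw [h1, smul_apply, smul_eq_mul]
        ring
    rw [hswap]
    simp only [hinner]
    rw [integral_const_mul, ← hfin, map_smul, smul_eq_mul, ← mul_assoc, inv_mul_cancel₀, one_mul]
    exact mul_ne_zero hπ hps

end ShortTime

/-! ### From a symbol to short time estimates -/

section SymbolTransform

open SchwartzMap Complex FourierTransform

variable {d : ℕ}

theorem one_add_norm_add_rpow_le {E : Type*} [NormedAddCommGroup E] (x y : E) (s : ℝ) :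
    (1 + ‖x + y‖) ^ s ≤ (1 + ‖y‖) ^ |s| * (1 + ‖x‖) ^ s := by
  simpa using one_add_norm_sub_rpow_le x (-y) s

theorem IsShubinSymbol.fderiv_apply {s : ℝ} {a : Rd d → ℂ} (ha : IsShubinSymbol s a) (w : Rd d) :
    IsShubinSymbol (s - 1) (fun x => fderiv ℝ a x w) := by
  rw [isShubinSymbol_iff] at ha ⊢
  obtain ⟨hs, hb⟩ := ha
  have hd : ContDiff ℝ ∞ (fderiv ℝ a) := (contDiff_infty_iff_fderiv.1 hs).2
  refine ⟨hd.clm_apply contDiff_const, fun k => ?_⟩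
  obtain ⟨C, hC⟩ := hb (k + 1)
  refine ⟨‖w‖ * C, fun z => ?_⟩
  have h1 := (ContinuousLinearMap.apply ℝ ℂ w).norm_iteratedFDeriv_comp_left
    (f := fderiv ℝ a) (x := z) hd.contDiffAt (n := k) (by exact_mod_cast le_top)
  have h2 : ‖ContinuousLinearMap.apply ℝ ℂ w‖ ≤ ‖w‖ :=
    ContinuousLinearMap.opNorm_le_bound _ (norm_nonneg _) fun f => by
      rw [mul_comm]; exact f.le_opNorm w
  have h3 := hC z
  rw [← norm_iteratedFDeriv_fderiv] at h3
  calc ‖iteratedFDeriv ℝ k (fun x => fderiv ℝ a x w) z‖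
      ≤ ‖ContinuousLinearMap.apply ℝ ℂ w‖ * ‖iteratedFDeriv ℝ k (fderiv ℝ a) z‖ := h1
    _ ≤ ‖w‖ * (C * (1 + ‖z‖) ^ (s - ((k + 1 : ℕ) : ℝ))) := by gcongr
    _ = ‖w‖ * C * (1 + ‖z‖) ^ (s - 1 - (k : ℝ)) := by
        rw [← mul_assoc]; congr 2; push_cast; ring

theorem IsShubinSymbol.norm_le {s : ℝ} {a : Rd d → ℂ} (ha : IsShubinSymbol s a) :
    ∃ C, ∀ z, ‖a z‖ ≤ C * (1 + ‖z‖) ^ s := by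
  obtain ⟨C, hC⟩ := (isShubinSymbol_iff.1 ha).2 0
  exact ⟨C, fun z => by simpa using hC z⟩

theorem IsShubinSymbol.norm_fderiv_le {s : ℝ} {a : Rd d → ℂ} (ha : IsShubinSymbol s a) :
    ∃ C, ∀ z, ‖fderiv ℝ a z‖ ≤ C * (1 + ‖z‖) ^ (s - 1) := by
  obtain ⟨C, hC⟩ := (isShubinSymbol_iff.1 ha).2 1
  refine ⟨C, fun z => ?_⟩
  have := hC z
  rwa [norm_iteratedFDeriv_one, Nat.cast_one] at this

theorem IsShubinSymbol.integrable_mul {s : ℝ} {a : Rd d → ℂ} (ha : IsShubinSymbol s a)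
    (χ : 𝓢(Rd d, ℂ)) : Integrable fun x => a x * χ x := by
  obtain ⟨C, hC⟩ := ha.norm_le
  refine ((χ.integrable_rpow_mul s).const_mul C).mono'
    (ha.1.continuous.mul χ.continuous).aestronglyMeasurable
    (Filter.Eventually.of_forall fun x => ?_)
  rw [norm_mul, ← mul_assoc]
  exact mul_le_mul_of_nonneg_right (hC x) (norm_nonneg _)

/-- Near p, Peetre's inequality dominates the derivative of the integrand by a power of 1 + ‖y‖
times |φ(y)|. The derivative has the same form with a derivative of a as the new symbol, so the
family is closed. -/
theorem hasFDerivAt_integral_symbol {s : ℝ} {a : Rd d → ℂ} (ha : IsShubinSymbol s a)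
    (φ : 𝓢(Rd d, ℂ)) (p : Rd d) :
    ∃ L : Rd d →L[ℝ] ℂ, HasFDerivAt (fun p => ∫ y, a (p + y) * φ y) L p ∧
      ∀ w, L w = ∫ y, fderiv ℝ a (p + y) w * φ y := by
  obtain ⟨C₀, hC₀⟩ := ha.norm_le
  obtain ⟨C₁, hC₁⟩ := ha.norm_fderiv_le
  have hC₀0 : 0 ≤ C₀ := by simpa using (norm_nonneg _).trans (hC₀ 0)
  have hC₁0 : 0 ≤ C₁ := by simpa using (norm_nonneg _).trans (hC₁ 0)
  have hdc : Continuous (fderiv ℝ a) := ha.1.continuous_fderiv (by simp)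
  let f' : Rd d → Rd d → (Rd d →L[ℝ] ℂ) := fun p y => φ y • fderiv ℝ a (p + y)
  have hc : ∀ p, Continuous fun y => a (p + y) * φ y := fun p =>
    (ha.1.continuous.comp (continuous_const.add continuous_id)).mul φ.continuous
  have hc' : ∀ p, Continuous (f' p) := fun p =>
    φ.continuous.smul (hdc.comp (continuous_const.add continuous_id))
  have hb : ∀ q ∈ Metric.ball p 1, ∀ y, ‖f' q y‖ ≤
      C₁ * (2 + ‖p‖) ^ |s - 1| * ((1 + ‖y‖) ^ |s - 1| * ‖φ y‖) := by
    intro q hq y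
    rw [norm_smul]
    calc ‖φ y‖ * ‖fderiv ℝ a (q + y)‖
        ≤ ‖φ y‖ * (C₁ * ((1 + ‖y‖) ^ |s - 1| * (2 + ‖p‖) ^ |s - 1|)) := by
          gcongr
          refine (hC₁ _).trans (mul_le_mul_of_nonneg_left ?_ hC₁0)
          refine (one_add_norm_add_rpow_le q y _).trans ?_
          gcongr
          exact one_add_norm_rpow_le_of_mem_ball hq _
      _ = _ := by ring
  have hbi : Integrable fun y => C₁ * (2 + ‖p‖) ^ |s - 1| * ((1 + ‖y‖) ^ |s - 1| * ‖φ y‖) :=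
    (φ.integrable_rpow_mul _).const_mul _
  have hi : Integrable fun y => a (p + y) * φ y := by
    refine ((φ.integrable_rpow_mul |s|).const_mul (C₀ * (1 + ‖p‖) ^ s)).mono'
      (hc p).aestronglyMeasurable (Filter.Eventually.of_forall fun y => ?_)
    rw [norm_mul]
    calc ‖a (p + y)‖ * ‖φ y‖ ≤ C₀ * ((1 + ‖y‖) ^ |s| * (1 + ‖p‖) ^ s) * ‖φ y‖ := by
          gcongr
          exact (hC₀ _).trans (mul_le_mul_of_nonneg_left (one_add_norm_add_rpow_le p y s) hC₀0)
      _ = _ := by ring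
  have hp : p ∈ Metric.ball p 1 := Metric.mem_ball_self one_pos
  have hi' : Integrable (f' p) := hbi.mono' (hc' p).aestronglyMeasurable
    (Filter.Eventually.of_forall (hb p hp))
  refine ⟨∫ y, f' p y, ?_, fun w => ?_⟩
  · refine hasFDerivAt_integral_of_dominated_of_fderiv_le (𝕜 := ℝ)
      (Metric.ball_mem_nhds p one_pos)
      (Filter.Eventually.of_forall fun q => (hc q).aestronglyMeasurable) hi
      (hc' p).aestronglyMeasurable (Filter.Eventually.of_forall fun y q hq => hb q hq y) hbi
      (Filter.Eventually.of_forall fun y q _ => ?_)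
    have h1 : HasFDerivAt (fun q => a (q + y)) (fderiv ℝ a (q + y)) q := by
      have := (ha.1.differentiable (by simp) (q + y)).hasFDerivAt
      exact (hasFDerivAt_comp_add_right y).2 this
    exact h1.mul_const (φ y)
  · rw [ContinuousLinearMap.integral_apply hi']
    refine integral_congr_ae (Filter.Eventually.of_forall fun y => ?_)
    simp [f', mul_comm]

/-- The integral is the Fourier transform of a(p + ·) h at -q/(2π). By Leibniz and Peetre, every
derivative of this product is at most (1 + ‖p‖)^s times an integrable function independent of p, so
decay in q comes uniformly with that weight. -/
theorem exists_norm_integral_symbol_le {s : ℝ} {a : Rd d → ℂ} (ha : IsShubinSymbol s a)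
    (h : 𝓢(Rd d, ℂ)) (n : ℕ) : ∃ C, 0 ≤ C ∧ ∀ p q : Rd d,
      ‖∫ y, a (p + y) * modulation q h y‖ ≤ C * (1 + ‖p‖) ^ s * (1 + ‖q‖) ^ (-(n : ℝ)) := by
  choose A hA using (isShubinSymbol_iff.1 ha).2
  have hA0 : ∀ i, 0 ≤ A i := fun i => by simpa using (norm_nonneg _).trans (hA i 0)
  let g : ℕ → Rd d → ℝ := fun l y => ∑ i ∈ Finset.range (l + 1), (l.choose i : ℝ) * A i *
    ((1 + ‖y‖) ^ |s| * ‖iteratedFDeriv ℝ (l - i) h y‖)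
  have hgi : ∀ l, Integrable (g l) := fun l => integrable_finsetSum _ fun i _ =>
    (h.integrable_rpow_mul_iteratedFDeriv |s| (l - i)).const_mul _
  have hsm : ∀ p, ContDiff ℝ ∞ fun y => a (p + y) * h y := fun p =>
    (ha.1.comp (contDiff_const.add contDiff_id)).mul (h.smooth ⊤)
  have hfb : ∀ p l y, ‖iteratedFDeriv ℝ l (fun y => a (p + y) * h y) y‖
      ≤ (1 + ‖p‖) ^ s * g l y := by
    intro p l y
    refine (norm_iteratedFDeriv_mul_le (ha.1.comp (contDiff_const.add contDiff_id))
      (h.smooth ⊤) y (n := l) (by exact_mod_cast le_top)).trans ?_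
    rw [Finset.mul_sum]
    refine Finset.sum_le_sum fun i _ => ?_
    have h1 : ‖iteratedFDeriv ℝ i (a ∘ fun x => p + x) y‖
        ≤ A i * ((1 + ‖y‖) ^ |s| * (1 + ‖p‖) ^ s) := by
      have h2 : iteratedFDeriv ℝ i (a ∘ fun x => p + x) y = iteratedFDeriv ℝ i a (p + y) :=
        iteratedFDeriv_comp_add_left i p y
      rw [h2]
      refine (hA i _).trans (mul_le_mul_of_nonneg_left ?_ (hA0 i))
      refine le_trans ?_ (one_add_norm_add_rpow_le p y s)
      -- The gain of order from derivatives in y is discarded: they only serve to produce decay in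
      -- q.
      exact Real.rpow_le_rpow_of_exponent_le (by linarith [norm_nonneg (p + y)]) (by simp)
    calc (l.choose i : ℝ) * ‖iteratedFDeriv ℝ i (a ∘ fun x => p + x) y‖ *
          ‖iteratedFDeriv ℝ (l - i) h y‖
        ≤ (l.choose i : ℝ) * (A i * ((1 + ‖y‖) ^ |s| * (1 + ‖p‖) ^ s)) *
          ‖iteratedFDeriv ℝ (l - i) h y‖ := by gcongr
      _ = _ := by ring
  have hint : ∀ p l, Integrable fun y => ‖iteratedFDeriv ℝ l (fun y => a (p + y) * h y) y‖ :=
    fun p l => ((hgi l).const_mul ((1 + ‖p‖) ^ s)).mono'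
      ((hsm p).continuous_iteratedFDeriv (by exact_mod_cast le_top)).norm.aestronglyMeasurable
      (Filter.Eventually.of_forall fun y => by rw [norm_norm]; exact hfb p l y)
  have hint' : ∀ p l, ∫ y, ‖iteratedFDeriv ℝ l (fun y => a (p + y) * h y) y‖
      ≤ (1 + ‖p‖) ^ s * ∫ y, g l y := fun p l => by
    rw [← integral_const_mul]
    exact integral_mono (hint p l) ((hgi l).const_mul _) (hfb p l)
  let J : ℕ → ℝ := fun n => 2 ^ n * ∑ l ∈ Finset.range (n + 1), ∫ y, g l y
  have hfour : ∀ p w (n : ℕ), ‖w‖ ^ n * ‖𝓕 (fun y => a (p + y) * h y) w‖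
      ≤ (1 + ‖p‖) ^ s * J n := by
    intro p w n
    have h1 := Real.pow_mul_norm_iteratedFDeriv_fourier_le (K := 0) (N := (n : ℕ∞))
      (f := fun y => a (p + y) * h y) ((hsm p).of_le (by exact_mod_cast le_top))
      (fun k l hk _ => by
        have : k = 0 := by simpa using hk
        subst this
        simpa using hint p l) (k := 0) (n := n) le_rfl le_rfl w
    rw [norm_iteratedFDeriv_zero] at h1
    refine h1.trans ?_
    rw [Finset.sum_product]
    simp only [zero_add, Finset.range_one, Finset.sum_singleton, pow_zero, one_mul,
      Nat.cast_zero, mul_zero]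
    simp only [J]
    rw [mul_left_comm]
    refine mul_le_mul_of_nonneg_left ?_ (by positivity)
    rw [Finset.mul_sum]
    exact Finset.sum_le_sum fun l _ => hint' p l
  have hrel : ∀ p q, ∫ y, a (p + y) * modulation q h y
      = 𝓕 (fun y => a (p + y) * h y) (-(2 * Real.pi)⁻¹ • q) := by
    intro p q
    rw [Real.fourier_eq']
    refine integral_congr_ae (Filter.Eventually.of_forall fun y => ?_)
    simp only [modulation_apply, smul_eq_mul]
    have : exp (I * ((inner ℝ y q : ℝ) : ℂ))
        = exp (((-2 * Real.pi * inner ℝ y (-(2 * Real.pi)⁻¹ • q) : ℝ) : ℂ) * I) := by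
      congr 1
      rw [inner_smul_right]
      have : (Real.pi : ℂ) ≠ 0 := by exact_mod_cast Real.pi_ne_zero
      push_cast
      field_simp
    rw [this]
    ring
  have hg0 : ∀ l, 0 ≤ ∫ y, g l y := fun l => integral_nonneg fun y =>
    Finset.sum_nonneg fun i _ => by have := hA0 i; positivity
  have hJ0 : ∀ n, 0 ≤ J n := fun n =>
    mul_nonneg (by positivity) (Finset.sum_nonneg fun l _ => hg0 l)
  refine ⟨2 ^ n * (J 0 + (2 * Real.pi) ^ n * J n), by have := hJ0 0; have := hJ0 n; positivity,
    fun p q => ?_⟩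
  rw [hrel]
  set w := -(2 * Real.pi)⁻¹ • q with hw
  have hq : ‖q‖ = 2 * Real.pi * ‖w‖ := by
    rw [hw, norm_smul, norm_neg, norm_inv, Real.norm_of_nonneg (by positivity)]
    field_simp
  set X := ‖𝓕 (fun y => a (p + y) * h y) w‖
  have h0 : X ≤ (1 + ‖p‖) ^ s * J 0 := by simpa using hfour p w 0
  have h1 : ‖q‖ ^ n * X ≤ (2 * Real.pi) ^ n * ((1 + ‖p‖) ^ s * J n) := by
    rw [hq, mul_pow, mul_assoc]
    exact mul_le_mul_of_nonneg_left (hfour p w n) (by positivity)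
  have h2 : (1 + ‖q‖) ^ n ≤ 2 ^ n * (1 + ‖q‖ ^ n) := by
    rcases le_total ‖q‖ 1 with hq1 | hq1
    · calc (1 + ‖q‖) ^ n ≤ 2 ^ n := pow_le_pow_left₀ (by positivity) (by linarith) n
        _ ≤ 2 ^ n * (1 + ‖q‖ ^ n) := le_mul_of_one_le_right (by positivity)
            (by linarith [pow_nonneg (norm_nonneg q) n])
    · calc (1 + ‖q‖) ^ n ≤ (2 * ‖q‖) ^ n := pow_le_pow_left₀ (by positivity) (by linarith) n
        _ = 2 ^ n * ‖q‖ ^ n := mul_pow _ _ _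
        _ ≤ 2 ^ n * (1 + ‖q‖ ^ n) := by gcongr; linarith
  rw [Real.rpow_neg (by positivity), Real.rpow_natCast, ← div_eq_mul_inv,
    le_div_iff₀ (by positivity)]
  calc X * (1 + ‖q‖) ^ n ≤ X * (2 ^ n * (1 + ‖q‖ ^ n)) := by gcongr
    _ = 2 ^ n * (X + ‖q‖ ^ n * X) := by ring
    _ ≤ 2 ^ n * ((1 + ‖p‖) ^ s * J 0 + (2 * Real.pi) ^ n * ((1 + ‖p‖) ^ s * J n)) := by gcongr
    _ = _ := by ring

/-- The short time transform of a symbol satisfies symbol type estimates. -/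
theorem exists_shortTime_le_of_symbol {m : ℝ} {a : Rd d → ℂ} (ha : IsShubinSymbol m a)
    (v : 𝓢(Rd d, ℂ) →L[ℂ] ℂ) (hv : ∀ χ : 𝓢(Rd d, ℂ), v χ = ∫ x, a x * χ x) (h : 𝓢(Rd d, ℂ))
    (j n : ℕ) : ∃ C : ℝ, ∀ p q : Rd d,
      ‖iteratedFDeriv ℝ j (fun p => shortTime v h (p, q)) p‖
        ≤ C * (1 + ‖p‖) ^ (m - (j : ℝ)) * (1 + ‖q‖) ^ (-(n : ℝ)) := by
  -- The order is carried along with the symbol, so that j derivatives in p lead to a member of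
  -- order m - j.
  let S := {b : ℝ × (Rd d → ℂ) // IsShubinSymbol b.1 b.2}
  let D : Rd d → S → S := fun w b =>
    ⟨(b.1.1 - 1, fun x => fderiv ℝ b.1.2 x w), b.2.fderiv_apply w⟩
  let T : Rd d → S → Rd d → ℂ := fun q b p => ∫ y, b.1.2 (p + y) * modulation q h y
  have hT : ∀ q b p, ∃ L : Rd d →L[ℝ] ℂ, HasFDerivAt (T q b) L p ∧ ∀ w, L w = T q (D w b) p :=
    fun q b p => hasFDerivAt_integral_symbol b.2 (modulation q h) p
  let b₀ : S := ⟨(m, a), ha⟩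
  have hG : ∀ q, (fun p => shortTime v h (p, q)) = T q b₀ := by
    intro q
    funext p
    rw [shortTime, hv, ← integral_add_left_eq_self _ p]
    simp [T, b₀, translation_apply]
  have hord : ∀ (j : ℕ) (w : Fin j → Rd d) (b : S), (iterFamily D j w b).1.1 = b.1.1 - j := by
    intro j
    induction j with
    | zero => intro w b; simp [iterFamily]
    | succ j ih =>
      intro w b
      rw [iterFamily, ih]
      simp only [D]
      push_cast
      ring
  obtain ⟨c, hc0, hc⟩ := exists_norm_multilinear_le_sum (X := Rd d) (F := ℂ) j
  choose C hC0 hC using fun r : Fin j → Fin (Module.finrank ℝ (Rd d)) =>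
    exists_norm_integral_symbol_le
      (iterFamily D j (fun i => Module.finBasis ℝ (Rd d) (r i)) b₀).2 h n
  refine ⟨c * ∑ r, C r, fun p q => ?_⟩
  rw [hG]
  refine (hc _).trans ?_
  rw [mul_assoc, mul_assoc, Finset.sum_mul]
  refine mul_le_mul_of_nonneg_left (Finset.sum_le_sum fun r _ => ?_) hc0
  rw [iteratedFDeriv_family_apply (T q) D (hT q)]
  have := hC r p q
  rw [hord, mul_assoc] at this
  exact this

end SymbolTransform

/-! ### The splitting of ℝⁿ⁺ᵏ and the partial inverse Fourier transform -/

section Coordinates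

open SchwartzMap Complex

variable {n k : ℕ}

@[simp] theorem fstVec_joinVec (y : Rd n) (θ : Rd k) : fstVec (joinVec y θ) = y := by
  ext i
  simp [fstVec, joinVec]

@[simp] theorem sndVec_joinVec (y : Rd n) (θ : Rd k) : sndVec (joinVec y θ) = θ := by
  ext i
  simp [sndVec, joinVec]

@[simp] theorem joinVec_fstVec_sndVec (z : Rd (n + k)) : joinVec (fstVec z) (sndVec z) = z := by
  ext i
  refine Fin.addCases (fun i => ?_) (fun i => ?_) i <;> simp [sndVec, fstVec, joinVec]

theorem inner_eq_fstVec_add_sndVec (x y : Rd (n + k)) :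
    (inner ℝ x y : ℝ) = inner ℝ (fstVec x) (fstVec y) + inner ℝ (sndVec x) (sndVec y) := by
  simp [PiLp.inner_apply, Fin.sum_univ_add, fstVec, sndVec]

/-- The isometry `ℝⁿ × ℝᵏ ≃ ℝⁿ⁺ᵏ`. -/
noncomputable def joinIsometry (n k : ℕ) : WithLp 2 (Rd n × Rd k) ≃ₗᵢ[ℝ] Rd (n + k) :=
  LinearEquiv.isometryOfInner
    { toFun := fun p => joinVec p.fst p.snd
      invFun := fun z => WithLp.toLp 2 (fstVec z, sndVec z)
      map_add' := fun p q => by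
        ext i
        refine Fin.addCases (fun i => ?_) (fun i => ?_) i <;> simp [joinVec]
      map_smul' := fun c p => by
        ext i
        refine Fin.addCases (fun i => ?_) (fun i => ?_) i <;> simp [joinVec]
      left_inv := fun p => by simp only [fstVec_joinVec, sndVec_joinVec]; rfl
      right_inv := fun z => by simp } fun x y => by
    rw [inner_eq_fstVec_add_sndVec]
    simp [WithLp.prod_inner_apply]

/-- The linear identification `ℝⁿ × ℝᵏ ≃ ℝⁿ⁺ᵏ`. -/
noncomputable def joinEquiv (n k : ℕ) : (Rd n × Rd k) ≃L[ℝ] Rd (n + k) :=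
  (WithLp.prodContinuousLinearEquiv 2 ℝ (Rd n) (Rd k)).symm.trans
    (joinIsometry n k).toContinuousLinearEquiv

@[simp] theorem joinEquiv_apply (p : Rd n × Rd k) : joinEquiv n k p = joinVec p.1 p.2 := rfl

@[simp] theorem joinEquiv_symm_apply (z : Rd (n + k)) :
    (joinEquiv n k).symm z = (fstVec z, sndVec z) := rfl

theorem measurePreserving_joinEquiv (n k : ℕ) : MeasurePreserving (joinEquiv n k) :=
  (joinIsometry n k).measurePreserving.comp (WithLp.volume_preserving_toLp (Rd n) (Rd k))

theorem measurableEmbedding_joinEquiv (n k : ℕ) : MeasurableEmbedding (joinEquiv n k) :=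
  (joinEquiv n k).toHomeomorph.measurableEmbedding

theorem norm_fstVec_le (z : Rd (n + k)) : ‖fstVec z‖ ≤ ‖z‖ := by
  refine le_of_sq_le_sq ?_ (norm_nonneg z)
  rw [← real_inner_self_eq_norm_sq, ← real_inner_self_eq_norm_sq, inner_eq_fstVec_add_sndVec z z]
  linarith [real_inner_self_nonneg (x := sndVec z) (F := Rd k)]

theorem norm_joinVec_le (y : Rd n) (θ : Rd k) : ‖joinVec y θ‖ ≤ ‖y‖ + ‖θ‖ := by
  refine le_of_sq_le_sq ?_ (by positivity)
  rw [← real_inner_self_eq_norm_sq, inner_eq_fstVec_add_sndVec, fstVec_joinVec, sndVec_joinVec,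
    real_inner_self_eq_norm_sq, real_inner_self_eq_norm_sq]
  nlinarith [norm_nonneg y, norm_nonneg θ]

theorem two_pi_rpow_ne_zero (s : ℝ) : (((2 * Real.pi) ^ s : ℝ) : ℂ) ≠ 0 := by
  exact_mod_cast (by positivity : ((2 * Real.pi) ^ s : ℝ) ≠ 0)

/-- The partial inverse Fourier transform as an operator on the Schwartz space. -/
noncomputable def partialFourierInvCLM (n k : ℕ) : 𝓢(Rd (n + k), ℂ) →L[ℂ] 𝓢(Rd (n + k), ℂ) :=
  (((2 * Real.pi) ^ (-(k : ℝ) / 2) : ℝ) : ℂ) •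
    (compCLMOfContinuousLinearEquiv ℂ (joinEquiv n k).symm ∘L partialFourier ∘L
      compCLMOfContinuousLinearEquiv ℂ (joinEquiv n k))

theorem partialFourierInvCLM_apply (φ : 𝓢(Rd (n + k), ℂ)) (z : Rd (n + k)) :
    partialFourierInvCLM n k φ z = partialFourierInv φ z := rfl

/-- The inverse of `partialFourierInvCLM`. -/
noncomputable def partialFourierDirect (n k : ℕ) : 𝓢(Rd (n + k), ℂ) →L[ℂ] 𝓢(Rd (n + k), ℂ) :=
  (((2 * Real.pi) ^ (-(k : ℝ) / 2) : ℝ) : ℂ)⁻¹ •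
    (compCLMOfContinuousLinearEquiv ℂ (joinEquiv n k).symm ∘L partialFourierSymm ∘L
      compCLMOfContinuousLinearEquiv ℂ (joinEquiv n k))

theorem compCLM_joinEquiv_symm (φ : 𝓢(Rd n × Rd k, ℂ)) :
    compCLMOfContinuousLinearEquiv ℂ (joinEquiv n k)
      (compCLMOfContinuousLinearEquiv ℂ (joinEquiv n k).symm φ) = φ := by
  ext p
  simp

theorem compCLM_symm_joinEquiv (φ : 𝓢(Rd (n + k), ℂ)) :
    compCLMOfContinuousLinearEquiv ℂ (joinEquiv n k).symm
      (compCLMOfContinuousLinearEquiv ℂ (joinEquiv n k) φ) = φ := by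
  ext p
  simp

theorem partialFourierInvCLM_partialFourierDirect (φ : 𝓢(Rd (n + k), ℂ)) :
    partialFourierInvCLM n k (partialFourierDirect n k φ) = φ := by
  simp only [partialFourierInvCLM, partialFourierDirect, _root_.smul_apply,
    ContinuousLinearMap.comp_apply, map_smul, compCLM_joinEquiv_symm,
    partialFourier_partialFourierSymm, compCLM_symm_joinEquiv, smul_smul]
  rw [inv_mul_cancel₀ (two_pi_rpow_ne_zero _), one_smul]

theorem partialFourierDirect_partialFourierInvCLM (φ : 𝓢(Rd (n + k), ℂ)) :
    partialFourierDirect n k (partialFourierInvCLM n k φ) = φ := by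
  simp only [partialFourierInvCLM, partialFourierDirect, _root_.smul_apply,
    ContinuousLinearMap.comp_apply, map_smul, compCLM_joinEquiv_symm,
    partialFourierSymm_partialFourier, compCLM_symm_joinEquiv, smul_smul]
  rw [mul_inv_cancel₀ (two_pi_rpow_ne_zero _), one_smul]

end Coordinates

/-! ### Oscillatory integrals as partial Fourier transforms of symbols -/

section OscillatoryIntegral

open SchwartzMap Complex

variable {n k : ℕ}

theorem integrable_comp_continuousLinearEquiv {d : ℕ} (A : Rd d ≃L[ℝ] Rd d) {f : Rd d → ℂ}
    (hf : Integrable f) : Integrable fun x => f (A x) := by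
  have hdet : LinearMap.det (A : Rd d →ₗ[ℝ] Rd d) ≠ 0 := A.toLinearEquiv.isUnit_det'.ne_zero
  have h := Measure.map_linearMap_addHaar_eq_smul_addHaar (volume : Measure (Rd d)) hdet
  have h2 : Integrable f (Measure.map A volume) := by
    change Integrable f (Measure.map (A : Rd d →ₗ[ℝ] Rd d) volume)
    rw [h]
    exact hf.smul_measure ENNReal.ofReal_ne_top
  exact (A.toHomeomorph.measurableEmbedding.integrable_map_iff).1 h2

theorem integral_comp_continuousLinearEquiv {d : ℕ} (A : Rd d ≃L[ℝ] Rd d) (f : Rd d → ℂ) :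
    ∫ x, f (A x) = ((|(LinearMap.det (A : Rd d →ₗ[ℝ] Rd d))⁻¹| : ℝ) : ℂ) * ∫ y, f y := by
  have hdet : LinearMap.det (A : Rd d →ₗ[ℝ] Rd d) ≠ 0 := A.toLinearEquiv.isUnit_det'.ne_zero
  have h := Measure.map_linearMap_addHaar_eq_smul_addHaar (volume : Measure (Rd d)) hdet
  refine ((A.toHomeomorph.measurableEmbedding).integral_map f).symm.trans ?_
  change ∫ y, f y ∂(Measure.map (A : Rd d →ₗ[ℝ] Rd d) volume) = _
  rw [h, integral_smul_measure, ENNReal.toReal_ofReal (abs_nonneg _)]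
  simp

/-- The constant relating an oscillatory integral to the partial inverse Fourier transform. -/
noncomputable def oscillatoryConst (k : ℕ) {d : ℕ} (A : Rd d ≃L[ℝ] Rd d) : ℂ :=
  ((|(LinearMap.det (A : Rd d →ₗ[ℝ] Rd d))⁻¹| : ℝ) : ℂ) *
    (((2 * Real.pi) ^ (-(k : ℝ) / 2) : ℝ) : ℂ)⁻¹

theorem oscillatoryConst_ne_zero (k : ℕ) {d : ℕ} (A : Rd d ≃L[ℝ] Rd d) :
    oscillatoryConst k A ≠ 0 := by
  have hdet : LinearMap.det (A : Rd d →ₗ[ℝ] Rd d) ≠ 0 := A.toLinearEquiv.isUnit_det'.ne_zero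
  refine mul_ne_zero ?_ (inv_ne_zero (two_pi_rpow_ne_zero _))
  exact_mod_cast abs_ne_zero.2 (inv_ne_zero hdet)

theorem IsShubinSymbol.integrable_exp_mul {m : ℝ} {a : Rd (n + k) → ℂ} (ha : IsShubinSymbol m a)
    (ψ : 𝓢(Rd (n + k), ℂ)) (θ : Rd k) :
    Integrable fun y => exp (I * ((inner ℝ (sndVec y) θ : ℝ) : ℂ)) *
      a (joinVec (fstVec y) θ) * ψ y := by
  obtain ⟨C, hC⟩ := ha.norm_le
  have hC0 : 0 ≤ C := by simpa using (norm_nonneg _).trans (hC 0)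
  have hf : Continuous fun y : Rd (n + k) => fstVec (n := n) (k := k) y :=
    continuous_fst.comp (joinEquiv n k).symm.continuous
  have hs : Continuous fun y : Rd (n + k) => sndVec (n := n) (k := k) y :=
    continuous_snd.comp (joinEquiv n k).symm.continuous
  refine ((ψ.integrable_rpow_mul |m|).const_mul (C * (1 + ‖θ‖) ^ |m|)).mono' ?_
    (Filter.Eventually.of_forall fun y => ?_)
  · refine Continuous.aestronglyMeasurable ?_
    refine ((continuous_exp.comp (continuous_const.mul (continuous_ofReal.comp
      (hs.inner continuous_const)))).mul (ha.1.continuous.comp ?_)).mul ψ.continuous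
    exact (joinEquiv n k).continuous.comp (hf.prodMk continuous_const)
  · rw [norm_mul, norm_mul, norm_exp_I_mul_ofReal', one_mul, ← mul_assoc]
    refine mul_le_mul_of_nonneg_right ((hC _).trans ?_) (norm_nonneg _)
    rw [mul_assoc, ← Real.mul_rpow (by positivity) (by positivity)]
    refine mul_le_mul_of_nonneg_left ?_ hC0
    calc (1 + ‖joinVec (fstVec y) θ‖) ^ m ≤ (1 + ‖joinVec (fstVec y) θ‖) ^ |m| :=
          Real.rpow_le_rpow_of_exponent_le (by linarith [norm_nonneg (joinVec (fstVec y) θ)])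
            (le_abs_self m)
      _ ≤ _ := by
          refine Real.rpow_le_rpow (by positivity) ?_ (abs_nonneg _)
          nlinarith [norm_joinVec_le (fstVec y) θ, norm_fstVec_le (n := n) (k := k) y,
            norm_nonneg y, norm_nonneg θ]

/-- For fixed θ the integrand is absolutely integrable, so Fubini applies; a(s, θ) is constant in
the last variables, and integrating these out leaves the partial transform of ψ. -/
theorem IsShubinSymbol.integral_exp_mul {m : ℝ} {a : Rd (n + k) → ℂ} (ha : IsShubinSymbol m a)
    (ψ : 𝓢(Rd (n + k), ℂ)) (θ : Rd k) :
    ∫ y, exp (I * ((inner ℝ (sndVec y) θ : ℝ) : ℂ)) * a (joinVec (fstVec y) θ) * ψ y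
      = (((2 * Real.pi) ^ (-(k : ℝ) / 2) : ℝ) : ℂ)⁻¹ *
        ∫ s : Rd n, a (joinVec s θ) * partialFourierInvCLM n k ψ (joinVec s θ) := by
  have hJ := measurePreserving_joinEquiv n k
  have hi := (hJ.integrable_comp_emb (measurableEmbedding_joinEquiv n k)).2
    (ha.integrable_exp_mul ψ θ)
  rw [← hJ.integral_comp (measurableEmbedding_joinEquiv n k)]
  change ∫ p : Rd n × Rd k, _ ∂(volume.prod volume) = _
  refine (integral_prod _ hi).trans ?_
  rw [← integral_const_mul]
  refine integral_congr_ae (Filter.Eventually.of_forall fun s => ?_)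
  simp only [Function.comp_apply, joinEquiv_apply, fstVec_joinVec, sndVec_joinVec,
    partialFourierInvCLM_apply, partialFourierInv]
  rw [mul_left_comm (a _), inv_mul_cancel_left₀ (two_pi_rpow_ne_zero _), ← integral_const_mul]
  refine integral_congr_ae (Filter.Eventually.of_forall fun t => ?_)
  ring

/-- For a Shubin symbol the iterated integrals defining an oscillatory integral with linear phase
converge, and they are given by the partial inverse Fourier transform. -/
theorem IsShubinSymbol.isOscillatoryIntegral_iff {m : ℝ} {a : Rd (n + k) → ℂ}
    (ha : IsShubinSymbol m a) (A : Rd (n + k) ≃L[ℝ] Rd (n + k)) (u : 𝓢'(Rd (n + k), ℂ)) :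
    IsOscillatoryIntegral (fun (x : Rd (n + k)) (θ : Rd k) => inner ℝ (sndVec (A x)) θ)
        (fun (x : Rd (n + k)) (θ : Rd k) => a (joinVec (fstVec (A x)) θ)) u ↔
      ∀ φ, u φ = oscillatoryConst k A * ∫ z, a z *
        partialFourierInvCLM n k (compCLMOfContinuousLinearEquiv ℂ A.symm φ) z := by
  refine forall_congr' fun φ => ?_
  set ψ := compCLMOfContinuousLinearEquiv ℂ A.symm φ
  have hφ : ∀ x, φ x = ψ (A x) := fun x => by simp [ψ]
  have hJ := measurePreserving_joinEquiv n k
  have hJe := measurableEmbedding_joinEquiv n k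
  have h1 : ∀ θ : Rd k, ∫ x, exp (I * ((inner ℝ (sndVec (A x)) θ : ℝ) : ℂ)) *
      a (joinVec (fstVec (A x)) θ) * φ x = oscillatoryConst k A *
        ∫ s : Rd n, a (joinVec s θ) * partialFourierInvCLM n k ψ (joinVec s θ) := fun θ => by
    simp only [hφ]
    rw [integral_comp_continuousLinearEquiv A fun y => exp (I * ((inner ℝ (sndVec y) θ : ℝ) : ℂ)) *
      a (joinVec (fstVec y) θ) * ψ y, ha.integral_exp_mul, oscillatoryConst, mul_assoc]
  -- Once the inner integral is rewritten with the Schwartz function Pψ, the double integral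
  -- converges absolutely; this yields both integrability in θ and the exchange of order.
  have hi : Integrable (fun p : Rd n × Rd k => a (joinVec p.1 p.2) *
      partialFourierInvCLM n k ψ (joinVec p.1 p.2)) (volume.prod volume) :=
    (hJ.integrable_comp_emb hJe).2 (ha.integrable_mul (partialFourierInvCLM n k ψ))
  have h2 : ∫ θ : Rd k, ∫ s : Rd n, a (joinVec s θ) * partialFourierInvCLM n k ψ (joinVec s θ)
      = ∫ z, a z * partialFourierInvCLM n k ψ z := by
    rw [← integral_prod_symm _ hi]
    exact hJ.integral_comp hJe fun z => a z * partialFourierInvCLM n k ψ z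
  simp only [h1]
  rw [integral_const_mul, h2]
  refine ⟨fun h => h.2.2, fun h => ⟨fun θ => ?_, hi.integral_prod_right.const_mul _, h⟩⟩
  simp only [hφ]
  exact integrable_comp_continuousLinearEquiv A (ha.integrable_exp_mul ψ θ)

/-- The functional `ψ ↦ c⁻¹ u((P⁻¹ψ) ∘ A)`, where `P` is the partial inverse Fourier transform: it
is given by the symbol when `u` is an oscillatory integral with phase `⟨(A x)₂, θ⟩`. -/
noncomputable def symbolFunctional (A : Rd (n + k) ≃L[ℝ] Rd (n + k)) (u : 𝓢'(Rd (n + k), ℂ)) :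
    𝓢(Rd (n + k), ℂ) →L[ℂ] ℂ :=
  let u' : 𝓢(Rd (n + k), ℂ) →L[ℂ] ℂ := u
  (oscillatoryConst k A)⁻¹ • (u' ∘L compCLMOfContinuousLinearEquiv ℂ A ∘L partialFourierDirect n k)

theorem symbolFunctional_apply (A : Rd (n + k) ≃L[ℝ] Rd (n + k)) (u : 𝓢'(Rd (n + k), ℂ))
    (ψ : 𝓢(Rd (n + k), ℂ)) : symbolFunctional A u ψ = (oscillatoryConst k A)⁻¹ *
      u (compCLMOfContinuousLinearEquiv ℂ A (partialFourierDirect n k ψ)) := rfl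

theorem apply_eq_symbolFunctional (A : Rd (n + k) ≃L[ℝ] Rd (n + k)) (u : 𝓢'(Rd (n + k), ℂ))
    (φ : 𝓢(Rd (n + k), ℂ)) : u φ = oscillatoryConst k A * symbolFunctional A u
      (partialFourierInvCLM n k (compCLMOfContinuousLinearEquiv ℂ A.symm φ)) := by
  rw [symbolFunctional_apply, mul_inv_cancel_left₀ (oscillatoryConst_ne_zero k A),
    partialFourierDirect_partialFourierInvCLM]
  congr 1
  ext x
  simp

theorem IsShubinSymbol.isOscillatoryIntegral_iff_symbolFunctional {m : ℝ} {a : Rd (n + k) → ℂ}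
    (ha : IsShubinSymbol m a) (A : Rd (n + k) ≃L[ℝ] Rd (n + k)) (u : 𝓢'(Rd (n + k), ℂ)) :
    IsOscillatoryIntegral (fun (x : Rd (n + k)) (θ : Rd k) => inner ℝ (sndVec (A x)) θ)
        (fun (x : Rd (n + k)) (θ : Rd k) => a (joinVec (fstVec (A x)) θ)) u ↔
      ∀ ψ : 𝓢(Rd (n + k), ℂ), symbolFunctional A u ψ = ∫ z, a z * ψ z := by
  rw [ha.isOscillatoryIntegral_iff A u]
  constructor
  · intro h ψ
    rw [symbolFunctional_apply, h, inv_mul_cancel_left₀ (oscillatoryConst_ne_zero k A)]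
    have : compCLMOfContinuousLinearEquiv ℂ A.symm
        (compCLMOfContinuousLinearEquiv ℂ A (partialFourierDirect n k ψ))
        = partialFourierDirect n k ψ := by
      ext x
      simp
    rw [this, partialFourierInvCLM_partialFourierDirect]
  · intro h φ
    rw [apply_eq_symbolFunctional A u φ, h]

end OscillatoryIntegral

/-! ### The induced coordinates on phase space -/

section PhaseCoordinates

open SchwartzMap Complex

variable {n k : ℕ}

theorem joinVec_sub (y y' : Rd n) (θ θ' : Rd k) :
    joinVec y θ - joinVec y' θ' = joinVec (y - y') (θ - θ') :=
  ((joinEquiv n k).map_sub (y, θ) (y', θ')).symm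

/-- `fstVec` as a continuous linear map. -/
noncomputable def fstVecL (n k : ℕ) : Rd (n + k) →L[ℝ] Rd n :=
  ContinuousLinearMap.fst ℝ (Rd n) (Rd k) ∘L (joinEquiv n k).symm.toContinuousLinearMap

/-- `sndVec` as a continuous linear map. -/
noncomputable def sndVecL (n k : ℕ) : Rd (n + k) →L[ℝ] Rd k :=
  ContinuousLinearMap.snd ℝ (Rd n) (Rd k) ∘L (joinEquiv n k).symm.toContinuousLinearMap

/-- `(p, q) ↦ (p₁, q₂)`. -/
noncomputable def mixL (n k : ℕ) : (Rd (n + k) × Rd (n + k)) →L[ℝ] Rd (n + k) :=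
  (joinEquiv n k).toContinuousLinearMap ∘L
    (fstVecL n k ∘L ContinuousLinearMap.fst ℝ _ _).prod
      (sndVecL n k ∘L ContinuousLinearMap.snd ℝ _ _)

theorem mixL_apply (z : Rd (n + k) × Rd (n + k)) :
    mixL n k z = joinVec (fstVec z.1) (sndVec z.2) := rfl

/-- `q ↦ (-q₁, q₂)`. -/
noncomputable def negFstL (n k : ℕ) : Rd (n + k) →L[ℝ] Rd (n + k) :=
  (joinEquiv n k).toContinuousLinearMap ∘L (-fstVecL n k).prod (sndVecL n k)

theorem negFstL_apply (q : Rd (n + k)) : negFstL n k q = joinVec (-fstVec q) (sndVec q) := rfl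

/-- The symplectic change of coordinates `(p, q) ↦ ((p₁, q₂), (-q₁, p₂))`. -/
noncomputable def shuffleEquiv (n k : ℕ) :
    (Rd (n + k) × Rd (n + k)) ≃L[ℝ] Rd (n + k) × Rd (n + k) :=
  ContinuousLinearEquiv.equivOfInverse
    ((mixL n k).prod (negFstL n k ∘L mixL n k ∘L
      (ContinuousLinearEquiv.prodComm ℝ _ _).toContinuousLinearMap))
    ((mixL n k).prod (negFstL n k ∘L mixL n k ∘L
      (ContinuousLinearEquiv.prodComm ℝ _ _).toContinuousLinearMap))
    (fun z => Prod.ext (by simp [mixL_apply, negFstL_apply])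
      (by simp [mixL_apply, negFstL_apply]))
    (fun z => Prod.ext (by simp [mixL_apply, negFstL_apply])
      (by simp [mixL_apply, negFstL_apply]))

/-- The transpose of an automorphism of `ℝᵈ`. -/
noncomputable def transposeEquiv {d : ℕ} (A : Rd d ≃L[ℝ] Rd d) : Rd d ≃L[ℝ] Rd d :=
  ContinuousLinearEquiv.equivOfInverse (ContinuousLinearMap.adjoint (A : Rd d →L[ℝ] Rd d))
    (ContinuousLinearMap.adjoint (A.symm : Rd d →L[ℝ] Rd d))
    (fun y => by
      rw [← ContinuousLinearMap.comp_apply, ← ContinuousLinearMap.adjoint_comp]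
      simp [ContinuousLinearMap.adjoint_id])
    (fun y => by
      rw [← ContinuousLinearMap.comp_apply, ← ContinuousLinearMap.adjoint_comp]
      simp [ContinuousLinearMap.adjoint_id])

/-- The coordinates `(p, q) ↦ (A⁻¹(p₁, q₂), Aᵗ(-q₁, p₂))` on phase space. -/
noncomputable def phaseEquiv (A : Rd (n + k) ≃L[ℝ] Rd (n + k)) :
    (Rd (n + k) × Rd (n + k)) ≃L[ℝ] PhaseSpace (n + k) :=
  ((shuffleEquiv n k).trans (A.symm.prodCongr (transposeEquiv A))).trans
    (WithLp.prodContinuousLinearEquiv 2 ℝ _ _).symm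

theorem phaseEquiv_apply_fst (A : Rd (n + k) ≃L[ℝ] Rd (n + k)) (p q : Rd (n + k)) :
    (phaseEquiv A (p, q)).fst = A.symm (joinVec (fstVec p) (sndVec q)) := rfl

theorem phaseEquiv_apply_snd (A : Rd (n + k) ≃L[ℝ] Rd (n + k)) (p q : Rd (n + k)) :
    (phaseEquiv A (p, q)).snd = ContinuousLinearMap.adjoint (A : Rd (n + k) →L[ℝ] Rd (n + k))
      (joinVec (-fstVec q) (sndVec p)) := by
  change ContinuousLinearMap.adjoint (A : Rd (n + k) →L[ℝ] Rd (n + k))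
    (negFstL n k (mixL n k (q, p))) = _
  rw [mixL_apply, negFstL_apply, fstVec_joinVec, sndVec_joinVec]

theorem inner_phaseEquiv_snd (A : Rd (n + k) ≃L[ℝ] Rd (n + k)) (p q x : Rd (n + k)) :
    (inner ℝ x (phaseEquiv A (p, q)).snd : ℝ)
      = inner ℝ (sndVec (A x)) (sndVec p) - inner ℝ (fstVec (A x)) (fstVec q) := by
  rw [phaseEquiv_apply_snd, ContinuousLinearMap.adjoint_inner_right,
    ContinuousLinearEquiv.coe_coe, inner_eq_fstVec_add_sndVec, fstVec_joinVec, sndVec_joinVec,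
    inner_neg_right]
  ring

/-- Membership of x in Y says q₂ = 0. Pairing ξ with points of Y = A⁻¹(ℝⁿ × 0) leaves only -⟨·, q₁⟩,
so ξ ∈ Y^⊥ says q₁ = 0. -/
theorem phaseEquiv_mem_conormalSpace (A : Rd (n + k) ≃L[ℝ] Rd (n + k))
    {Y : Submodule ℝ (Rd (n + k))} (hY : ∀ x, x ∈ Y ↔ sndVec (A x) = 0) (p q : Rd (n + k)) :
    phaseEquiv A (p, q) ∈ conormalSpace Y ↔ q = 0 := by
  have h0 : q = 0 ↔ fstVec q = 0 ∧ sndVec q = 0 := by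
    constructor
    · rintro rfl
      exact ⟨rfl, rfl⟩
    · rintro ⟨h1, h2⟩
      rw [← joinVec_fstVec_sndVec q, h1, h2]
      exact (joinEquiv n k).map_zero
  change (phaseEquiv A (p, q)).fst ∈ Y ∧ (phaseEquiv A (p, q)).snd ∈ Yᗮ ↔ _
  rw [hY, phaseEquiv_apply_fst, ContinuousLinearEquiv.apply_symm_apply, sndVec_joinVec, h0,
    and_comm]
  refine and_congr_left fun _ => ?_
  rw [Submodule.mem_orthogonal]
  constructor
  · intro h
    -- Testing with the point A⁻¹(q₁, 0) of Y gives -‖q₁‖² = 0.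
    have h1 := h (A.symm (joinVec (fstVec q) 0)) ((hY _).2 (by simp))
    rw [inner_phaseEquiv_snd] at h1
    simpa using h1
  · intro h x hx
    rw [inner_phaseEquiv_snd, (hY x).1 hx, h]
    simp

/-- The window `P(ḡ ∘ A⁻¹)` on the symbol side. -/
noncomputable def symbolWindow (A : Rd (n + k) ≃L[ℝ] Rd (n + k)) (g : 𝓢(Rd (n + k), ℂ)) :
    𝓢(Rd (n + k), ℂ) :=
  partialFourierInvCLM n k (compCLMOfContinuousLinearEquiv ℂ A.symm (schwartzConj g))

theorem symbolWindow_ne_zero (A : Rd (n + k) ≃L[ℝ] Rd (n + k)) {g : 𝓢(Rd (n + k), ℂ)}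
    (hg : g ≠ 0) : symbolWindow A g ≠ 0 := by
  intro h
  have h1 := congrArg (partialFourierDirect n k) h
  rw [symbolWindow, partialFourierDirect_partialFourierInvCLM, map_zero] at h1
  refine hg (SchwartzMap.ext fun x => ?_)
  have h2 := congrArg (fun f : 𝓢(Rd (n + k), ℂ) => f (A x)) h1
  simpa [schwartzConj_apply] using h2

/-- In the last k variables the partial transform exchanges translations and modulations.
Conjugating the window reverses its frequency, hence the sign of q₁ in `phaseEquiv`; reordering the
shift and the modulation leaves the factor e^{i⟨q₂, p₂⟩}. -/
theorem partialFourierInvCLM_comp_window (A : Rd (n + k) ≃L[ℝ] Rd (n + k))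
    (g : 𝓢(Rd (n + k), ℂ)) (p q : Rd (n + k)) :
    partialFourierInvCLM n k (compCLMOfContinuousLinearEquiv ℂ A.symm (schwartzConj
      (translation (phaseEquiv A (p, q)).fst (modulation (phaseEquiv A (p, q)).snd g))))
      = exp (I * ((inner ℝ (sndVec q) (sndVec p) : ℝ) : ℂ)) •
        translation p (modulation q (symbolWindow A g)) := by
  have h1 : ∀ w, compCLMOfContinuousLinearEquiv ℂ A.symm (schwartzConj
      (translation (phaseEquiv A (p, q)).fst (modulation (phaseEquiv A (p, q)).snd g))) w
      = exp (I * ((inner ℝ (fstVec w - fstVec p) (fstVec q)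
          - inner ℝ (sndVec w - sndVec q) (sndVec p) : ℝ) : ℂ)) *
        compCLMOfContinuousLinearEquiv ℂ A.symm (schwartzConj g)
          (w - joinVec (fstVec p) (sndVec q)) := fun w => by
    simp only [compCLMOfContinuousLinearEquiv_apply, Function.comp_apply, schwartzConj_apply,
      translation_apply, modulation_apply, map_mul, ← exp_conj, conj_I, conj_ofReal]
    rw [phaseEquiv_apply_fst, ← map_sub, inner_phaseEquiv_snd,
      ContinuousLinearEquiv.apply_symm_apply]
    have h2 : fstVec (w - joinVec (fstVec p) (sndVec q)) = fstVec w - fstVec p := by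
      conv_lhs => rw [← joinVec_fstVec_sndVec w, joinVec_sub, fstVec_joinVec]
    have h3 : sndVec (w - joinVec (fstVec p) (sndVec q)) = sndVec w - sndVec q := by
      conv_lhs => rw [← joinVec_fstVec_sndVec w, joinVec_sub, sndVec_joinVec]
    rw [h2, h3]
    congr 2
    push_cast
    ring
  ext z
  rw [_root_.smul_apply, translation_apply, modulation_apply, symbolWindow,
    partialFourierInvCLM_apply, partialFourierInvCLM_apply, partialFourierInv, partialFourierInv,
    smul_eq_mul]
  simp only [h1, fstVec_joinVec, sndVec_joinVec, joinVec_sub]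
  -- Substituting t + q₂ recentres the window; equality of the integrands is then an identity
  -- between the exponents.
  rw [← integral_add_right_eq_self _ (sndVec q),
    mul_left_comm (exp (I * ((inner ℝ (z - p) q : ℝ) : ℂ))),
    mul_left_comm (exp (I * ((inner ℝ (sndVec q) (sndVec p) : ℝ) : ℂ)))]
  congr 1
  rw [← integral_const_mul, ← integral_const_mul]
  refine integral_congr_ae (Filter.Eventually.of_forall fun t => ?_)
  simp only [add_sub_cancel_right]
  rw [← mul_assoc, ← mul_assoc, ← mul_assoc, ← exp_add, ← exp_add, ← exp_add,
    inner_eq_fstVec_add_sndVec (z - p) q,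
    show fstVec (z - p) = fstVec z - fstVec p from rfl,
    show sndVec (z - p) = sndVec z - sndVec p from rfl]
  congr 2
  rw [← mul_add, ← mul_add, ← mul_add, ← ofReal_add, ← ofReal_add, ← ofReal_add]
  congr 2
  simp only [inner_add_left, inner_sub_left, inner_sub_right,
    real_inner_comm (sndVec q) (sndVec z), real_inner_comm (sndVec q) (sndVec p)]
  ring

theorem fbiTransform_phaseEquiv (A : Rd (n + k) ≃L[ℝ] Rd (n + k)) (g : 𝓢(Rd (n + k), ℂ))
    (u : 𝓢'(Rd (n + k), ℂ)) (p q : Rd (n + k)) :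
    fbiTransform g u (phaseEquiv A (p, q)) =
      (((2 * Real.pi) ^ (-((n + k : ℕ) : ℝ) / 2) : ℝ) : ℂ) * (oscillatoryConst k A *
        (exp (I * ((inner ℝ (sndVec q) (sndVec p) : ℝ) : ℂ)) *
          shortTime (symbolFunctional A u) (symbolWindow A g) (p, q))) := by
  rw [fbiTransform, apply_eq_symbolFunctional A u, partialFourierInvCLM_comp_window, map_smul,
    smul_eq_mul, shortTime]

/-- The phase, depending on `q` only, by which the twisted transform differs from `shortTime`. -/
noncomputable def twistPhase (A : Rd (n + k) ≃L[ℝ] Rd (n + k)) (Y : Submodule ℝ (Rd (n + k)))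
    (q : Rd (n + k)) : ℝ :=
  inner ℝ (fstVec (A (Yᗮ.starProjection (A.symm (joinVec 0 (sndVec q)))))) (fstVec q)

theorem contDiff_twistPhase (A : Rd (n + k) ≃L[ℝ] Rd (n + k)) (Y : Submodule ℝ (Rd (n + k))) :
    ContDiff ℝ ∞ (twistPhase A Y) := by
  let B : Rd (n + k) →L[ℝ] Rd n := fstVecL n k ∘L A.toContinuousLinearMap ∘L
    Yᗮ.starProjection ∘L A.symm.toContinuousLinearMap ∘L (joinEquiv n k).toContinuousLinearMap ∘L
    ContinuousLinearMap.inr ℝ (Rd n) (Rd k) ∘L sndVecL n k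
  exact B.contDiff.inner ℝ (fstVecL n k).contDiff

/-- Let w = π_{Y^⊥} x. Since A⁻¹(p₁, 0) lies in Y, w depends on q₂ only; since A⁻¹(0, q₂) - w lies
in Y, (Aw)₂ = q₂. So ⟨w, ξ⟩ = ⟨q₂, p₂⟩ - ⟨(Aw)₁, q₁⟩: the twist cancels e^{i⟨q₂, p₂⟩} and leaves a
phase in q. -/
theorem fbiTransformAlong_phaseEquiv (A : Rd (n + k) ≃L[ℝ] Rd (n + k))
    {Y : Submodule ℝ (Rd (n + k))} (hY : ∀ x, x ∈ Y ↔ sndVec (A x) = 0) (g : 𝓢(Rd (n + k), ℂ))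
    (u : 𝓢'(Rd (n + k), ℂ)) (p q : Rd (n + k)) :
    fbiTransformAlong Y g u (phaseEquiv A (p, q)) =
      (((2 * Real.pi) ^ (-((n + k : ℕ) : ℝ) / 2) : ℝ) : ℂ) * oscillatoryConst k A *
        exp (I * (twistPhase A Y q : ℂ)) *
          shortTime (symbolFunctional A u) (symbolWindow A g) (p, q) := by
  have h1 : Yᗮ.starProjection (phaseEquiv A (p, q)).fst
      = Yᗮ.starProjection (A.symm (joinVec 0 (sndVec q))) := by
    rw [phaseEquiv_apply_fst, ← sub_eq_zero, ← map_sub, ← map_sub, joinVec_sub, sub_zero, sub_self,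
      Submodule.starProjection_apply_eq_zero_iff, Submodule.orthogonal_orthogonal, hY]
    simp
  have h2 : sndVec (A (Yᗮ.starProjection (A.symm (joinVec (0 : Rd n) (sndVec q))))) = sndVec q := by
    have h3 := (hY _).1 (show A.symm (joinVec (0 : Rd n) (sndVec q))
      - Yᗮ.starProjection (A.symm (joinVec (0 : Rd n) (sndVec q))) ∈ Y by
        have := Submodule.sub_starProjection_mem_orthogonal (K := Yᗮ)
          (A.symm (joinVec (0 : Rd n) (sndVec q)))
        rwa [Submodule.orthogonal_orthogonal] at this)
    rw [map_sub, ContinuousLinearEquiv.apply_symm_apply] at h3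
    have h4 : sndVec (joinVec (0 : Rd n) (sndVec q)) -
      sndVec (A (Yᗮ.starProjection (A.symm (joinVec (0 : Rd n) (sndVec q))))) = 0 := h3
    rw [sndVec_joinVec, sub_eq_zero] at h4
    exact h4.symm
  rw [fbiTransformAlong, h1, fbiTransform_phaseEquiv, inner_phaseEquiv_snd, h2, twistPhase]
  set c : ℝ := inner ℝ (sndVec q) (sndVec p)
  set b : ℝ := inner ℝ (fstVec (A (Yᗮ.starProjection (A.symm (joinVec 0 (sndVec q)))))) (fstVec q)
  have h5 : exp (I * (b : ℂ)) = exp (-I * ((c - b : ℝ) : ℂ)) * exp (I * (c : ℂ)) := by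
    rw [← exp_add]
    congr 1
    push_cast
    ring
  rw [h5]
  ring

end PhaseCoordinates

/-! ### Distances to N(Y) and to its complement -/

section Weights

variable {X Z E : Type*} [NormedAddCommGroup X] [NormedSpace ℝ X] [NormedAddCommGroup Z]
  [NormedSpace ℝ Z] [NormedAddCommGroup E] [NormedSpace ℝ E]

/-- For the upper bound compare with the point Λ(p, 0) of N; for the lower bound, the second
component of Λ⁻¹ vanishes on N and is bounded. -/
theorem one_add_infDist_le_and_ge (Λ : (X × Z) ≃L[ℝ] E) {N : Submodule ℝ E}
    (hN : ∀ p q, Λ (p, q) ∈ N ↔ q = 0) : ∃ C : ℝ, 1 ≤ C ∧ ∀ p q,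
      1 + Metric.infDist (Λ (p, q)) N ≤ C * (1 + ‖q‖) ∧
      1 + ‖q‖ ≤ C * (1 + Metric.infDist (Λ (p, q)) N) := by
  obtain ⟨a, ha0, ha⟩ := Λ.toContinuousLinearMap.bound
  obtain ⟨b, hb0, hb⟩ := Λ.symm.toContinuousLinearMap.bound
  refine ⟨1 + a + b, by linarith, fun p q => ⟨?_, ?_⟩⟩
  · have h1 : Metric.infDist (Λ (p, q)) N ≤ a * ‖q‖ := by
      refine (Metric.infDist_le_dist_of_mem (y := Λ (p, 0)) ((hN p 0).2 rfl)).trans ?_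
      rw [dist_eq_norm, ← map_sub]
      refine (ha _).trans_eq ?_
      simp [Prod.norm_def]
    nlinarith [norm_nonneg q]
  · have h1 : ‖q‖ / b ≤ Metric.infDist (Λ (p, q)) N := by
      refine (Metric.le_infDist ⟨0, N.zero_mem⟩).2 fun y hy => ?_
      rw [div_le_iff₀' hb0, dist_eq_norm]
      have h2 : (Λ.symm y).2 = 0 := (hN (Λ.symm y).1 _).1 (by simpa using hy)
      have h3 : q = (Λ.symm (Λ (p, q) - y)).2 := by simp [h2]
      calc ‖q‖ = ‖(Λ.symm (Λ (p, q) - y)).2‖ := by rw [← h3]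
        _ ≤ _ := (norm_snd_le _).trans (hb _)
    rw [div_le_iff₀' hb0] at h1
    nlinarith [Metric.infDist_nonneg (x := Λ (p, q)) (s := (N : Set E))]

/-- V need not be Λ({0} × Z), so the distance to V sees q as well as p. The projection onto N along
V recovers p with an error linear in ‖q‖, whence the factor 1 + ‖q‖. -/
theorem one_add_infDist_compl_le_and_ge [FiniteDimensional ℝ E] (Λ : (X × Z) ≃L[ℝ] E)
    {N V : Submodule ℝ E} (hN : ∀ p q, Λ (p, q) ∈ N ↔ q = 0) (hV : IsCompl N V) :
    ∃ C : ℝ, 1 ≤ C ∧ ∀ p q,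
      1 + Metric.infDist (Λ (p, q)) V ≤ C * (1 + ‖q‖) * (1 + ‖p‖) ∧
      1 + ‖p‖ ≤ C * (1 + ‖q‖) * (1 + Metric.infDist (Λ (p, q)) V) := by
  obtain ⟨a, ha0, ha⟩ := Λ.toContinuousLinearMap.bound
  obtain ⟨b, hb0, hb⟩ := Λ.symm.toContinuousLinearMap.bound
  let π : E →L[ℝ] E := (N.subtype ∘ₗ N.projectionOnto V hV).toContinuousLinearMap
  have hπN : ∀ x ∈ N, π x = x := fun x hx => by
    simpa [π] using congrArg Subtype.val (Submodule.projectionOnto_apply_left hV ⟨x, hx⟩)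
  have hπV : ∀ x ∈ V, π x = 0 := fun x hx => by
    simpa [π] using (Submodule.projectionOnto_apply_eq_zero_iff hV).2 hx
  obtain ⟨c, hc0, hc⟩ := π.bound
  refine ⟨1 + a + b * c + b * c * a, by nlinarith [mul_pos hb0 hc0, mul_pos (mul_pos hb0 hc0) ha0],
    fun p q => ⟨?_, ?_⟩⟩
  · have h1 : Metric.infDist (Λ (p, q)) V ≤ a * (‖p‖ + ‖q‖) := by
      refine (Metric.infDist_le_dist_of_mem V.zero_mem).trans ?_
      rw [dist_zero_right]
      refine (ha _).trans (mul_le_mul_of_nonneg_left ?_ ha0.le)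
      exact max_le (le_add_of_nonneg_right (norm_nonneg q)) (le_add_of_nonneg_left (norm_nonneg p))
    have h2 : ‖p‖ + ‖q‖ ≤ (1 + ‖q‖) * (1 + ‖p‖) := by
      nlinarith [mul_nonneg (norm_nonneg q) (norm_nonneg p)]
    have h3 : 1 ≤ (1 + ‖q‖) * (1 + ‖p‖) := by
      nlinarith [mul_nonneg (norm_nonneg q) (norm_nonneg p), norm_nonneg q, norm_nonneg p]
    have h4 : 0 ≤ b * c + b * c * a := by positivity
    calc 1 + Metric.infDist (Λ (p, q)) V ≤ (1 + a) * ((1 + ‖q‖) * (1 + ‖p‖)) := by nlinarith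
      _ ≤ (1 + a + b * c + b * c * a) * ((1 + ‖q‖) * (1 + ‖p‖)) := by
          refine mul_le_mul_of_nonneg_right (by linarith) (by linarith)
      _ = _ := by ring
  · set D := Metric.infDist (Λ (p, q)) V
    have hD : 0 ≤ D := Metric.infDist_nonneg
    have h1 : (‖p‖ - b * c * a * ‖q‖) / (b * c) ≤ D := by
      refine (Metric.le_infDist ⟨0, V.zero_mem⟩).2 fun y hy => ?_
      rw [div_le_iff₀' (by positivity), dist_eq_norm]
      -- The projection kills y and fixes Λ(p, 0) = Λ(p, q) - Λ(0, q).
      have h2 : Λ (p, 0) = π (Λ (p, q) - y) - π (Λ (0, q)) := by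
        rw [map_sub, hπV y hy, sub_zero, ← map_sub, ← map_sub]
        have : ((p, q) : X × Z) - (0, q) = (p, 0) := by simp
        rw [this, hπN _ ((hN p 0).2 rfl)]
      have h3 : ‖Λ (p, 0)‖ ≤ c * ‖Λ (p, q) - y‖ + c * (a * ‖q‖) := by
        rw [h2]
        refine (norm_sub_le _ _).trans (add_le_add (hc _) ((hc _).trans ?_))
        refine mul_le_mul_of_nonneg_left ((ha _).trans_eq ?_) hc0.le
        simp [Prod.norm_def]
      have h4 : ‖p‖ ≤ b * ‖Λ (p, 0)‖ := by
        have := hb (Λ (p, 0))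
        simpa [Prod.norm_def] using this
      nlinarith
    rw [div_le_iff₀' (by positivity)] at h1
    have h5 : 0 ≤ b * c := by positivity
    have h6 : 0 ≤ b * c * a := by positivity
    have h7 : 1 ≤ (1 + ‖q‖) * (1 + D) := by nlinarith [mul_nonneg (norm_nonneg q) hD, norm_nonneg q]
    have h8 : D ≤ (1 + ‖q‖) * (1 + D) := by nlinarith [mul_nonneg (norm_nonneg q) hD, norm_nonneg q]
    have h9 : ‖q‖ ≤ (1 + ‖q‖) * (1 + D) := by
      nlinarith [mul_nonneg (norm_nonneg q) hD, norm_nonneg q]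
    set T := (1 + ‖q‖) * (1 + D)
    calc 1 + ‖p‖ ≤ 1 + b * c * D + b * c * a * ‖q‖ := by linarith
      _ ≤ T + b * c * T + b * c * a * T := by gcongr
      _ ≤ (1 + a + b * c + b * c * a) * T := by nlinarith
      _ = _ := by ring

/-- Replacing A by B in the power s costs Q^{|s|}; starting from N' ≥ N + |s| powers of decay pays
for it. Here A, B stand for the growth weights and D, Q for the decay weights, in either coordinate
system. -/
theorem weight_mul_weight_le {A B D Q C₁ C₂ : ℝ} (s : ℝ) (N N' : ℕ) (hN : (N : ℝ) + |s| ≤ N')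
    (hA : 1 ≤ A) (hB : 1 ≤ B) (hD : 1 ≤ D) (hQ : 1 ≤ Q) (hC₁ : 1 ≤ C₁) (hC₂ : 1 ≤ C₂)
    (h₁ : A ≤ C₁ * Q * B) (h₂ : B ≤ C₁ * Q * A) (h₃ : Q ≤ C₂ * D) :
    A ^ s * D ^ (-(N' : ℝ)) ≤ C₁ ^ |s| * C₂ ^ (N' : ℝ) * (B ^ s * Q ^ (-(N : ℝ))) := by
  have h4 : A ^ s ≤ C₁ ^ |s| * Q ^ |s| * B ^ s := by
    rw [← Real.mul_rpow (by linarith) (by linarith)]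
    exact rpow_le_rpow_abs_mul (by linarith) (by linarith) (by nlinarith) h₁ h₂ s
  have h5 : D ^ (-(N' : ℝ)) ≤ C₂ ^ (N' : ℝ) * Q ^ (-(N' : ℝ)) := by
    rw [Real.rpow_neg (by linarith), Real.rpow_neg (by linarith), ← div_eq_mul_inv,
      inv_le_comm₀ (by positivity) (by positivity), inv_div,
      div_le_iff₀ (by positivity), mul_comm, ← Real.mul_rpow (by linarith) (by linarith)]
    exact Real.rpow_le_rpow (by linarith) h₃ (by positivity)
  have h6 : Q ^ |s| * Q ^ (-(N' : ℝ)) ≤ Q ^ (-(N : ℝ)) := by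
    rw [← Real.rpow_add (by linarith)]
    exact Real.rpow_le_rpow_of_exponent_le hQ (by linarith)
  calc A ^ s * D ^ (-(N' : ℝ))
      ≤ (C₁ ^ |s| * Q ^ |s| * B ^ s) * (C₂ ^ (N' : ℝ) * Q ^ (-(N' : ℝ))) := by gcongr
    _ = C₁ ^ |s| * C₂ ^ (N' : ℝ) * (B ^ s * (Q ^ |s| * Q ^ (-(N' : ℝ)))) := by ring
    _ ≤ _ := by gcongr

theorem iteratedFDeriv_comp_affine {F : Type*} [NormedAddCommGroup F] [NormedSpace ℝ F] {f : E → F}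
    (hf : ContDiff ℝ ∞ f) (L : X →L[ℝ] E) (z : E) (p : X) (j : ℕ) (v : Fin j → X) :
    iteratedFDeriv ℝ j (fun p => f (L p + z)) p v
      = iteratedFDeriv ℝ j f (L p + z) fun i => L (v i) := by
  have hg : ContDiff ℝ ∞ fun x => f (x + z) := hf.comp (contDiff_id.add contDiff_const)
  have h1 := L.iteratedFDeriv_comp_right (i := j) hg p (by exact_mod_cast le_top)
  rw [show (fun p => f (L p + z)) = (fun x => f (x + z)) ∘ L from rfl, h1,
    iteratedFDeriv_comp_add_right]
  rfl

end Weights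

/-! ### Conormality in the new coordinates -/

section GammaConormal

open SchwartzMap Complex

variable {n k : ℕ}

theorem contDiff_fbiTransformAlong (A : Rd (n + k) ≃L[ℝ] Rd (n + k))
    {Y : Submodule ℝ (Rd (n + k))} (hY : ∀ x, x ∈ Y ↔ sndVec (A x) = 0) (g : 𝓢(Rd (n + k), ℂ))
    (u : 𝓢'(Rd (n + k), ℂ)) : ContDiff ℝ ∞ (fbiTransformAlong Y g u) := by
  have h : fbiTransformAlong Y g u = (fun z : Rd (n + k) × Rd (n + k) =>
      (((2 * Real.pi) ^ (-((n + k : ℕ) : ℝ) / 2) : ℝ) : ℂ) * oscillatoryConst k A *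
        exp (I * (twistPhase A Y z.2 : ℂ)) *
          shortTime (symbolFunctional A u) (symbolWindow A g) z) ∘ (phaseEquiv A).symm := by
    funext z
    rw [Function.comp_apply, ← fbiTransformAlong_phaseEquiv A hY, Prod.mk.eta,
      ContinuousLinearEquiv.apply_symm_apply]
  rw [h]
  refine ContDiff.comp ?_ (phaseEquiv A).symm.contDiff
  refine (contDiff_const.mul (ContDiff.cexp (contDiff_const.mul (ofRealCLM.contDiff.comp
    ((contDiff_twistPhase A Y).comp contDiff_snd))))).mul (contDiff_shortTime _ _)

/-- The directions are images of vectors (v, 0), so q stays fixed; the remaining phase is a constant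
of modulus one for these derivatives. -/
theorem norm_iteratedFDeriv_fbiTransformAlong (A : Rd (n + k) ≃L[ℝ] Rd (n + k))
    {Y : Submodule ℝ (Rd (n + k))} (hY : ∀ x, x ∈ Y ↔ sndVec (A x) = 0) (g : 𝓢(Rd (n + k), ℂ))
    (u : 𝓢'(Rd (n + k), ℂ)) (p q : Rd (n + k)) (j : ℕ) (v : Fin j → Rd (n + k)) :
    ‖iteratedFDeriv ℝ j (fbiTransformAlong Y g u) (phaseEquiv A (p, q))
        fun i => phaseEquiv A (v i, 0)‖
      = ‖(((2 * Real.pi) ^ (-((n + k : ℕ) : ℝ) / 2) : ℝ) : ℂ) * oscillatoryConst k A‖ *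
        ‖iteratedFDeriv ℝ j (fun p => shortTime (symbolFunctional A u) (symbolWindow A g) (p, q)) p
          v‖ := by
  let L : Rd (n + k) →L[ℝ] PhaseSpace (n + k) :=
    (phaseEquiv A).toContinuousLinearMap ∘L ContinuousLinearMap.inl ℝ _ _
  have hL : ∀ p, phaseEquiv A (p, q) = L p + phaseEquiv A (0, q) := fun p => by
    change _ = phaseEquiv A (p, 0) + _
    rw [← map_add]
    simp
  have h1 := iteratedFDeriv_comp_affine (contDiff_fbiTransformAlong A hY g u) L
    (phaseEquiv A (0, q)) p j v
  rw [← hL] at h1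
  change ‖iteratedFDeriv ℝ j (fbiTransformAlong Y g u) (phaseEquiv A (p, q)) fun i => L (v i)‖ = _
  rw [← h1]
  simp only [← hL]
  have h2 : (fun p => fbiTransformAlong Y g u (phaseEquiv A (p, q))) = fun p =>
      ((((2 * Real.pi) ^ (-((n + k : ℕ) : ℝ) / 2) : ℝ) : ℂ) * oscillatoryConst k A *
        exp (I * (twistPhase A Y q : ℂ))) •
          shortTime (symbolFunctional A u) (symbolWindow A g) (p, q) :=
    funext fun p => fbiTransformAlong_phaseEquiv A hY g u p q
  have hs : ContDiffAt ℝ j (fun p =>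
      shortTime (symbolFunctional A u) (symbolWindow A g) (p, q)) p :=
    (((contDiff_shortTime _ _).comp (contDiff_id.prodMk contDiff_const)).of_le
      (by exact_mod_cast le_top)).contDiffAt
  rw [h2, iteratedFDeriv_const_smul_apply' hs, _root_.smul_apply, norm_smul, norm_mul,
    norm_exp_I_mul_ofReal', mul_one]

/-- Conormality in terms of symbol type estimates of the short time transform. -/
theorem isGammaConormal_iff_shortTime (m : ℝ) (A : Rd (n + k) ≃L[ℝ] Rd (n + k))
    {Y : Submodule ℝ (Rd (n + k))} (hY : ∀ x, x ∈ Y ↔ sndVec (A x) = 0)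
    {V : Submodule ℝ (PhaseSpace (n + k))} (hV : IsCompl (conormalSpace Y) V)
    (u : 𝓢'(Rd (n + k), ℂ)) : IsGammaConormal m Y V u ↔
      ∃ g : 𝓢(Rd (n + k), ℂ), g ≠ 0 ∧ ∀ j N : ℕ, ∃ C : ℝ, ∀ p q : Rd (n + k),
        ‖iteratedFDeriv ℝ j
            (fun p => shortTime (symbolFunctional A u) (symbolWindow A g) (p, q)) p‖
          ≤ C * (1 + ‖p‖) ^ (m - (j : ℝ)) * (1 + ‖q‖) ^ (-(N : ℝ)) := by
  have hN := fun p q => phaseEquiv_mem_conormalSpace A hY p q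
  obtain ⟨C₂, hC₂, hQ⟩ := one_add_infDist_le_and_ge (phaseEquiv A) hN
  obtain ⟨C₁, hC₁, hP⟩ := one_add_infDist_compl_le_and_ge (phaseEquiv A) hN hV
  set c := ‖(((2 * Real.pi) ^ (-((n + k : ℕ) : ℝ) / 2) : ℝ) : ℂ) * oscillatoryConst k A‖ with hc
  have hc0 : 0 < c :=
    norm_pos_iff.2 (mul_ne_zero (two_pi_rpow_ne_zero _) (oscillatoryConst_ne_zero k A))
  have hge : ∀ (W : Submodule ℝ (PhaseSpace (n + k))) z,
      1 ≤ 1 + Metric.infDist z (W : Set (PhaseSpace (n + k))) :=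
    fun W z => le_add_of_nonneg_right Metric.infDist_nonneg
  have hge' : ∀ x : Rd (n + k), 1 ≤ 1 + ‖x‖ := fun x => le_add_of_nonneg_right (norm_nonneg x)
  refine exists_congr fun g => and_congr_right fun _ => ⟨fun H j N => ?_, fun H j N b hb => ?_⟩
  · let N' : ℕ := N + ⌈|m - j|⌉₊
    have hN' : (N : ℝ) + |m - j| ≤ N' := by
      simp only [N']
      push_cast
      linarith [Nat.le_ceil |m - j|]
    -- Conormality supplies one constant per tuple of directions; the finitely many basis tuples
    -- suffice for the full derivative.
    obtain ⟨B, hB0, hB⟩ := exists_norm_multilinear_le_sum (X := Rd (n + k)) (F := ℂ) j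
    choose C hC using fun r : Fin j → Fin (Module.finrank ℝ (Rd (n + k))) =>
      H j N' (fun i => phaseEquiv A (Module.finBasis ℝ (Rd (n + k)) (r i), 0))
        fun i => (hN _ _).2 rfl
    refine ⟨B * ∑ r, c⁻¹ * |C r| * (C₁ ^ |m - j| * C₂ ^ (N' : ℝ)), fun p q => (hB _).trans ?_⟩
    rw [mul_assoc, mul_assoc, Finset.sum_mul]
    refine mul_le_mul_of_nonneg_left (Finset.sum_le_sum fun r _ => ?_) hB0
    have h1 := hC r (phaseEquiv A (p, q))
    rw [norm_iteratedFDeriv_fbiTransformAlong A hY, ← hc] at h1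
    have h2 := weight_mul_weight_le (m - j) N N' hN' (hge V (phaseEquiv A (p, q))) (hge' p)
      (hge (conormalSpace Y) (phaseEquiv A (p, q))) (hge' q) hC₁ hC₂ (hP p q).1 (hP p q).2
      (hQ p q).2
    rw [mul_assoc (c⁻¹), mul_assoc (c⁻¹), ← div_eq_inv_mul, le_div_iff₀' hc0]
    refine h1.trans ?_
    rw [mul_assoc, mul_assoc |C r|]
    exact mul_le_mul (le_abs_self _) h2 (mul_nonneg
      (Real.rpow_nonneg (zero_le_one.trans (hge _ _)) _)
      (Real.rpow_nonneg (zero_le_one.trans (hge _ _)) _)) (abs_nonneg _)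
  · let N' : ℕ := N + ⌈|m - j|⌉₊
    have hN' : (N : ℝ) + |m - j| ≤ N' := by
      simp only [N']
      push_cast
      linarith [Nat.le_ceil |m - j|]
    obtain ⟨C, hC⟩ := H j N'
    -- Vectors of N(Y) have q = 0, so their p-components determine them.
    let v : Fin j → Rd (n + k) := fun i => ((phaseEquiv A).symm (b i)).1
    have hv : b = fun i => phaseEquiv A (v i, 0) := by
      funext i
      have h1 := (hN ((phaseEquiv A).symm (b i)).1 ((phaseEquiv A).symm (b i)).2).1 (by
        simpa using hb i)
      rw [← h1, Prod.mk.eta, ContinuousLinearEquiv.apply_symm_apply]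
    refine ⟨c * (|C| * ((C₁ * C₂) ^ |m - j| * C₂ ^ (N' : ℝ)) * ∏ i, ‖v i‖), fun z => ?_⟩
    obtain ⟨⟨p, q⟩, rfl⟩ := (phaseEquiv A).surjective z
    rw [hv, norm_iteratedFDeriv_fbiTransformAlong A hY, ← hc, mul_assoc, mul_assoc c]
    refine mul_le_mul_of_nonneg_left ?_ hc0.le
    have hD := hge (conormalSpace Y) (phaseEquiv A (p, q))
    -- The roles of the two coordinate systems are now exchanged, so the loss must be expressed by
    -- the distance to N(Y) instead of ‖q‖; this turns C₁ into C₁ * C₂.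
    have h3 : C₁ * (1 + ‖q‖) ≤ C₁ * C₂ * (1 + Metric.infDist (phaseEquiv A (p, q))
        (conormalSpace Y)) := by
      rw [mul_assoc]
      exact mul_le_mul_of_nonneg_left (hQ p q).2 (by linarith)
    have h2 := weight_mul_weight_le (m - j) N N' hN' (hge' p) (hge V (phaseEquiv A (p, q)))
      (hge' q) hD (by nlinarith : 1 ≤ C₁ * C₂) hC₂
      ((hP p q).2.trans (mul_le_mul_of_nonneg_right h3 (by linarith [hge V (phaseEquiv A (p, q))])))
      ((hP p q).1.trans (mul_le_mul_of_nonneg_right h3 (by linarith [hge' p]))) (hQ p q).1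
    calc _ ≤ ‖iteratedFDeriv ℝ j
            (fun p => shortTime (symbolFunctional A u) (symbolWindow A g) (p, q)) p‖ *
              ∏ i, ‖v i‖ := ContinuousMultilinearMap.le_opNorm _ _
      _ ≤ (|C| * ((1 + ‖p‖) ^ (m - (j : ℝ)) * (1 + ‖q‖) ^ (-(N' : ℝ)))) * ∏ i, ‖v i‖ := by
          refine mul_le_mul_of_nonneg_right ((hC p q).trans ?_)
            (Finset.prod_nonneg fun i _ => norm_nonneg _)
          rw [mul_assoc]
          exact mul_le_mul_of_nonneg_right (le_abs_self C) (by positivity)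
      _ ≤ (|C| * ((C₁ * C₂) ^ |m - j| * C₂ ^ (N' : ℝ) *
            ((1 + Metric.infDist (phaseEquiv A (p, q)) V) ^ (m - (j : ℝ)) *
              (1 + Metric.infDist (phaseEquiv A (p, q)) (conormalSpace Y)) ^ (-(N : ℝ))))) *
            ∏ i, ‖v i‖ := by
          refine mul_le_mul_of_nonneg_right (mul_le_mul_of_nonneg_left h2 (abs_nonneg C))
            (Finset.prod_nonneg fun i _ => norm_nonneg _)
      _ = _ := by ring

theorem exists_ne_zero_schwartz (d : ℕ) : ∃ g : 𝓢(Rd d, ℂ), g ≠ 0 := by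
  obtain ⟨g, hg⟩ := exists_schwartz_bump (0 : Rd d)
  refine ⟨g, fun h => ?_⟩
  have := hg.self_of_nhds
  simp [h] at this

/-- Conormal distributions are the oscillatory integrals with a Shubin amplitude. -/
theorem isGammaConormal_iff_exists_symbol (m : ℝ) (A : Rd (n + k) ≃L[ℝ] Rd (n + k))
    {Y : Submodule ℝ (Rd (n + k))} (hY : ∀ x, x ∈ Y ↔ sndVec (A x) = 0)
    {V : Submodule ℝ (PhaseSpace (n + k))} (hV : IsCompl (conormalSpace Y) V)
    (u : 𝓢'(Rd (n + k), ℂ)) : IsGammaConormal m Y V u ↔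
      ∃ a : Rd (n + k) → ℂ, IsShubinSymbol m a ∧
        IsOscillatoryIntegral (fun (x : Rd (n + k)) (θ : Rd k) => inner ℝ (sndVec (A x)) θ)
          (fun (x : Rd (n + k)) (θ : Rd k) => a (joinVec (fstVec (A x)) θ)) u := by
  rw [isGammaConormal_iff_shortTime m A hY hV u]
  constructor
  · rintro ⟨g, hg, H⟩
    obtain ⟨a, ha, h⟩ := exists_symbol_of_shortTime (symbolFunctional A u) (symbolWindow A g)
      (symbolWindow_ne_zero A hg) H
    exact ⟨a, ha, (ha.isOscillatoryIntegral_iff_symbolFunctional A u).2 h⟩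
  -- For a symbol the estimates hold for every window, so any nonzero g serves.
  · rintro ⟨a, ha, h⟩
    obtain ⟨g, hg⟩ := exists_ne_zero_schwartz (n + k)
    exact ⟨g, hg, exists_shortTime_le_of_symbol ha (symbolFunctional A u)
      ((ha.isOscillatoryIntegral_iff_symbolFunctional A u).1 h) (symbolWindow A g)⟩

end GammaConormal

/-! ### Adapted matrices and the model case -/

section Adapted

open SchwartzMap Complex

variable {n k : ℕ}

theorem toEuclideanLin_transpose_apply {d l : ℕ} (M : Matrix (Fin d) (Fin l) ℝ) (x : Rd d)
    (j : Fin l) : M.transpose.toEuclideanLin x j = inner ℝ (WithLp.toLp 2 fun i => M i j : Rd d) x := by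
  simp [Matrix.toLpLin_apply, Matrix.mulVec, dotProduct, PiLp.inner_apply, mul_comm]

theorem fstVec_blockMatrix_transpose (M₁ : Matrix (Fin (n + k)) (Fin n) ℝ)
    (M₂ : Matrix (Fin (n + k)) (Fin k) ℝ) (x : Rd (n + k)) :
    fstVec ((blockMatrix M₁ M₂).transpose.toEuclideanLin x) = M₁.transpose.toEuclideanLin x := by
  ext j
  rw [toEuclideanLin_transpose_apply]
  change (blockMatrix M₁ M₂).transpose.toEuclideanLin x (Fin.castAdd k j) = _
  rw [toEuclideanLin_transpose_apply]
  simp [blockMatrix]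

theorem sndVec_blockMatrix_transpose (M₁ : Matrix (Fin (n + k)) (Fin n) ℝ)
    (M₂ : Matrix (Fin (n + k)) (Fin k) ℝ) (x : Rd (n + k)) :
    sndVec ((blockMatrix M₁ M₂).transpose.toEuclideanLin x) = M₂.transpose.toEuclideanLin x := by
  ext j
  rw [toEuclideanLin_transpose_apply]
  change (blockMatrix M₁ M₂).transpose.toEuclideanLin x (Fin.natAdd n j) = _
  rw [toEuclideanLin_transpose_apply]
  simp [blockMatrix]

theorem toEuclideanLin_injective_iff_isUnit {d : ℕ} (M : Matrix (Fin d) (Fin d) ℝ) :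
    Function.Injective M.toEuclideanLin ↔ IsUnit M := by
  rw [← Matrix.mulVec_injective_iff_isUnit]
  have h : (M.toEuclideanLin : Rd d → Rd d) = WithLp.toLp 2 ∘ M.mulVec ∘ WithLp.ofLp := rfl
  rw [h, (WithLp.toLp_injective 2).of_comp_iff,
    Function.Injective.of_comp_iff' _ (WithLp.ofLp_bijective 2)]

/-- The automorphism is x ↦ [M₁ M₂]ᵗ x, whose two blocks are M₁ᵗx and M₂ᵗx. -/
theorem IsAdapted.exists_equiv {Y : Submodule ℝ (Rd (n + k))}
    {M₁ : Matrix (Fin (n + k)) (Fin n) ℝ} {M₂ : Matrix (Fin (n + k)) (Fin k) ℝ}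
    (h : IsAdapted Y M₁ M₂) : ∃ A : Rd (n + k) ≃L[ℝ] Rd (n + k),
      (∀ x, fstVec (A x) = M₁.transpose.toEuclideanLin x) ∧
      (∀ x, sndVec (A x) = M₂.transpose.toEuclideanLin x) ∧
      ∀ x, x ∈ Y ↔ sndVec (A x) = 0 := by
  have hinj := (toEuclideanLin_injective_iff_isUnit _).2 ((Matrix.isUnit_transpose _).2 h.2)
  refine ⟨(LinearEquiv.ofInjectiveEndo _ hinj).toContinuousLinearEquiv,
    fstVec_blockMatrix_transpose M₁ M₂, sndVec_blockMatrix_transpose M₁ M₂, fun x => ?_⟩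
  rw [h.1, LinearMap.mem_ker]
  exact (sndVec_blockMatrix_transpose M₁ M₂ x) ▸ Iff.rfl

theorem mem_orthogonal_of_basis {d l : ℕ} {Y : Submodule ℝ (Rd d)}
    (b : Module.Basis (Fin l) ℝ Y) {x : Rd d} (h : ∀ j, (inner ℝ (b j : Rd d) x : ℝ) = 0) :
    x ∈ Yᗮ := by
  rw [Submodule.mem_orthogonal]
  intro y hy
  have h1 : ((innerₗ (Rd d)).flip x) ∘ₗ Y.subtype = 0 := b.ext fun j => h j
  exact LinearMap.congr_fun h1 ⟨y, hy⟩

/-- Take bases of Y and of Y^⊥ as columns of M₁ and M₂. Then Ker M₂ᵗ = Y^⊥⊥ = Y, and [M₁ M₂]ᵗ has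
kernel Y^⊥ ∩ Y = 0. -/
theorem exists_isAdapted {Y : Submodule ℝ (Rd (n + k))} (hY : Module.finrank ℝ Y = n) :
    ∃ (M₁ : Matrix (Fin (n + k)) (Fin n) ℝ) (M₂ : Matrix (Fin (n + k)) (Fin k) ℝ),
      IsAdapted Y M₁ M₂ := by
  have hY' : Module.finrank ℝ Yᗮ = k := by
    have := Submodule.finrank_add_finrank_orthogonal Y
    rw [hY, finrank_euclideanSpace_fin] at this
    omega
  let b₁ := Module.finBasisOfFinrankEq ℝ Y hY
  let b₂ := Module.finBasisOfFinrankEq ℝ Yᗮ hY'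
  let M₁ : Matrix (Fin (n + k)) (Fin n) ℝ := Matrix.of fun i j => (b₁ j : Rd (n + k)) i
  let M₂ : Matrix (Fin (n + k)) (Fin k) ℝ := Matrix.of fun i j => (b₂ j : Rd (n + k)) i
  have h₁ : ∀ x j, M₁.transpose.toEuclideanLin x j = inner ℝ (b₁ j : Rd (n + k)) x :=
    fun x j => toEuclideanLin_transpose_apply M₁ x j
  have h₂ : ∀ x j, M₂.transpose.toEuclideanLin x j = inner ℝ (b₂ j : Rd (n + k)) x :=
    fun x j => toEuclideanLin_transpose_apply M₂ x j
  have hker : ∀ x, M₂.transpose.toEuclideanLin x = 0 → x ∈ Y := fun x hx => by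
    rw [← Submodule.orthogonal_orthogonal Y]
    exact mem_orthogonal_of_basis b₂ fun j => by rw [← h₂, hx]; rfl
  refine ⟨M₁, M₂, ?_, ?_⟩
  · ext x
    rw [LinearMap.mem_ker]
    refine ⟨fun hx => ?_, hker x⟩
    ext j
    rw [h₂]
    exact Submodule.inner_left_of_mem_orthogonal hx (b₂ j).2
  · rw [← Matrix.isUnit_transpose, ← toEuclideanLin_injective_iff_isUnit, ← LinearMap.ker_eq_bot,
      LinearMap.ker_eq_bot']
    intro x hx
    have hx₁ : M₁.transpose.toEuclideanLin x = 0 := by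
      rw [← fstVec_blockMatrix_transpose M₁ M₂, hx]
      rfl
    have hx₂ : M₂.transpose.toEuclideanLin x = 0 := by
      rw [← sndVec_blockMatrix_transpose M₁ M₂, hx]
      rfl
    have hx₃ : x ∈ Yᗮ := mem_orthogonal_of_basis b₁ fun j => by rw [← h₁, hx₁]; rfl
    exact inner_self_eq_zero.1 (Submodule.inner_right_of_mem_orthogonal (hker x hx₂) hx₃)

theorem isGammaConormal_iff_of_isAdapted (m : ℝ) {Y : Submodule ℝ (Rd (n + k))}
    {M₁ : Matrix (Fin (n + k)) (Fin n) ℝ} {M₂ : Matrix (Fin (n + k)) (Fin k) ℝ}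
    (h : IsAdapted Y M₁ M₂) {V : Submodule ℝ (PhaseSpace (n + k))}
    (hV : IsCompl (conormalSpace Y) V) (u : 𝓢'(Rd (n + k), ℂ)) :
    IsGammaConormal m Y V u ↔
      ∃ a : Rd (n + k) → ℂ, IsShubinSymbol m a ∧ IsLinearOscillatoryIntegral M₁ M₂ a u := by
  obtain ⟨A, h₁, h₂, hY⟩ := h.exists_equiv
  rw [isGammaConormal_iff_exists_symbol m A hY hV u]
  simp only [h₁, h₂]
  rfl

theorem IsShubinSymbol.const_mul {d : ℕ} {m : ℝ} {a : Rd d → ℂ} (ha : IsShubinSymbol m a)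
    (c : ℂ) : IsShubinSymbol m fun z => c * a z := by
  refine ⟨contDiff_const.mul ha.1, fun j => ?_⟩
  obtain ⟨C, hC⟩ := ha.2 j
  refine ⟨‖c‖ * C, fun z => ?_⟩
  have h := iteratedFDeriv_const_smul_apply' (𝕜 := ℝ) (a := c) (i := j) (x := z) (f := a)
    (ha.1.of_le (by exact_mod_cast le_top)).contDiffAt
  simp only [smul_eq_mul] at h
  rw [h, norm_smul, mul_assoc]
  exact mul_le_mul_of_nonneg_left (hC z) (norm_nonneg c)

/-- This is the case A = id, where the determinant is 1 and the constant of the oscillatory integral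
cancels the prefactor (2π)^{-k/2}. -/
theorem IsShubinSymbol.isOscillatoryIntegral_iff_isPartialFourierInv {m : ℝ}
    {a : Rd (n + k) → ℂ} (ha : IsShubinSymbol m a) (u : 𝓢'(Rd (n + k), ℂ)) :
    IsOscillatoryIntegral (fun (x : Rd (n + k)) (θ : Rd k) => inner ℝ (sndVec x) θ)
        (fun (x : Rd (n + k)) (θ : Rd k) =>
          (((2 * Real.pi) ^ (-(k : ℝ) / 2) : ℝ) : ℂ) * a (joinVec (fstVec x) θ)) u ↔
      IsPartialFourierInv a u := by
  refine ((ha.const_mul _).isOscillatoryIntegral_iff (ContinuousLinearEquiv.refl ℝ _) u).trans ?_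
  refine forall_congr' fun φ => ?_
  have h1 : compCLMOfContinuousLinearEquiv ℂ
      (ContinuousLinearEquiv.refl ℝ (Rd (n + k))).symm φ = φ := by
    ext x
    rfl
  have h2 : oscillatoryConst k (ContinuousLinearEquiv.refl ℝ (Rd (n + k)))
      = (((2 * Real.pi) ^ (-(k : ℝ) / 2) : ℝ) : ℂ)⁻¹ := by
    rw [oscillatoryConst, show ((ContinuousLinearEquiv.refl ℝ (Rd (n + k)) :
      Rd (n + k) ≃L[ℝ] Rd (n + k)) : Rd (n + k) →ₗ[ℝ] Rd (n + k)) = LinearMap.id from rfl]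
    simp
  simp only [h1, h2, mul_assoc, partialFourierInvCLM_apply]
  rw [integral_const_mul, inv_mul_cancel_left₀ (two_pi_rpow_ne_zero _)]
  exact ⟨fun h => ⟨ha.integrable_mul (partialFourierInvCLM n k φ), h⟩, fun h => h.2⟩

/-- Again A = id; the prefactor is absorbed in the amplitude, since Shubin classes are stable under
scalars. -/
theorem isGammaConormal_coordSubspace_iff (m : ℝ) {V : Submodule ℝ (PhaseSpace (n + k))}
    (hV : IsCompl (conormalSpace (coordSubspace n k)) V) (u : 𝓢'(Rd (n + k), ℂ)) :
    IsGammaConormal m (coordSubspace n k) V u ↔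
      ∃ a : Rd (n + k) → ℂ, IsShubinSymbol m a ∧
        IsOscillatoryIntegral (fun (x : Rd (n + k)) (θ : Rd k) => inner ℝ (sndVec x) θ)
          (fun (x : Rd (n + k)) (θ : Rd k) =>
            (((2 * Real.pi) ^ (-(k : ℝ) / 2) : ℝ) : ℂ) * a (joinVec (fstVec x) θ)) u := by
  refine (isGammaConormal_iff_exists_symbol m (ContinuousLinearEquiv.refl ℝ _)
    (fun x => Iff.rfl) hV u).trans ⟨?_, ?_⟩
  · rintro ⟨a, ha, h⟩
    refine ⟨_, ha.const_mul (((2 * Real.pi) ^ (-(k : ℝ) / 2) : ℝ) : ℂ)⁻¹, ?_⟩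
    simp only [mul_inv_cancel_left₀ (two_pi_rpow_ne_zero _)]
    exact h
  · rintro ⟨a, ha, h⟩
    exact ⟨_, ha.const_mul _, h⟩

end Adapted

theorem mainTheorem3 (n k : ℕ) (m : ℝ) (u : 𝓢'(Rd (n + k), ℂ)) :
    -- characterization for a general `n`-dimensional subspace `Y`
    (∀ (Y : Submodule ℝ (Rd (n + k))), Module.finrank ℝ Y = n →
      ∀ (V : Submodule ℝ (PhaseSpace (n + k))), IsCompl (conormalSpace Y) V →
        (IsGammaConormal m Y V u ↔
          ∃ (M₁ : Matrix (Fin (n + k)) (Fin n) ℝ) (M₂ : Matrix (Fin (n + k)) (Fin k) ℝ),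
            IsAdapted Y M₁ M₂ ∧
            ∃ a : Rd (n + k) → ℂ, IsShubinSymbol m a ∧ IsLinearOscillatoryIntegral M₁ M₂ a u) ∧
        (∀ (M₁ : Matrix (Fin (n + k)) (Fin n) ℝ) (M₂ : Matrix (Fin (n + k)) (Fin k) ℝ),
          IsAdapted Y M₁ M₂ →
            (IsGammaConormal m Y V u ↔
              ∃ a : Rd (n + k) → ℂ,
                IsShubinSymbol m a ∧ IsLinearOscillatoryIntegral M₁ M₂ a u))) ∧
    -- the model case `Y = ℝⁿ × {0}`
    (∀ (V : Submodule ℝ (PhaseSpace (n + k))), IsCompl (conormalSpace (coordSubspace n k)) V →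
      (IsGammaConormal m (coordSubspace n k) V u ↔
        ∃ a : Rd (n + k) → ℂ, IsShubinSymbol m a ∧
          IsOscillatoryIntegral (fun (x : Rd (n + k)) (θ : Rd k) => inner ℝ (sndVec x) θ)
            (fun (x : Rd (n + k)) (θ : Rd k) =>
              (((2 * Real.pi) ^ (-(k : ℝ) / 2) : ℝ) : ℂ) * a (joinVec (fstVec x) θ)) u)) ∧
    (∀ a : Rd (n + k) → ℂ, IsShubinSymbol m a →
      (IsOscillatoryIntegral (fun (x : Rd (n + k)) (θ : Rd k) => inner ℝ (sndVec x) θ)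
          (fun (x : Rd (n + k)) (θ : Rd k) =>
            (((2 * Real.pi) ^ (-(k : ℝ) / 2) : ℝ) : ℂ) * a (joinVec (fstVec x) θ)) u ↔
        IsPartialFourierInv a u)) := by
  refine ⟨fun Y hY V hV => ⟨⟨fun h => ?_, ?_⟩, fun M₁ M₂ hM =>
      isGammaConormal_iff_of_isAdapted m hM hV u⟩,
    fun V hV => isGammaConormal_coordSubspace_iff m hV u,
    fun a ha => ha.isOscillatoryIntegral_iff_isPartialFourierInv u⟩
  -- The existential form needs one adapted pair, which exists because dim Y = n.
  · obtain ⟨M₁, M₂, hM⟩ := exists_isAdapted hY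
    exact ⟨M₁, M₂, hM, (isGammaConormal_iff_of_isAdapted m hM hV u).1 h⟩
  · rintro ⟨M₁, M₂, hM, h⟩
    exact (isGammaConormal_iff_of_isAdapted m hM hV u).2 h
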